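/- Let $\Omega\subset\mathbb R^2$ be a bounded domain (for instance with smooth boundary; no regularity of $\partial\Omega$ is needed). Let $a_1,a_2,b_1,b_2>0$ and $\theta_1,\theta_2>1$, and put $\theta_{max}=\max\{\theta_1,\theta_2\}$. Let $H_0^1(\Omega)$ be the closure of $C_c^\infty(\Omega)$ in $H^1(\Omega)$, let $\|w\|=\left(\int_\Omega|\nabla w|^2dx\right)^{1/2}$ for $w\in H^1_0(\Omega)$, and let $H^1_0(\Omega,\mathbb R^2)=H^1_0(\Omega)\times H^1_0(\Omega)$. Let $H(x,W)$, $W=(u,v)\in\mathbb R^2$, be a real function with $H(x,\cdot)\in C^1(\mathbb R^2)$ for every $x\in\Omega$, and let $\nabla H=(H_u,H_v)$ be its gradient in $W$. Suppose that $H$ and $\nabla H$ are continuous on $\Omega\times\mathbb R^2$ and that $\nabla H$ is bounded on $\Omega\times\{|W|\le r\}$ for every $r>0$ (all of this holds if $H\in C^1(\overline\Omega\times\mathbb R^2)$). Suppose further: - (subcritical growth) for every $\beta>0$, $\displaystyle\lim_{|W|\to\infty}\frac{|H_u(x,W)|}{\exp(\beta|W|^2)}=\lim_{|W|\to\infty}\frac{|H_v(x,W)|}{\exp(\beta|W|^2)}=0$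 uniformly in $x\in\Omega$; - $(H_1)$ $H(x,W)\ge0$, $uH_u(x,W)\ge0$ and $vH_v(x,W)\ge0$ for all $x\in\Omega$ and $W=(u,v)\in\mathbb R^2$; - $(H_2)$ there are constants $S_0,M_0>0$ such that $0<H(x,W)\le M_0|\nabla H(x,W)|$ for all $x\in\Omega$ and $|W|\ge S_0$; - $(\overline{H_2})$ there are $\mu\ge2\theta_{max}$ and $R>0$ such that $0<\mu H(x,W)\le W\cdot\nabla H(x,W)$ for all $x\in\Omega$ and $|W|\ge R$; - $(SL)$ $\displaystyle\limsup_{|W|\to0}\frac{H(x,W)}{|W|^2}=0$ uniformly in $x\in\Omega$. Then for every $\lambda>0$ the system $$-\big(a_1+b_1\|u\|^{2(\theta_1-1)}\big)\Delta u=\lambda H_u(x,u,v),\quad -\big(a_2+b_2\|v\|^{2(\theta_2-1)}\big)\Delta v=\lambda H_v(x,u,v)\ \text{ in }\Omega,\qquad u=v=0\ \text{ on }\partial\Omega,$$ has at least one nontrivial weak solution: there is $W=(u,v)\in H^1_0(\Omega,\mathbb R^2)$, $W\ne(0,0)$, such that for all $\Phi=(\varphi,\psi)\in H^1_0(\Omega,\mathbb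 R^2)$ the function $\Phi\cdot\nabla H(x,W)$ is integrable on $\Omega$ and $$\big(a_1+b_1\|u\|^{2(\theta_1-1)}\big)\int_\Omega\nabla u\cdot\nabla\varphi\,dx+\big(a_2+b_2\|v\|^{2(\theta_2-1)}\big)\int_\Omega\nabla v\cdot\nabla\psi\,dx=\lambda\int_\Omega\Phi\cdot\nabla H(x,W)\,dx .$$ -/

import Mathlib

open MeasureTheory Filter Topology
open scoped ContDiff ENNReal

noncomputable section

namespace Kirchhoff

/-- The Euclidean plane; it serves both as the space of points `x` and as the space of values
`W = (u, v)`. Its norm is the Euclidean norm. -/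
abbrev Plane : Type := EuclideanSpace ℝ (Fin 2)

/-- `φ ∈ C_c^∞(Ω)`. -/
structure IsTestFunction (Ω : Set Plane) (φ : Plane → ℝ) : Prop where
  smooth : ContDiff ℝ ∞ φ
  compact : HasCompactSupport φ
  support : tsupport φ ⊆ Ω

/-- The Hilbert space `L²(Ω) × L²(Ω, ℝ²)`, with norm `(‖f‖₂² + ‖g‖₂²)^{1/2}`. -/
abbrev L2Pair (Ω : Set Plane) : Type :=
  WithLp 2 (Lp ℝ 2 (volume.restrict Ω) × Lp Plane 2 (volume.restrict Ω))

/-- The pairs `(φ, ∇φ)` with `φ ∈ C_c^∞(Ω)`. -/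
def testPairs (Ω : Set Plane) : Submodule ℝ (L2Pair Ω) where
  carrier := {p | ∃ φ : Plane → ℝ, IsTestFunction Ω φ ∧
    p.fst =ᵐ[volume.restrict Ω] φ ∧ p.snd =ᵐ[volume.restrict Ω] gradient φ}
  zero_mem' := by
    refine ⟨fun _ => 0, ⟨contDiff_const, HasCompactSupport.zero, ?_⟩, ?_, ?_⟩
    · rw [show tsupport (fun _ : Plane => (0 : ℝ)) = ∅ from tsupport_eq_empty_iff.2 rfl]
      exact Set.empty_subset _
    · exact Lp.coeFn_zero _ _ _
    · filter_upwards [Lp.coeFn_zero Plane 2 (volume.restrict Ω)] with x hx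
      rw [show gradient (fun _ : Plane => (0 : ℝ)) x = 0 from gradient_const x 0]
      exact hx
  add_mem' := by
    rintro p q ⟨φ, hφ, hp1, hp2⟩ ⟨ψ, hψ, hq1, hq2⟩
    refine ⟨φ + ψ, ⟨hφ.smooth.add hψ.smooth, hφ.compact.add hψ.compact, ?_⟩, ?_, ?_⟩
    · exact (tsupport_add φ ψ).trans (Set.union_subset hφ.support hψ.support)
    · filter_upwards [Lp.coeFn_add p.fst q.fst, hp1, hq1] with x h h1 h2
      rw [show (p + q).fst = p.fst + q.fst from rfl, h, Pi.add_apply, h1, h2, Pi.add_apply]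
    · filter_upwards [Lp.coeFn_add p.snd q.snd, hp2, hq2] with x h h1 h2
      have d1 := (hφ.smooth.differentiable (by simp) x)
      have d2 := (hψ.smooth.differentiable (by simp) x)
      rw [show (p + q).snd = p.snd + q.snd from rfl, h, Pi.add_apply, h1, h2, gradient, gradient,
        gradient, fderiv_add d1 d2, map_add]
  smul_mem' := by
    rintro c p ⟨φ, hφ, hp1, hp2⟩
    refine ⟨c • φ, ⟨contDiff_const.smul hφ.smooth, hφ.compact.smul_left, ?_⟩, ?_, ?_⟩
    · exact (closure_mono (Function.support_const_smul_subset c φ)).trans hφ.support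
    · filter_upwards [Lp.coeFn_smul c p.fst, hp1] with x h h1
      rw [show (c • p).fst = c • p.fst from rfl, h, Pi.smul_apply, h1, Pi.smul_apply]
    · filter_upwards [Lp.coeFn_smul c p.snd, hp2] with x h h1
      have d1 := (hφ.smooth.differentiable (by simp) x)
      rw [show (c • p).snd = c • p.snd from rfl, h, Pi.smul_apply, h1, gradient,
        gradient, fderiv_const_smul d1, map_smulₛₗ]
      simp

/-- The Sobolev space `H^1_0(Ω)`, the closure of `C_c^∞(Ω)` in the `H¹` norm. A function `w` in it is
recorded together with its weak gradient, as the pair `(w, ∇w)`. -/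
abbrev H10 (Ω : Set Plane) : Type := (testPairs Ω).topologicalClosure

namespace H10

variable {Ω : Set Plane}

/-- The function `w : Ω → ℝ` (an `L²` class). -/
def fn (w : H10 Ω) : Lp ℝ 2 (volume.restrict Ω) := w.1.fst

/-- The weak gradient `∇w : Ω → ℝ²` (an `L²` class). -/
def grad (w : H10 Ω) : Lp Plane 2 (volume.restrict Ω) := w.1.snd

/-- `∇w` is the distributional gradient of `w` (so `w` determines it). -/
theorem integral_fn_mul (w : H10 Ω) {η : Plane → ℝ}
    (hη : IsTestFunction Ω η) (e : Plane) :
    ∫ x in Ω, w.fn x * fderiv ℝ η x e = - ∫ x in Ω, inner ℝ (w.grad x) (η x • e) := by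
  have c1 : Continuous (fun x => fderiv ℝ η x e) :=
    (hη.smooth.continuous_fderiv (by simp)).clm_apply continuous_const
  have s1 : HasCompactSupport (fun x => fderiv ℝ η x e) := hη.compact.fderiv_apply (𝕜 := ℝ) e
  have c2 : Continuous (fun x => η x • e) := hη.smooth.continuous.smul continuous_const
  have s2 : HasCompactSupport (fun x => η x • e) := hη.compact.smul_right
  have m1 : MemLp (fun x => fderiv ℝ η x e) 2 (volume.restrict Ω) :=
    (c1.memLp_of_hasCompactSupport s1).restrict Ω
  have m2 : MemLp (fun x => η x • e) 2 (volume.restrict Ω) :=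
    (c2.memLp_of_hasCompactSupport s2).restrict Ω
  have key : ∀ p : L2Pair Ω, p ∈ closure (testPairs Ω : Set (L2Pair Ω)) →
      inner ℝ p.fst (m1.toLp _) + inner ℝ p.snd (m2.toLp _) = 0 := by
    intro p hp
    refine closure_minimal (t := {p : L2Pair Ω |
      inner ℝ p.fst (m1.toLp _) + inner ℝ p.snd (m2.toLp _) = 0}) ?_ ?_ hp
    · rintro p ⟨φ, hφ, h1, h2⟩
      have hz : ∀ x ∉ Ω, φ x = 0 := fun x hx => image_eq_zero_of_notMem_tsupport
        fun h => hx (hφ.support h)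
      have hz' : ∀ x ∉ Ω, η x = 0 := fun x hx => image_eq_zero_of_notMem_tsupport
        fun h => hx (hη.support h)
      have e1 : inner ℝ p.fst (m1.toLp _) = ∫ x, φ x * fderiv ℝ η x e := by
        rw [L2.inner_def, ← setIntegral_eq_integral_of_forall_compl_eq_zero (s := Ω)
          (f := fun x => φ x * fderiv ℝ η x e) (fun x hx => by rw [hz x hx, zero_mul])]
        refine integral_congr_ae ?_
        filter_upwards [h1, m1.coeFn_toLp] with x hx hx'
        rw [hx, hx']
        simp [mul_comm]
      have e2 : inner ℝ p.snd (m2.toLp _) = ∫ x, fderiv ℝ φ x e * η x := by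
        rw [L2.inner_def, ← setIntegral_eq_integral_of_forall_compl_eq_zero (s := Ω)
          (f := fun x => fderiv ℝ φ x e * η x) (fun x hx => by rw [hz' x hx, mul_zero])]
        refine integral_congr_ae ?_
        filter_upwards [h2, m2.coeFn_toLp] with x hx hx'
        rw [hx, hx', inner_smul_right, gradient, InnerProductSpace.toDual_symm_apply, mul_comm]
      have c3 : Continuous (fun x => fderiv ℝ φ x e) :=
        (hφ.smooth.continuous_fderiv (by simp)).clm_apply continuous_const
      change _ + _ = _
      rw [e1, e2, integral_mul_fderiv_eq_neg_fderiv_mul_of_integrable, neg_add_cancel]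
      · exact (c3.mul hη.smooth.continuous).integrable_of_hasCompactSupport hη.compact.mul_left
      · exact (hφ.smooth.continuous.mul c1).integrable_of_hasCompactSupport s1.mul_left
      · exact (hφ.smooth.continuous.mul hη.smooth.continuous).integrable_of_hasCompactSupport
          hη.compact.mul_left
      · exact fun x _ => hφ.smooth.differentiable (by simp) x
      · exact fun x _ => hη.smooth.differentiable (by simp) x
    · refine isClosed_eq ?_ continuous_const
      exact ((WithLp.prod_continuous_ofLp 2 _ _).fst.inner continuous_const).add
        ((WithLp.prod_continuous_ofLp 2 _ _).snd.inner continuous_const)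
  have h := key w.1 w.2
  rw [L2.inner_def, L2.inner_def] at h
  rw [eq_neg_iff_add_eq_zero, ← h]
  congr 1
  · refine integral_congr_ae ?_
    filter_upwards [m1.coeFn_toLp] with x hx
    rw [hx]
    simp [fn, mul_comm]
  · refine integral_congr_ae ?_
    filter_upwards [m2.coeFn_toLp] with x hx
    rw [hx]
    rfl

/-- The scalar product `∫_Ω ∇w · ∇φ dx` of `H^1_0(Ω)`. -/
def dirichlet (w φ : H10 Ω) : ℝ := ∫ x in Ω, inner ℝ (w.grad x) (φ.grad x)

/-- The norm `‖w‖ = (∫_Ω |∇w|² dx)^{1/2}` of `H^1_0(Ω)`. -/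
def dnorm (w : H10 Ω) : ℝ := Real.sqrt (∫ x in Ω, ‖w.grad x‖ ^ 2)

end H10

/-- `∇H(x, W)`, the gradient of `H` in the variables `W = (u, v)`. -/
def gradW (H : Plane → Plane → ℝ) (x W : Plane) : Plane := gradient (H x) W

/-- `H_u`. -/
def Hu (H : Plane → Plane → ℝ) (x W : Plane) : ℝ := gradW H x W 0

/-- `H_v`. -/
def Hv (H : Plane → Plane → ℝ) (x W : Plane) : ℝ := gradW H x W 1

/-- Regularity of `H`: `H(x, ·)` is `C¹`, `H` and `∇H` are continuous on `Ω × ℝ²`, and `∇H` is bounded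
on `Ω × {|W| ≤ r}` for every `r`. All this holds when `H` is `C¹` on `closure Ω × ℝ²`. -/
structure Regular (Ω : Set Plane) (H : Plane → Plane → ℝ) : Prop where
  contDiff : ∀ x ∈ Ω, ContDiff ℝ 1 (H x)
  cont : ContinuousOn (fun p : Plane × Plane => H p.1 p.2) (Ω ×ˢ Set.univ)
  cont_gradW : ContinuousOn (fun p : Plane × Plane => gradW H p.1 p.2) (Ω ×ˢ Set.univ)
  bdd_gradW : ∀ r : ℝ, ∃ C : ℝ, ∀ x ∈ Ω, ∀ W : Plane, ‖W‖ ≤ r → ‖gradW H x W‖ ≤ C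

/-- Subcritical growth: `|h(x, W)| / exp(β|W|²) → 0` as `|W| → ∞`, uniformly in `x ∈ Ω`, for all
`β > 0`. -/
def SubcriticalGrowth (Ω : Set Plane) (h : Plane → Plane → ℝ) : Prop :=
  ∀ β : ℝ, 0 < β → TendstoUniformlyOn
    (fun (W x : Plane) => |h x W| / Real.exp (β * ‖W‖ ^ 2)) (fun _ => 0)
    (Bornology.cobounded Plane) Ω

/-- `H ≥ 0`, `u H_u ≥ 0` and `v H_v ≥ 0`. -/
def CondH1 (Ω : Set Plane) (H : Plane → Plane → ℝ) : Prop :=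
  ∀ x ∈ Ω, ∀ W : Plane, 0 ≤ H x W ∧ 0 ≤ W 0 * Hu H x W ∧ 0 ≤ W 1 * Hv H x W

def CondH2 (Ω : Set Plane) (H : Plane → Plane → ℝ) : Prop :=
  ∃ S₀ > 0, ∃ M₀ > 0, ∀ x ∈ Ω, ∀ W : Plane, S₀ ≤ ‖W‖ →
    0 < H x W ∧ H x W ≤ M₀ * ‖gradW H x W‖

def CondH2bar (θ₁ θ₂ : ℝ) (Ω : Set Plane) (H : Plane → Plane → ℝ) : Prop :=
  ∃ μ ≥ 2 * max θ₁ θ₂, ∃ R > 0, ∀ x ∈ Ω, ∀ W : Plane, R ≤ ‖W‖ →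
    0 < μ * H x W ∧ μ * H x W ≤ inner ℝ W (gradW H x W)

/-- Superlinearity at `0`: `limsup_{|W| → 0} H(x, W) / |W|² ≤ 0` uniformly in `x ∈ Ω`. For `H ≥ 0`
this is the same as equality. -/
def CondSL (Ω : Set Plane) (H : Plane → Plane → ℝ) : Prop :=
  ∀ ε : ℝ, 0 < ε → ∀ᶠ W in 𝓝[≠] (0 : Plane), ∀ x ∈ Ω, H x W / ‖W‖ ^ 2 < ε

/-- `W = (u, v) ∈ H^1_0(Ω, ℝ²)` is a weak solution of
`-(a₁ + b₁‖u‖^{2(θ₁-1)}) Δu = λ H_u(x, u, v)`, `-(a₂ + b₂‖v‖^{2(θ₂-1)}) Δv = λ H_v(x, u, v)` in `Ω`,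
`u = v = 0` on `∂Ω`. The integral on the right-hand side is required to converge absolutely. -/
def IsWeakSolution (Ω : Set Plane) (a₁ a₂ b₁ b₂ θ₁ θ₂ lam : ℝ) (H : Plane → Plane → ℝ)
    (u v : H10 Ω) : Prop :=
  ∀ φ ψ : H10 Ω,
    IntegrableOn (fun x => inner ℝ (!₂[φ.fn x, ψ.fn x] : Plane)
      (gradW H x !₂[u.fn x, v.fn x])) Ω ∧
    (a₁ + b₁ * u.dnorm ^ (2 * (θ₁ - 1))) * u.dirichlet φ
      + (a₂ + b₂ * v.dnorm ^ (2 * (θ₂ - 1))) * v.dirichlet ψ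
      = lam * ∫ x in Ω, inner ℝ (!₂[φ.fn x, ψ.fn x] : Plane)
          (gradW H x !₂[u.fn x, v.fn x])

/-- `(u, v)` is not the zero function. -/
def IsNontrivial {Ω : Set Plane} (u v : H10 Ω) : Prop :=
  ¬ (u.fn =ᵐ[volume.restrict Ω] 0 ∧ v.fn =ᵐ[volume.restrict Ω] 0)

end Kirchhoff

end

noncomputable section

namespace Kirchhoff

/-! Weak solutions are the critical points of J(u,v) = (a₁/2)‖u‖² + (b₁/2θ₁)‖u‖^{2θ₁} + (a₂/2)‖v‖² +
(b₂/2θ₂)‖v‖^{2θ₂} - λ∫H(x,u,v), and the solution is found at a mountain pass level c > 0 = J(0).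

The analytic input is Trudinger's inequality: ∫ exp(k w²) is bounded on every bounded set of `H10
Ω`, with k > 0 depending on the set. Since H grows more slowly than exp(β|W|²) for every β > 0, no
sharp constant is needed: for a suitable β, ∇H(x,W) is bounded in L⁴ on bounded sets, and J is C¹.

Geometry. By (SL) and Trudinger, ∫H is at most a small multiple of ρ² on a small sphere of radius ρ,
so J is at least a positive constant there. Along (t w, 0), with w = 1 on a ball, (H₁) makes ∇H
parallel to the axis and (H₂) makes H grow at least like exp(t/M), which beats the powers t² and
t^{2θ₁}; hence J becomes nonpositive far away.

Compactness. A Palais–Smale sequence is bounded: μJ(W) - J'(W)W controls the squared norm, because μ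
≥ 2θ_max makes the Kirchhoff terms contribute with the good sign. Rellich's theorem gives
convergence a.e. along a subsequence, and the L⁴ bound upgrades it (Vitali) to L² convergence of
∇H(x,W_n). The Kirchhoff operators applied to u_n and v_n then converge; their scalar coefficients
converge along a subsequence to limits bounded below by a₁, a₂ > 0, and the Laplacian is coercive,
so u_n and v_n converge strongly. The limit is critical with J = c > 0.

The carrying lemmas are `exists_measure_superlevel_le` (Trudinger), `exists_palaisSmale_sequence`
(mountain pass, through Ekeland's principle), `totallyBounded_fst_testPairs` (Rellich),
`tendsto_eLpNorm_gradW_sub` (Vitali) and the abstract `exists_kirchhoff_critical_point`. -/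

/-! ### The Trudinger inequality by iteration over level sets -/

theorem deriv_smoothTransition_eq_zero {t : ℝ} (ht : t ≤ 0 ∨ 1 ≤ t) :
    deriv Real.smoothTransition t = 0 := by
  rcases ht with ht | ht
  · refine IsLocalMin.deriv_eq_zero (Eventually.of_forall fun y => ?_)
    rw [Real.smoothTransition.zero_of_nonpos ht]
    exact Real.smoothTransition.nonneg y
  · refine IsLocalMax.deriv_eq_zero (Eventually.of_forall fun y => ?_)
    rw [Real.smoothTransition.one_of_one_le ht]
    exact Real.smoothTransition.le_one y

theorem exists_bound_deriv_smoothTransition :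
    ∃ B > 0, ∀ t, |deriv Real.smoothTransition t| ≤ B := by
  have hc : Continuous (deriv Real.smoothTransition) :=
    (Real.smoothTransition.contDiff (n := 1)).continuous_deriv le_rfl
  obtain ⟨C, hC⟩ := (isCompact_Icc (a := (0 : ℝ)) (b := 1)).exists_bound_of_continuousOn
    hc.continuousOn
  refine ⟨max C 1, by positivity, fun t => ?_⟩
  by_cases ht : t ∈ Set.Icc (0 : ℝ) 1
  · exact (hC t ht).trans (le_max_left _ _)
  · rw [deriv_smoothTransition_eq_zero, abs_zero]
    · positivity
    · rw [Set.mem_Icc, not_and_or, not_le, not_le] at ht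
      exact ht.imp le_of_lt le_of_lt

/-- Cauchy–Schwarz on a set of finite measure. -/
theorem sq_setLIntegral_le {α : Type*} [MeasurableSpace α] (μ : Measure α) (s : Set α)
    {f : α → ℝ≥0∞} (hf : AEMeasurable f (μ.restrict s)) :
    (∫⁻ x in s, f x ∂μ) ^ 2 ≤ (∫⁻ x in s, f x ^ 2 ∂μ) * μ s := by
  have h := ENNReal.lintegral_mul_le_Lp_mul_Lq (μ.restrict s) Real.HolderConjugate.two_two hf
    (aemeasurable_const (b := (1 : ℝ≥0∞)))
  simp only [Pi.mul_apply, mul_one, lintegral_const, one_pow, one_mul,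
    Measure.restrict_apply_univ, ENNReal.rpow_two] at h
  calc _ ≤ ((∫⁻ x in s, f x ^ 2 ∂μ) ^ (1 / 2 : ℝ) * μ s ^ (1 / 2 : ℝ)) ^ 2 := by gcongr
    _ = _ := by
      rw [mul_pow, ← ENNReal.rpow_two, ← ENNReal.rpow_two, ← ENNReal.rpow_mul,
        ← ENNReal.rpow_mul]
      norm_num

/-- Comparison of consecutive superlevel sets of a compactly supported function of two variables. -/
theorem exists_measure_superlevel_step :
    ∃ K : ℝ, 0 < K ∧ ∀ u : Plane → ℝ, ContDiff ℝ 1 u → HasCompactSupport u → ∀ h : ℝ, 0 < h →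
      ∀ k : ℕ, volume {x | (k + 1) * h < u x} ≤
        ENNReal.ofReal (K / h ^ 2) * (∫⁻ x in {x | k * h < u x ∧ u x ≤ (k + 1) * h},
          ‖fderiv ℝ u x‖ₑ ^ 2) * volume {x | k * h < u x} := by
  obtain ⟨B, hB0, hB⟩ := exists_bound_deriv_smoothTransition
  set C := lintegralPowLePowLIntegralFDerivConst (volume : Measure Plane) 2 with hC
  -- `C + 1` replaces `C` only to make the constant positive.
  refine ⟨(C + 1) * B ^ 2, by positivity, fun u hu hcu h hh k => ?_⟩
  set A : Set Plane := {x | k * h < u x ∧ u x ≤ (k + 1) * h} with hA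
  have hAm : MeasurableSet A :=
    (measurableSet_lt measurable_const hu.continuous.measurable).inter
      (measurableSet_le hu.continuous.measurable measurable_const)
  -- A C¹ truncation: 0 below height kh, 1 above (k+1)h, with gradient supported in the layer `A`
  -- and bounded by (B/h)|∇u|.
  set g : Plane → ℝ := fun x => Real.smoothTransition (h⁻¹ * u x - k) with hg
  have hg1 : ContDiff ℝ 1 g :=
    Real.smoothTransition.contDiff.comp ((contDiff_const.mul hu).sub contDiff_const)
  have hgc : HasCompactSupport g := by
    refine hcu.mono fun x hx => ?_
    contrapose! hx
    simp only [Function.mem_support, not_not] at hx ⊢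
    simp only [hg, hx, mul_zero, zero_sub]
    exact Real.smoothTransition.zero_of_nonpos (by simp)
  have hfd : ∀ x, ‖fderiv ℝ g x‖ₑ ≤
      A.indicator (fun x => ENNReal.ofReal (B / h) * ‖fderiv ℝ u x‖ₑ) x := by
    intro x
    have hd : HasFDerivAt g (deriv Real.smoothTransition (h⁻¹ * u x - k) •
        (h⁻¹ • fderiv ℝ u x)) x := by
      have h1 : HasFDerivAt (fun x => h⁻¹ * u x - k) (h⁻¹ • fderiv ℝ u x) x :=
        ((hu.differentiable (by simp) x).hasFDerivAt.const_mul h⁻¹).sub_const _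
      exact ((Real.smoothTransition.contDiff (n := 1)).differentiable (by simp)
        _).hasDerivAt.comp_hasFDerivAt x h1
    rw [hd.fderiv]
    by_cases hx : x ∈ A
    · rw [Set.indicator_of_mem hx, enorm_smul, enorm_smul, ← mul_assoc]
      gcongr
      rw [Real.enorm_eq_ofReal_abs, Real.enorm_eq_ofReal_abs, ← ENNReal.ofReal_mul (abs_nonneg _),
        abs_of_pos (inv_pos.2 hh)]
      exact ENNReal.ofReal_le_ofReal (mul_le_mul_of_nonneg_right (hB _) (inv_pos.2 hh).le)
    · rw [Set.indicator_of_notMem hx, deriv_smoothTransition_eq_zero, zero_smul]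
      · rw [← ofReal_norm, norm_zero, ENNReal.ofReal_zero]
      rw [hA, Set.mem_ofPred_eq, not_and_or, not_lt, not_le] at hx
      rcases hx with hx | hx
      · left
        rw [sub_nonpos, inv_mul_le_iff₀ hh, mul_comm]
        exact hx
      · right
        rw [le_sub_iff_add_le, le_inv_mul_iff₀ hh]
        linarith
  -- Gagliardo–Nirenberg–Sobolev from W^{1,1}: in dimension two the exponent n/(n-1) is 2, so ∫g² ≤
  -- C(∫|∇g|)².
  have hgns := lintegral_pow_le_pow_lintegral_fderiv (volume : Measure Plane) hg1 hgc (p := 2)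
    (by simpa using Real.HolderConjugate.two_two)
  rw [← hC] at hgns
  simp only [ENNReal.rpow_two] at hgns
  calc volume {x | (k + 1) * h < u x}
      ≤ ∫⁻ x, ‖g x‖ₑ ^ 2 := by
        have hm : MeasurableSet {x | (k + 1) * h < u x} :=
          measurableSet_lt measurable_const hu.continuous.measurable
        rw [← lintegral_indicator_one hm]
        refine lintegral_mono (Set.indicator_le' (fun x hx => ?_) (fun x _ => zero_le))
        have : g x = 1 := by
          refine Real.smoothTransition.one_of_one_le ?_
          rw [le_sub_iff_add_le, le_inv_mul_iff₀ hh]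
          rw [Set.mem_ofPred_eq] at hx
          linarith
        simp [this]
    _ ≤ C * (∫⁻ x, ‖fderiv ℝ g x‖ₑ) ^ 2 := hgns
    _ ≤ C * (∫⁻ x in A, ENNReal.ofReal (B / h) * ‖fderiv ℝ u x‖ₑ) ^ 2 := by
        rw [← lintegral_indicator hAm]
        gcongr with x
        exact hfd x
    _ = C * ENNReal.ofReal (B / h) ^ 2 * (∫⁻ x in A, ‖fderiv ℝ u x‖ₑ) ^ 2 := by
        rw [lintegral_const_mul' _ _ ENNReal.ofReal_ne_top, mul_pow, mul_assoc]
    _ ≤ ENNReal.ofReal ((C + 1) * B ^ 2 / h ^ 2) *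
        ((∫⁻ x in A, ‖fderiv ℝ u x‖ₑ ^ 2) * volume A) := by
        gcongr
        · rw [← ENNReal.ofReal_pow (by positivity), ← ENNReal.ofReal_coe_nnreal,
            ← ENNReal.ofReal_mul (by positivity), div_pow, mul_div_assoc]
          gcongr
          simp
        · exact sq_setLIntegral_le _ _
            ((hu.continuous_fderiv one_ne_zero).enorm.measurable).aemeasurable
    _ ≤ _ := by
        rw [mul_assoc]
        gcongr
        exact fun x hx => hx.1

/-- The level-set form of the Trudinger inequality in the plane. -/
theorem exists_measure_superlevel_le :
    ∃ κ : ℝ, 0 < κ ∧ ∀ u : Plane → ℝ, ContDiff ℝ 1 u → HasCompactSupport u → ∀ M : ℝ, 0 < M →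
      ∫⁻ x, ‖fderiv ℝ u x‖ₑ ^ 2 ≤ ENNReal.ofReal (M ^ 2) →
      ∀ n : ℕ, volume {x | κ * M * √n < u x} ≤
        ENNReal.ofReal (Real.exp (-n)) * volume (Function.support u) := by
  obtain ⟨K, hK, step⟩ := exists_measure_superlevel_step
  refine ⟨Real.exp 1 * √K, by positivity, fun u hu hcu M hM hE n => ?_⟩
  rcases n.eq_zero_or_pos with rfl | hn
  · simp only [CharP.cast_eq_zero, Real.sqrt_zero, mul_zero, neg_zero, Real.exp_zero,
      ENNReal.ofReal_one, one_mul]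
    exact measure_mono fun x hx => ne_of_gt hx
  have hn' : (0 : ℝ) < n := by exact_mod_cast hn
  -- With this height, n layers reach exactly κM√n, and e²K/h² = n/M².
  set h : ℝ := Real.exp 1 * √K * M / √n with hh
  have hh0 : 0 < h := by positivity
  set A : ℕ → Set Plane := fun k => {x | k * h < u x ∧ u x ≤ (k + 1) * h} with hA
  have hAm : ∀ k, MeasurableSet (A k) := fun k =>
    (measurableSet_lt measurable_const hu.continuous.measurable).inter
      (measurableSet_le hu.continuous.measurable measurable_const)
  have hAd : Pairwise (Function.onFun Disjoint A) := by
    refine (pairwise_disjoint_on A).2 fun i j hij => Set.disjoint_left.2 fun x hi hj => ?_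
    have h1 : ((i : ℝ) + 1) ≤ j := by exact_mod_cast hij
    have h2 : ((i : ℝ) + 1) * h ≤ j * h := by gcongr
    exact absurd (hj.1.trans_le hi.2) (not_lt.2 h2)
  set e : ℕ → ℝ≥0∞ := fun k => ∫⁻ x in A k, ‖fderiv ℝ u x‖ₑ ^ 2 with he
  have hsum : ∀ m, ∑ k ∈ Finset.range m, e k ≤ ENNReal.ofReal (M ^ 2) := by
    intro m
    rw [he, ← lintegral_biUnion_finset (fun i _ j _ hij => hAd hij) (fun k _ => hAm k)]
    exact (setLIntegral_le_lintegral _ _).trans hE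
  have hek : ∀ k, e k ≠ ⊤ := fun k => ne_top_of_le_ne_top ENNReal.ofReal_ne_top
    ((Finset.single_le_sum (fun _ _ => zero_le) (Finset.self_mem_range_succ k)).trans
      (hsum (k + 1)))
  -- The layer estimates are multiplied. The layer energies sum to at most M², so for m = n the
  -- exponent is at most n - 2n = -n.
  have hind : ∀ m : ℕ, volume {x | m * h < u x} ≤
      ENNReal.ofReal (Real.exp (Real.exp 1 ^ 2 * (K / h ^ 2) *
        ∑ k ∈ Finset.range m, (e k).toReal - 2 * m)) * volume (Function.support u) := by
    intro m
    induction m with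
    | zero =>
      simp only [CharP.cast_eq_zero, zero_mul, Finset.range_zero, Finset.sum_empty, mul_zero,
        sub_zero, Real.exp_zero, ENNReal.ofReal_one, one_mul]
      exact measure_mono fun x hx => ne_of_gt hx
    | succ m ih =>
      have h1 := step u hu hcu h hh0 m
      push_cast
      refine h1.trans ?_
      -- From e²y ≤ exp(e²y): y ≤ exp(e²y - 2), which turns the product of layer energies into a sum
      -- in the exponent.
      have h2 : ENNReal.ofReal (K / h ^ 2) * e m ≤
          ENNReal.ofReal (Real.exp (Real.exp 1 ^ 2 * (K / h ^ 2) * (e m).toReal - 2)) := by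
        conv_lhs => rw [← ENNReal.ofReal_toReal (hek m), ← ENNReal.ofReal_mul (by positivity)]
        refine ENNReal.ofReal_le_ofReal ?_
        set y := K / h ^ 2 * (e m).toReal with hy
        have h3 : Real.exp 1 ^ 2 * y ≤ Real.exp (Real.exp 1 ^ 2 * y) := by
          linarith [Real.add_one_le_exp (Real.exp 1 ^ 2 * y)]
        rw [mul_assoc, ← hy, Real.exp_sub, le_div_iff₀ (Real.exp_pos _)]
        calc y * Real.exp 2 = Real.exp 1 ^ 2 * y := by
              rw [← Real.exp_nat_mul]; push_cast; rw [mul_one, mul_comm]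
          _ ≤ _ := h3
      calc _ ≤ _ := mul_le_mul' h2 ih
        _ = _ := by
          rw [← mul_assoc, ← ENNReal.ofReal_mul (Real.exp_pos _).le, ← Real.exp_add,
            Finset.sum_range_succ]
          congr 3
          ring
  have hnh : (n : ℝ) * h = Real.exp 1 * √K * M * √n := by
    rw [hh]
    field_simp
    rw [Real.sq_sqrt hn'.le]
  have := hind n
  rw [hnh] at this
  refine this.trans ?_
  gcongr
  have hs : ∑ k ∈ Finset.range n, (e k).toReal ≤ M ^ 2 := by
    rw [← ENNReal.toReal_sum fun k _ => hek k]
    exact ENNReal.toReal_le_of_le_ofReal (by positivity) (hsum n)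
  have hc : Real.exp 1 ^ 2 * (K / h ^ 2) = n / M ^ 2 := by
    rw [hh, div_pow, mul_pow, mul_pow, Real.sq_sqrt hK.le, Real.sq_sqrt hn'.le]
    field_simp
  rw [hc]
  have : n / M ^ 2 * ∑ k ∈ Finset.range n, (e k).toReal ≤ n / M ^ 2 * M ^ 2 := by gcongr
  rw [div_mul_cancel₀ _ (by positivity)] at this
  linarith

theorem lintegral_enorm_sq_eq_ofReal_norm_sq {α F : Type*} [MeasurableSpace α] {μ : Measure α}
    [NormedAddCommGroup F] (f : Lp F 2 μ) :
    ∫⁻ x, ‖f x‖ₑ ^ 2 ∂μ = ENNReal.ofReal (‖f‖ ^ 2) := by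
  have hf := Lp.eLpNorm_ne_top f
  rw [Lp.norm_def, ← ENNReal.toReal_pow, ENNReal.ofReal_toReal (by finiteness)]
  rw [eLpNorm_eq_lintegral_rpow_enorm_toReal (by norm_num) (by norm_num), ← ENNReal.rpow_two,
    ← ENNReal.rpow_mul]
  simp

theorem H10.dnorm_eq_norm {Ω : Set Plane} (w : H10 Ω) : w.dnorm = ‖w.grad‖ := by
  rw [H10.dnorm, ← Real.sqrt_sq (norm_nonneg w.grad), ← real_inner_self_eq_norm_sq, L2.inner_def]
  simp only [real_inner_self_eq_norm_sq]

theorem IsTestFunction.lintegral_fderiv {Ω : Set Plane} {φ : Plane → ℝ}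
    (hφ : IsTestFunction Ω φ) :
    ∫⁻ x, ‖fderiv ℝ φ x‖ₑ ^ 2 = ∫⁻ x in Ω, ‖gradient φ x‖ₑ ^ 2 := by
  have h : ∀ x, ‖gradient φ x‖ₑ = ‖fderiv ℝ φ x‖ₑ := fun x => by
    rw [gradient, ← ofReal_norm, ← ofReal_norm, LinearIsometryEquiv.norm_map]
  simp only [h]
  refine (setLIntegral_eq_of_support_subset fun x hx => ?_).symm
  refine hφ.support (support_fderiv_subset ℝ fun h0 => hx ?_)
  simp only [h0]
  exact pow_eq_zero_iff two_ne_zero |>.2 (by rw [← ofReal_norm, norm_zero, ENNReal.ofReal_zero])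

/-- Density of test functions, with a subsequence converging a.e. The gradient norms of the
approximants only converge to `w.dnorm`, hence the strict inequality `w.dnorm < M`. -/
theorem H10.exists_test_seq {Ω : Set Plane} (w : H10 Ω) :
    ∃ φ : ℕ → Plane → ℝ, (∀ n, IsTestFunction Ω (φ n)) ∧
      (∀ᵐ x ∂volume.restrict Ω, Tendsto (fun n => φ n x) atTop (𝓝 (w.fn x))) ∧
      ∀ M, w.dnorm < M → ∀ᶠ n in atTop,
        ∫⁻ x, ‖fderiv ℝ (φ n) x‖ₑ ^ 2 ≤ ENNReal.ofReal (M ^ 2) := by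
  have hw : w.1 ∈ closure (testPairs Ω : Set (L2Pair Ω)) := w.2
  obtain ⟨p, hp, hlim⟩ := mem_closure_iff_seq_limit.1 hw
  choose φ hφ h1 h2 using hp
  have l1 : Tendsto (fun n => (p n).fst) atTop (𝓝 w.fn) :=
    ((WithLp.prod_continuous_ofLp 2 _ _).fst.tendsto w.1).comp hlim
  have l2 : Tendsto (fun n => (p n).snd) atTop (𝓝 w.grad) :=
    ((WithLp.prod_continuous_ofLp 2 _ _).snd.tendsto w.1).comp hlim
  obtain ⟨ns, hns, hae⟩ := (tendstoInMeasure_of_tendsto_Lp l1).exists_seq_tendsto_ae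
  refine ⟨fun n => φ (ns n), fun n => hφ _, ?_, fun M hM => ?_⟩
  · filter_upwards [hae, ae_all_iff.2 h1] with x hx hx1
    simpa only [← hx1] using hx
  · rw [H10.dnorm_eq_norm] at hM
    filter_upwards [hns.tendsto_atTop.eventually (l2.norm.eventually_lt_const hM)] with n hn
    rw [(hφ _).lintegral_fderiv]
    calc _ = ∫⁻ x in Ω, ‖(p (ns n)).snd x‖ₑ ^ 2 := by
          refine lintegral_congr_ae ?_
          filter_upwards [h2 (ns n)] with x hx
          rw [hx]
      _ = ENNReal.ofReal (‖(p (ns n)).snd‖ ^ 2) := lintegral_enorm_sq_eq_ofReal_norm_sq _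
      _ ≤ _ := by gcongr

/-- For y > 0 the single term n = ⌈y⌉ - 1 suffices, since n < y ≤ n + 1. Integrating the sum reduces
exponential integrals to measures of superlevel sets. -/
theorem ofReal_exp_half_le_tsum {y : ℝ} (hy : 0 ≤ y) :
    ENNReal.ofReal (Real.exp (y / 2)) ≤ 1 + ∑' n : ℕ,
      if (n : ℝ) < y then ENNReal.ofReal (Real.exp ((n + 1) / 2)) else 0 := by
  rcases hy.eq_or_lt with rfl | hy
  · simp
  · refine le_trans ?_ le_add_self
    refine le_trans ?_ (ENNReal.le_tsum (⌈y⌉₊ - 1))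
    have h0 : 1 ≤ ⌈y⌉₊ := Nat.one_le_iff_ne_zero.2 (Nat.ceil_pos.2 hy).ne'
    have h1 := Nat.ceil_lt_add_one hy.le
    have h2 := Nat.le_ceil y
    rw [if_pos (by push_cast [h0]; linarith)]
    push_cast [h0]
    gcongr
    linarith

/-- The Trudinger inequality in the plane for smooth functions, with non-optimal constants. -/
theorem exists_lintegral_exp_sq_le_of_isTestFunction :
    ∃ c : ℝ, 0 < c ∧ ∃ C : ℝ, ∀ (Ω : Set Plane) (φ : Plane → ℝ), IsTestFunction Ω φ →
      ∀ M : ℝ, 0 < M → ∫⁻ x, ‖fderiv ℝ φ x‖ₑ ^ 2 ≤ ENNReal.ofReal (M ^ 2) →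
      ∫⁻ x in Ω, ENNReal.ofReal (Real.exp (c * (φ x / M) ^ 2)) ≤ ENNReal.ofReal C * volume Ω := by
  obtain ⟨κ, hκ, key⟩ := exists_measure_superlevel_le
  have hsumm : Summable fun n : ℕ => 2 * Real.exp (1 / 2) * Real.exp (-(1 / 2)) ^ n :=
    (summable_geometric_of_lt_one (Real.exp_pos _).le (Real.exp_lt_one_iff.2 (by norm_num))).mul_left _
  -- This c makes the exponent y/2 with y = (φ/(κM))². As {y > n} has measure at most 2e^{-n}|Ω|,
  -- the n-th term is e^{(n+1)/2}·2e^{-n} = 2e^{1/2}e^{-n/2}, a geometric series.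
  refine ⟨1 / (2 * κ ^ 2), by positivity,
    1 + ∑' n : ℕ, 2 * Real.exp (1 / 2) * Real.exp (-(1 / 2)) ^ n, fun Ω φ hφ M hM hE => ?_⟩
  have hφ1 : ContDiff ℝ 1 φ := hφ.smooth.of_le (by exact_mod_cast le_top)
  set S : ℕ → Set Plane := fun n => {x | (n : ℝ) < (φ x / (κ * M)) ^ 2} with hS
  have hSm : ∀ n, MeasurableSet (S n) := fun n =>
    measurableSet_lt measurable_const ((hφ1.continuous.measurable.div_const _).pow_const 2)
  have hsupp : Function.support φ ⊆ Ω := (subset_tsupport φ).trans hφ.support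
  have hSv : ∀ n, volume (S n) ≤ ENNReal.ofReal (2 * Real.exp (-n)) * volume Ω := by
    intro n
    -- The level set estimate is one-sided, so it is used for φ and for -φ.
    have h1 : S n ⊆ {x | κ * M * √n < φ x} ∪ {x | κ * M * √n < (-φ) x} := by
      intro x hx
      have h2 : √n < |φ x / (κ * M)| := by
        rw [← Real.sqrt_sq_eq_abs]
        exact Real.sqrt_lt_sqrt (Nat.cast_nonneg n) hx
      rw [abs_div, abs_of_pos (show 0 < κ * M by positivity), lt_div_iff₀ (by positivity),
        mul_comm] at h2
      exact lt_abs.1 h2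
    have h2 := key φ hφ1 hφ.compact M hM hE n
    have h3 := key (-φ) hφ1.neg hφ.compact.neg M hM (by
      simpa only [fderiv_neg, enorm_neg] using hE) n
    rw [Function.support_neg] at h3
    calc _ ≤ _ := measure_mono h1
      _ ≤ _ := measure_union_le _ _
      _ ≤ _ := add_le_add h2 h3
      _ = ENNReal.ofReal (2 * Real.exp (-n)) * volume (Function.support φ) := by
        rw [← add_mul, ← ENNReal.ofReal_add (Real.exp_pos _).le (Real.exp_pos _).le, two_mul]
      _ ≤ _ := by gcongr
  calc ∫⁻ x in Ω, ENNReal.ofReal (Real.exp (1 / (2 * κ ^ 2) * (φ x / M) ^ 2))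
      ≤ ∫⁻ x in Ω, (1 + ∑' n : ℕ, (S n).indicator
          (fun _ => ENNReal.ofReal (Real.exp ((n + 1) / 2))) x) := by
        refine lintegral_mono fun x => ?_
        have h := ofReal_exp_half_le_tsum (y := (φ x / (κ * M)) ^ 2) (sq_nonneg _)
        have e : 1 / (2 * κ ^ 2) * (φ x / M) ^ 2 = (φ x / (κ * M)) ^ 2 / 2 := by field_simp
        rw [e]
        classical
        convert h using 4 with n
        rw [Set.indicator_apply]
        rfl
    _ = volume Ω + ∑' n : ℕ, ENNReal.ofReal (Real.exp ((n + 1) / 2)) *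
          (volume.restrict Ω) (S n) := by
        rw [lintegral_add_left measurable_const, setLIntegral_one, lintegral_tsum
          fun n => (measurable_const.indicator (hSm n)).aemeasurable]
        congr 2
        funext n
        rw [lintegral_indicator (hSm n), setLIntegral_const]
    _ ≤ volume Ω + ∑' n : ℕ, ENNReal.ofReal (2 * Real.exp (1 / 2) * Real.exp (-(1 / 2)) ^ n) *
          volume Ω := by
        refine add_le_add le_rfl (ENNReal.tsum_le_tsum fun n => ?_)
        calc _ ≤ ENNReal.ofReal (Real.exp ((n + 1) / 2)) *
              (ENNReal.ofReal (2 * Real.exp (-n)) * volume Ω) := by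
              gcongr
              exact (Measure.restrict_apply_le _ _).trans (hSv n)
          _ = _ := by
              rw [← mul_assoc, ← ENNReal.ofReal_mul (Real.exp_pos _).le]
              congr 2
              rw [mul_left_comm, ← Real.exp_add, ← Real.exp_nat_mul, mul_assoc, ← Real.exp_add]
              ring_nf
    _ = _ := by
        rw [ENNReal.tsum_mul_right, ← ENNReal.ofReal_tsum_of_nonneg (fun n => by positivity) hsumm,
          ENNReal.ofReal_add zero_le_one (tsum_nonneg fun n => by positivity), ENNReal.ofReal_one,
          add_mul, one_mul]

/-- The Trudinger inequality in `H^1_0(Ω)`, with non-optimal constants. -/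
theorem H10.exists_lintegral_exp_sq_le :
    ∃ c : ℝ, 0 < c ∧ ∃ C : ℝ, ∀ (Ω : Set Plane) (w : H10 Ω) (M : ℝ), 0 < M → w.dnorm ≤ M →
      ∫⁻ x in Ω, ENNReal.ofReal (Real.exp (c * (w.fn x / M) ^ 2)) ≤
        ENNReal.ofReal C * volume Ω := by
  obtain ⟨c, hc, C, h⟩ := exists_lintegral_exp_sq_le_of_isTestFunction
  -- The factor 1/4 pays for replacing M by 2M, which the approximants' energies eventually respect
  -- even if `w.dnorm = M`. Fatou's lemma then passes to the limit.
  refine ⟨c / 4, by positivity, C, fun Ω w M hM hw => ?_⟩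
  obtain ⟨φ, hφ, hae, hb⟩ := w.exists_test_seq
  have hb' := hb (2 * M) (by linarith)
  have e : ∀ t : ℝ, c / 4 * (t / M) ^ 2 = c * (t / (2 * M)) ^ 2 := fun t => by
    field_simp; ring
  simp only [e]
  have hcont : Continuous fun t : ℝ => ENNReal.ofReal (Real.exp (c * (t / (2 * M)) ^ 2)) := by
    exact ENNReal.continuous_ofReal.comp (by fun_prop)
  calc _ ≤ ∫⁻ x in Ω, liminf (fun n => ENNReal.ofReal (Real.exp (c * (φ n x / (2 * M)) ^ 2)))
          atTop := by
        refine lintegral_mono_ae ?_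
        filter_upwards [hae] with x hx
        exact (((hcont.tendsto _).comp hx).liminf_eq).ge
    _ ≤ liminf (fun n => ∫⁻ x in Ω, ENNReal.ofReal (Real.exp (c * (φ n x / (2 * M)) ^ 2)))
          atTop := lintegral_liminf_le fun n => hcont.measurable.comp (hφ n).smooth.continuous.measurable
    _ ≤ _ := by
        refine liminf_le_of_frequently_le' (Eventually.frequently ?_)
        filter_upwards [hb'] with n hn
        exact h Ω (φ n) (hφ n) (2 * M) (by positivity) hn

/-! ### Ekeland's principle and the mountain pass theorem -/

section

/-- A weak form of **Ekeland's variational principle**. -/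
theorem exists_ekeland_point {X : Type*} [MetricSpace X] [CompleteSpace X] [Nonempty X]
    {f : X → ℝ} (hf : Continuous f) (hb : BddBelow (Set.range f)) {ε : ℝ} (hε : 0 < ε) :
    ∃ x, f x ≤ (⨅ y, f y) + ε ∧ ∀ y, f x - ε * dist x y ≤ f y := by
  -- The lower set of x for the Ekeland order: the points below the cone of slope ε with vertex at
  -- (x, f x).
  set S : X → Set X := fun x => {y | f y + ε * dist x y ≤ f x} with hS
  have hself : ∀ x, x ∈ S x := fun x => by simp [hS]
  have htrans : ∀ {x y z}, y ∈ S x → z ∈ S y → z ∈ S x := by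
    intro x y z hy hz
    simp only [hS, Set.mem_ofPred_eq] at *
    nlinarith [dist_triangle x y z]
  have hbS : ∀ x, BddBelow (f '' S x) := fun x => hb.mono (Set.image_subset_range _ _)
  have hnext : ∀ (n : ℕ) (x : X), ∃ y ∈ S x, f y < sInf (f '' S x) + (1 / 2 : ℝ) ^ n := by
    intro n x
    obtain ⟨_, ⟨y, hy, rfl⟩, h⟩ := exists_lt_of_csInf_lt (Set.Nonempty.image f ⟨x, hself x⟩)
      (lt_add_of_pos_right (sInf (f '' S x)) (show (0 : ℝ) < (1 / 2 : ℝ) ^ n by positivity))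
    exact ⟨y, hy, h⟩
  choose next hn1 hn2 using hnext
  obtain ⟨x₀, hx₀⟩ := exists_lt_of_ciInf_lt (lt_add_of_pos_right (⨅ y, f y) hε)
  let x : ℕ → X := fun n => Nat.rec x₀ (fun n y => next n y) n
  have hx : ∀ n, x (n + 1) = next n (x n) := fun n => rfl
  have hmem : ∀ n k, x (n + k) ∈ S (x n) := by
    intro n k
    induction k with
    | zero => exact hself _
    | succ k ih => exact htrans ih (by rw [← add_assoc, hx]; exact hn1 _ _)
  -- A point y of S(x_{n+1}) also lies in S(x_n), so f y ≥ inf f over S(x_n) > f(x_{n+1}) - 2^{-n};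
  -- the cone inequality converts this into a bound on the distance.
  have hclose : ∀ n, ∀ y ∈ S (x (n + 1)), ε * dist (x (n + 1)) y ≤ (1 / 2 : ℝ) ^ n := by
    intro n y hy
    have h1 : sInf (f '' S (x n)) ≤ f y :=
      csInf_le (hbS _) ⟨y, htrans (by rw [hx]; exact hn1 _ _) hy, rfl⟩
    have h2 := hn2 n (x n)
    rw [← hx] at h2
    simp only [hS, Set.mem_ofPred_eq] at hy
    linarith
  have hdist : ∀ n, ∀ y ∈ S (x (n + 1)), dist (x (n + 1)) y ≤ ε⁻¹ * (1 / 2 : ℝ) ^ n := by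
    intro n y hy
    rw [inv_mul_eq_div, le_div_iff₀ hε, mul_comm]
    exact hclose n y hy
  have h0 : Tendsto (fun n : ℕ => ε⁻¹ * (1 / 2 : ℝ) ^ n) atTop (𝓝 0) := by
    simpa using (tendsto_pow_atTop_nhds_zero_of_lt_one (by norm_num : (0 : ℝ) ≤ 1 / 2)
      (by norm_num)).const_mul ε⁻¹
  have hcau : CauchySeq fun n => x (n + 1) := by
    refine cauchySeq_of_le_tendsto_0' _ (fun n m hnm => ?_) h0
    obtain ⟨k, rfl⟩ := Nat.exists_eq_add_of_le hnm
    refine hdist n _ ?_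
    rw [add_right_comm]
    exact hmem _ _
  obtain ⟨z, hz⟩ := cauchySeq_tendsto_of_complete hcau
  have hzS : ∀ n, z ∈ S (x n) := by
    intro n
    have hcl : IsClosed (S (x n)) := isClosed_le
      (hf.add (continuous_const.mul (continuous_const.dist continuous_id))) continuous_const
    refine hcl.mem_of_tendsto hz ((eventually_ge_atTop n).mono fun m hm => ?_)
    obtain ⟨k, rfl⟩ := Nat.exists_eq_add_of_le hm
    exact hmem n (k + 1)
  refine ⟨z, ?_, fun y => ?_⟩
  · have h1 : f z + ε * dist x₀ z ≤ f x₀ := hzS 0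
    nlinarith [dist_nonneg (x := x₀) (y := z)]
  -- A point y strictly below the cone at z lies in every S(x_n). These sets shrink to the limit of
  -- x_n, so y = z, which is absurd.
  · by_contra! hy
    have hyS : ∀ n, y ∈ S (x n) := fun n => htrans (hzS n) (by
      simp only [hS, Set.mem_ofPred_eq]; linarith)
    have hyt : Tendsto (fun n => x (n + 1)) atTop (𝓝 y) :=
      tendsto_iff_dist_tendsto_zero.2 (squeeze_zero (fun n => dist_nonneg)
        (fun n => hdist n y (hyS (n + 1))) h0)
    rw [tendsto_nhds_unique hz hyt, dist_self] at hy
    simp at hy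

variable {E : Type*} [NormedAddCommGroup E] [InnerProductSpace ℝ E]

/-- Ekeland's principle is applied to γ ↦ max J∘γ on the complete space of paths from p to q. A
nearly minimal path γ is pushed along -G/‖G‖, cut off near its ends; the maximum can drop only at
rate ε, so at some maximum point of J∘γ the gradient has norm at most ε. -/
theorem exists_almost_critical_point [CompleteSpace E] {J : E → ℝ} {G : E → E}
    (hJ : ∀ x, HasStrictFDerivAt J (innerSL ℝ (G x)) x) (hG : Continuous G) {p q : E} {α : ℝ}
    (hp : J p < α) (hq : J q < α)
    (hα : ∀ γ : C(unitInterval, E), γ 0 = p → γ 1 = q → ∃ t, α ≤ J (γ t)) :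
    ∃ c, α ≤ c ∧ ∀ ε, 0 < ε → ∃ a, c ≤ J a ∧ J a ≤ c + ε ∧ ‖G a‖ ≤ ε := by
  have hJc : Continuous J := continuous_iff_continuousAt.2 fun x => (hJ x).continuousAt
  set Γ : Set C(unitInterval, E) := {γ | γ 0 = p ∧ γ 1 = q} with hΓ
  have hΓc : IsClosed Γ := (isClosed_eq (continuous_eval_const 0)
    continuous_const).inter (isClosed_eq (continuous_eval_const 1) continuous_const)
  have : CompleteSpace Γ := hΓc.completeSpace_coe
  have : Nonempty Γ := ⟨⟨⟨fun t => p + (t : ℝ) • (q - p), by fun_prop⟩, by simp, by simp⟩⟩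
  set Ψ : Γ → ℝ := fun γ => sSup ((fun t => J (γ.1 t)) '' Set.univ) with hΨ
  have hΨc : Continuous Ψ := by
    refine isCompact_univ.continuous_sSup (f := fun (γ : Γ) (t : unitInterval) => J (γ.1 t)) ?_
    exact hJc.comp (continuous_eval.comp (continuous_subtype_val.prodMap continuous_id))
  have hmax : ∀ γ : Γ, ∃ t, J (γ.1 t) = Ψ γ := fun γ => by
    obtain ⟨t, -, ht⟩ := isCompact_univ.exists_sSup_image_eq Set.univ_nonempty
      (hJc.comp γ.1.continuous).continuousOn
    exact ⟨t, ht.symm⟩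
  have hle : ∀ (γ : Γ) t, J (γ.1 t) ≤ Ψ γ := fun γ t =>
    le_csSup (isCompact_univ.image (hJc.comp γ.1.continuous)).bddAbove ⟨t, trivial, rfl⟩
  have hΨα : ∀ γ, α ≤ Ψ γ := fun γ => by
    obtain ⟨t, ht⟩ := hα γ.1 γ.2.1 γ.2.2
    exact ht.trans (hle γ t)
  have hbdd : BddBelow (Set.range Ψ) := ⟨α, by rintro _ ⟨γ, rfl⟩; exact hΨα γ⟩
  refine ⟨⨅ γ, Ψ γ, le_ciInf hΨα, fun ε hε => ?_⟩
  obtain ⟨γ, hγ1, hγ2⟩ := exists_ekeland_point hΨc hbdd hε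
  set β : ℝ := max (J p) (J q) with hβ
  have hβα : β < α := max_lt hp hq
  -- The cutoff vanishes where J ≤ max(J p, J q), which fixes the endpoints, and equals 1 where J ≥
  -- α, which includes every maximum point of γ.
  set χ : unitInterval → ℝ := fun t => min 1 (max 0 ((J (γ.1 t) - β) / (α - β))) with hχ
  have hχ0 : ∀ t, 0 ≤ χ t := fun t => le_min zero_le_one (le_max_left _ _)
  have hχ1 : ∀ t, χ t ≤ 1 := fun t => min_le_left _ _
  have hχz : ∀ t, J (γ.1 t) ≤ β → χ t = 0 := fun t ht => by
    have : (J (γ.1 t) - β) / (α - β) ≤ 0 :=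
      div_nonpos_of_nonpos_of_nonneg (by linarith) (by linarith)
    simp [hχ, this]
  have hχo : ∀ t, α ≤ J (γ.1 t) → χ t = 1 := fun t ht => by
    have : 1 ≤ (J (γ.1 t) - β) / (α - β) := by
      rw [le_div_iff₀ (by linarith)]; linarith
    simp [hχ, this]
  have hmpos : ∀ t, 0 < max ‖G (γ.1 t)‖ ε := fun t => lt_max_of_lt_right hε
  -- Dividing by max(‖G‖, ε) rather than by ‖G‖ keeps the field continuous at zeros of G; it is the
  -- normalised -G wherever χ = 1 and ‖G‖ ≥ ε.
  set v : C(unitInterval, E) :=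
    ⟨fun t => -(χ t * (max ‖G (γ.1 t)‖ ε)⁻¹) • G (γ.1 t), by
      have h1 : Continuous fun t => G (γ.1 t) := hG.comp γ.1.continuous
      have h2 : Continuous fun t => J (γ.1 t) := hJc.comp γ.1.continuous
      have h3 : Continuous χ := by fun_prop
      exact ((h3.mul ((h1.norm.max continuous_const).inv₀ fun t => (hmpos t).ne')).neg).smul h1⟩
    with hv
  have hvt : ∀ t, v t = -(χ t * (max ‖G (γ.1 t)‖ ε)⁻¹) • G (γ.1 t) := fun t => rfl
  have hv1 : ∀ t, ‖v t‖ ≤ 1 := fun t => by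
    rw [hvt, norm_smul, norm_neg, norm_mul, norm_inv, Real.norm_of_nonneg (hχ0 t),
      Real.norm_of_nonneg (hmpos t).le, mul_assoc, inv_mul_eq_div]
    have := (div_le_one (hmpos t)).2 (le_max_left ‖G (γ.1 t)‖ ε)
    have h0 : 0 ≤ ‖G (γ.1 t)‖ / max ‖G (γ.1 t)‖ ε := div_nonneg (norm_nonneg _) (hmpos t).le
    exact mul_le_one₀ (hχ1 t) h0 this
  have hv0 : ∀ t, J (γ.1 t) ≤ β → v t = 0 := fun t ht => by rw [hvt, hχz t ht]; simp
  set s : ℕ → ℝ := fun n => 1 / ((n : ℝ) + 1) with hs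
  have hs0 : ∀ n, 0 < s n := fun n => Nat.one_div_pos_of_nat
  have hslim : Tendsto s atTop (𝓝 0) := tendsto_one_div_add_atTop_nhds_zero_nat
  set η : ℕ → Γ := fun n => ⟨γ.1 + s n • v, by
    refine ⟨?_, ?_⟩
    · have := hv0 0 (by rw [γ.2.1]; exact le_max_left _ _)
      simp [this, γ.2.1]
    · have := hv0 1 (by rw [γ.2.2]; exact le_max_right _ _)
      simp [this, γ.2.2]⟩ with hη
  have hηt : ∀ n t, (η n).1 t = γ.1 t + s n • v t := fun n t => rfl
  have hdist : ∀ n, dist γ (η n) ≤ s n := fun n => by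
    rw [Subtype.dist_eq, ContinuousMap.dist_le (hs0 n).le]
    intro t
    rw [hηt, dist_self_add_right, norm_smul, Real.norm_of_nonneg (hs0 n).le]
    exact mul_le_of_le_one_right (hs0 n).le (hv1 t)
  have hηΨ : ∀ n, Ψ γ - ε * s n ≤ Ψ (η n) := fun n =>
    (sub_le_sub_left (mul_le_mul_of_nonneg_left (hdist n) hε.le) _).trans (hγ2 (η n))
  choose t ht using fun n => hmax (η n)
  -- Maximum points of the deformed paths accumulate at t', which is a maximum point of the
  -- undeformed path.
  obtain ⟨t', -, φ, hφ, hlim⟩ := isCompact_univ.tendsto_subseq (x := t) (fun n => Set.mem_univ _)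
  have hsφ : Tendsto (fun n => s (φ n)) atTop (𝓝 0) := hslim.comp hφ.tendsto_atTop
  have hvφ : Tendsto (fun n => v (t (φ n))) atTop (𝓝 (v t')) := (v.continuous.tendsto t').comp hlim
  have hy : Tendsto (fun n => γ.1 (t (φ n))) atTop (𝓝 (γ.1 t')) :=
    (γ.1.continuous.tendsto t').comp hlim
  have hx : Tendsto (fun n => (η (φ n)).1 (t (φ n))) atTop (𝓝 (γ.1 t')) := by
    simp only [hηt]
    simpa using hy.add (hsφ.smul hvφ)
  have hJa : J (γ.1 t') = Ψ γ := by
    refine le_antisymm (hle _ _) (le_of_tendsto_of_tendsto' (f := fun n => Ψ γ - ε * s (φ n))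
      (by simpa using (hsφ.const_mul ε).const_sub (Ψ γ)) ((hJc.tendsto _).comp hx) fun n => ?_)
    exact (hηΨ _).trans (ht _).ge
  -- The difference quotients are taken at base points γ(t_n) that move with n, which is why J is
  -- required to be strictly differentiable.
  have hinner : -ε ≤ inner ℝ (G (γ.1 t')) (v t') := by
    refine le_of_forall_pos_le_add fun δ hδ => ?_
    have hlo := ((hJ (γ.1 t')).isLittleO.comp_tendsto (hx.prodMk_nhds hy)).bound hδ
    have hlim2 : Tendsto (fun n => (inner ℝ (G (γ.1 t')) (v (t (φ n))) : ℝ)) atTop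
        (𝓝 (inner ℝ (G (γ.1 t')) (v t'))) := tendsto_const_nhds.inner hvφ
    suffices -ε - δ ≤ inner ℝ (G (γ.1 t')) (v t') by linarith
    refine ge_of_tendsto hlim2 (hlo.mono fun n hn => ?_)
    simp only [Function.comp_apply, hηt, add_sub_cancel_left, innerSL_apply_apply, inner_smul_right,
      norm_smul, Real.norm_of_nonneg (hs0 (φ n)).le] at hn
    rw [← hηt, Real.norm_eq_abs, abs_le] at hn
    have h1 := hηΨ (φ n)
    rw [← ht] at h1
    have h2 := hle γ (t (φ n))
    have h3 : δ * (s (φ n) * ‖v (t (φ n))‖) ≤ δ * s (φ n) := by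
      gcongr
      exact mul_le_of_le_one_right (hs0 _).le (hv1 _)
    have h4 : s (φ n) * (-ε - δ) ≤ s (φ n) * inner ℝ (G (γ.1 t')) (v (t (φ n))) := by
      linarith [hn.2]
    exact le_of_mul_le_mul_left h4 (hs0 _)
  refine ⟨γ.1 t', ?_, hJa.trans_le hγ1, ?_⟩
  · rw [hJa]
    exact ciInf_le hbdd γ
  · by_contra! hlt
    rw [hvt, hχo t' (by rw [hJa]; exact hΨα γ), max_eq_left hlt.le, inner_smul_right,
      real_inner_self_eq_norm_sq] at hinner
    have h0 : 0 < ‖G (γ.1 t')‖ := hε.trans hlt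
    have : -(1 * ‖G (γ.1 t')‖⁻¹) * ‖G (γ.1 t')‖ ^ 2 = -‖G (γ.1 t')‖ := by field_simp
    linarith

/-- The **mountain pass theorem** without compactness: existence of Palais–Smale sequences. -/
theorem exists_palaisSmale_sequence [CompleteSpace E] {J : E → ℝ} {G : E → E}
    (hJ : ∀ x, HasStrictFDerivAt J (innerSL ℝ (G x)) x) (hG : Continuous G) {p q : E} {α : ℝ}
    (hp : J p < α) (hq : J q < α)
    (hα : ∀ γ : C(unitInterval, E), γ 0 = p → γ 1 = q → ∃ t, α ≤ J (γ t)) :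
    ∃ c, α ≤ c ∧ ∃ w : ℕ → E, Tendsto (fun n => J (w n)) atTop (𝓝 c) ∧
      Tendsto (fun n => G (w n)) atTop (𝓝 0) := by
  obtain ⟨c, hc, h⟩ := exists_almost_critical_point hJ hG hp hq hα
  choose w h1 h2 h3 using fun n : ℕ => h (1 / ((n : ℝ) + 1)) Nat.one_div_pos_of_nat
  have hs : Tendsto (fun n : ℕ => 1 / ((n : ℝ) + 1)) atTop (𝓝 0) :=
    tendsto_one_div_add_atTop_nhds_zero_nat
  exact ⟨c, hc, w, tendsto_of_tendsto_of_tendsto_of_le_of_le tendsto_const_nhds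
    (by simpa using hs.const_add c) h1 h2, squeeze_zero_norm h3 hs⟩

/-- A function on a Hilbert space whose directional derivatives are given by a continuous gradient
is strictly differentiable. -/
theorem hasStrictFDerivAt_of_hasDerivAt_line {J : E → ℝ} {G : E → E} (hG : Continuous G)
    (hJ : ∀ a z : E, HasDerivAt (fun s : ℝ => J (a + s • z)) (inner ℝ (G a) z) 0) (x : E) :
    HasStrictFDerivAt J (innerSL ℝ (G x)) x := by
  have hline : ∀ a z : E, ∀ s : ℝ,
      HasDerivAt (fun s : ℝ => J (a + s • z)) (inner ℝ (G (a + s • z)) z) s := by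
    intro a z s
    have h := HasDerivAt.comp_sub_const s s (by rw [sub_self]; exact hJ (a + s • z) z)
    refine (h.congr_of_eventuallyEq (Eventually.of_forall fun r => ?_)).congr_deriv rfl
    simp only [add_assoc, ← add_smul, add_sub_cancel]
  refine hasStrictFDerivAt_of_hasFDerivAt_of_continuousAt (f' := fun y => innerSL ℝ (G y))
    (Eventually.of_forall fun y => ?_) ((innerSL ℝ).continuous.comp hG).continuousAt
  rw [hasFDerivAt_iff_isLittleO_nhds_zero, Asymptotics.isLittleO_iff]
  intro δ hδ
  obtain ⟨r, hr, hball⟩ := Metric.continuousAt_iff.1 hG.continuousAt δ hδ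
  filter_upwards [Metric.ball_mem_nhds (0 : E) hr] with z hz
  rw [mem_ball_zero_iff] at hz
  -- Mean value inequality on the segment from y to y + z, after subtracting the linear part;
  -- continuity of G makes the remaining derivative at most δ‖z‖.
  have := norm_image_sub_le_of_norm_deriv_le_segment_01'
    (f := fun s : ℝ => J (y + s • z) - s * inner ℝ (G y) z)
    (f' := fun s => inner ℝ (G (y + s • z)) z - inner ℝ (G y) z) (C := δ * ‖z‖)
    (fun s _ => ((hline y z s).sub (by simpa using (hasDerivAt_id s).mul_const _)).hasDerivWithinAt)
    (fun s hs => by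
      rw [← inner_sub_left]
      refine (norm_inner_le_norm _ _).trans ?_
      gcongr
      rw [← dist_eq_norm]
      refine (hball ?_).le
      rw [dist_self_add_left, norm_smul, Real.norm_of_nonneg hs.1]
      exact (mul_le_of_le_one_left (norm_nonneg _) hs.2.le).trans_lt hz)
  simp only [one_smul, one_mul, zero_smul, add_zero, zero_mul, sub_zero] at this
  rw [innerSL_apply_apply]
  convert this using 2
  ring

end

/-! ### Rellich compactness by averaging over a square lattice -/

theorem enorm_setAverage_sq_le {α : Type*} [MeasurableSpace α] {μ : Measure α} {s : Set α}
    (h0 : μ s ≠ 0) (h1 : μ s ≠ ⊤) {f : α → ℝ} (hf : AEMeasurable f (μ.restrict s)) :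
    ‖⨍ x in s, f x ∂μ‖ₑ ^ 2 ≤ (μ s)⁻¹ * ∫⁻ x in s, ‖f x‖ₑ ^ 2 ∂μ := by
  have hV : ‖(μ.real s)⁻¹‖ₑ = (μ s)⁻¹ := by
    rw [Real.enorm_of_nonneg (by positivity), measureReal_def, ENNReal.ofReal_inv_of_pos
      (ENNReal.toReal_pos h0 h1), ENNReal.ofReal_toReal h1]
  rw [setAverage_eq, enorm_smul, hV, mul_pow]
  calc (μ s)⁻¹ ^ 2 * ‖∫ x in s, f x ∂μ‖ₑ ^ 2
      ≤ (μ s)⁻¹ ^ 2 * ((∫⁻ x in s, ‖f x‖ₑ ^ 2 ∂μ) * μ s) := by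
        gcongr
        refine le_trans ?_ (sq_setLIntegral_le μ s hf.enorm)
        gcongr
        exact enorm_integral_le_lintegral_enorm _
    _ = (μ s)⁻¹ * (μ s)⁻¹ * μ s * ∫⁻ x in s, ‖f x‖ₑ ^ 2 ∂μ := by ring
    _ = _ := by rw [mul_assoc (μ s)⁻¹, ENNReal.inv_mul_cancel h0 h1, mul_one]

/-- The difference is the integral of the derivative along the segment from x to x + z;
Cauchy–Schwarz in the parameter, Fubini and translation invariance give the bound. -/
theorem lintegral_translate_sub_sq_le {φ : Plane → ℝ} (hφ : ContDiff ℝ 1 φ) (z : Plane) :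
    ∫⁻ x, ‖φ (x + z) - φ x‖ₑ ^ 2 ≤ ‖z‖ₑ ^ 2 * ∫⁻ x, ‖fderiv ℝ φ x‖ₑ ^ 2 := by
  have hc : Continuous (fderiv ℝ φ) := hφ.continuous_fderiv one_ne_zero
  have hpt : ∀ x, ‖φ (x + z) - φ x‖ₑ ^ 2 ≤
      ∫⁻ t in Set.Ioc (0 : ℝ) 1, ‖fderiv ℝ φ (x + t • z)‖ₑ ^ 2 * ‖z‖ₑ ^ 2 := by
    intro x
    have hd : ∀ t : ℝ, HasDerivAt (fun t : ℝ => φ (x + t • z)) (fderiv ℝ φ (x + t • z) z) t := by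
      intro t
      have h1 : HasDerivAt (fun t : ℝ => x + t • z) z t := by
        simpa using ((hasDerivAt_id t).smul_const z).const_add x
      exact (hφ.differentiable one_ne_zero _).hasFDerivAt.comp_hasDerivAt t h1
    have hcd : Continuous fun t : ℝ => fderiv ℝ φ (x + t • z) z :=
      (hc.comp (by fun_prop)).clm_apply continuous_const
    have h2 := intervalIntegral.integral_eq_sub_of_hasDerivAt (a := 0) (b := 1)
      (fun t _ => hd t) (hcd.intervalIntegrable _ _)
    simp only [one_smul, zero_smul, add_zero] at h2
    rw [← h2, intervalIntegral.integral_of_le zero_le_one]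
    calc _ ≤ (∫⁻ t in Set.Ioc (0 : ℝ) 1, ‖fderiv ℝ φ (x + t • z) z‖ₑ) ^ 2 := by
          gcongr
          exact enorm_integral_le_lintegral_enorm _
      _ ≤ _ := sq_setLIntegral_le _ _ hcd.enorm.measurable.aemeasurable
      _ ≤ _ := by
          rw [Real.volume_Ioc, sub_zero, ENNReal.ofReal_one, mul_one]
          gcongr with t
          rw [← mul_pow]
          gcongr
          exact ContinuousLinearMap.le_opENorm _ _
  have hm : Measurable fun p : Plane × ℝ => ‖fderiv ℝ φ (p.1 + p.2 • z)‖ₑ ^ 2 * ‖z‖ₑ ^ 2 :=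
    (((hc.comp (by fun_prop)).enorm.measurable.pow_const 2).mul_const _)
  calc _ ≤ ∫⁻ x, ∫⁻ t in Set.Ioc (0 : ℝ) 1, ‖fderiv ℝ φ (x + t • z)‖ₑ ^ 2 * ‖z‖ₑ ^ 2 :=
        lintegral_mono hpt
    _ = ∫⁻ t in Set.Ioc (0 : ℝ) 1, ∫⁻ x, ‖fderiv ℝ φ (x + t • z)‖ₑ ^ 2 * ‖z‖ₑ ^ 2 :=
        lintegral_lintegral_swap hm.aemeasurable
    _ = ∫⁻ t in Set.Ioc (0 : ℝ) 1, ‖z‖ₑ ^ 2 * ∫⁻ x, ‖fderiv ℝ φ x‖ₑ ^ 2 := by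
        congr with t
        rw [lintegral_mul_const' _ _ (by finiteness), mul_comm,
          lintegral_add_right_eq_self (fun x => ‖fderiv ℝ φ x‖ₑ ^ 2)]
    _ = _ := by rw [setLIntegral_const, Real.volume_Ioc]; simp

/-- The index of the cell containing `x` in the square lattice of mesh `s`. -/
def cellIndex (s : ℝ) (x : Plane) : Fin 2 → ℤ := fun i => ⌊x i / s⌋

theorem measurable_cellIndex (s : ℝ) : Measurable (cellIndex s) := by
  refine measurable_pi_iff.2 fun i => ?_
  exact Int.measurable_floor.comp
    ((EuclideanSpace.proj (𝕜 := ℝ) i).continuous.measurable.div_const s)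

theorem measurableSet_cell (s : ℝ) (k : Fin 2 → ℤ) : MeasurableSet (cellIndex s ⁻¹' {k}) :=
  measurable_cellIndex s (measurableSet_singleton k)

theorem volume_cell {s : ℝ} (hs : 0 < s) (k : Fin 2 → ℤ) :
    volume (cellIndex s ⁻¹' {k}) = ENNReal.ofReal (s ^ 2) := by
  have h : cellIndex s ⁻¹' {k} = WithLp.ofLp ⁻¹'
      (Set.pi Set.univ fun i => Set.Ico (k i * s) ((k i + 1) * s)) := by
    ext x
    simp only [Set.mem_preimage, Set.mem_singleton_iff, Set.mem_pi, Set.mem_univ, forall_const,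
      Set.mem_Ico, funext_iff, cellIndex, Int.floor_eq_iff, le_div_iff₀ hs, div_lt_iff₀ hs]
  rw [h, (PiLp.volume_preserving_ofLp (Fin 2)).measure_preimage
    (MeasurableSet.univ_pi fun i => measurableSet_Ico).nullMeasurableSet, Real.volume_pi_Ico]
  simp only [add_mul, one_mul, add_sub_cancel_left, Finset.prod_const, Finset.card_univ,
    Fintype.card_fin, ENNReal.ofReal_pow hs.le]

theorem norm_sub_le_of_cellIndex_eq {s : ℝ} (hs : 0 < s) {x y : Plane}
    (h : cellIndex s x = cellIndex s y) : ‖y - x‖ ≤ 2 * s := by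
  have hi : ∀ i, |y i - x i| ≤ s := fun i => by
    have := Int.abs_sub_lt_one_of_floor_eq_floor (congrFun h i)
    rw [← sub_div, abs_div, abs_of_pos hs, div_lt_one hs, abs_sub_comm] at this
    exact this.le
  rw [EuclideanSpace.norm_eq, Fin.sum_univ_two]
  refine Real.sqrt_le_iff.2 ⟨by positivity, ?_⟩
  simp only [PiLp.sub_apply, Real.norm_eq_abs]
  have h0 := pow_le_pow_left₀ (abs_nonneg _) (hi 0) 2
  have h1 := pow_le_pow_left₀ (abs_nonneg _) (hi 1) 2
  nlinarith

theorem finite_cellIndex_image {Ω : Set Plane} (hΩ : Bornology.IsBounded Ω) {s : ℝ} (hs : 0 < s) :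
    (cellIndex s '' Ω).Finite := by
  obtain ⟨R, hR⟩ := hΩ.exists_norm_le
  refine (Set.Finite.pi' fun _ : Fin 2 => Set.finite_Icc ⌊-R / s⌋ ⌊R / s⌋).subset ?_
  rintro _ ⟨x, hx, rfl⟩ i
  have h : |x i| ≤ R := (PiLp.norm_apply_le x i).trans (hR x hx)
  rw [abs_le] at h
  exact ⟨Int.floor_le_floor (by gcongr; exact h.1), Int.floor_le_floor (by gcongr; exact h.2)⟩

/-- The mean of `φ` on a cell of the square lattice. -/
def cellMean (s : ℝ) (φ : Plane → ℝ) (k : Fin 2 → ℤ) : ℝ := ⨍ y in cellIndex s ⁻¹' {k}, φ y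

/-- The Poincaré inequality on the cells of the square lattices of the plane. -/
theorem exists_lintegral_sub_cellMean_sq_le :
    ∃ C : ℝ, 0 < C ∧ ∀ φ : Plane → ℝ, ContDiff ℝ 1 φ → HasCompactSupport φ → ∀ s : ℝ, 0 < s →
      ∫⁻ x, ‖φ x - cellMean s φ (cellIndex s x)‖ₑ ^ 2 ≤
        ENNReal.ofReal (C * s ^ 2) * ∫⁻ x, ‖fderiv ℝ φ x‖ₑ ^ 2 := by
  set B : ℝ := volume.real (Metric.ball (0 : Plane) 1) with hB
  have hB0 : 0 < B := ENNReal.toReal_pos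
    (Metric.isOpen_ball.measure_pos volume ⟨0, by simp⟩).ne' measure_ball_lt_top.ne
  -- s^{-2} from the cell area, (2s)² from the translation estimate and (2s)²B for the area of the
  -- ball of translations: in all 16Bs².
  refine ⟨16 * B, by positivity, fun φ hφ hφc s hs => ?_⟩
  -- Jensen's inequality for the mean of φ(y) - φ(x), with y = x + z. Enlarging the translated cell
  -- to a ball removes the dependence of the domain on x, so that Fubini applies.
  have hpt : ∀ x, ‖φ x - cellMean s φ (cellIndex s x)‖ₑ ^ 2 ≤
      (ENNReal.ofReal (s ^ 2))⁻¹ *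
        ∫⁻ z in Metric.closedBall 0 (2 * s), ‖φ (x + z) - φ x‖ₑ ^ 2 := by
    intro x
    set Q := cellIndex s ⁻¹' {cellIndex s x} with hQ
    have hQv : volume Q = ENNReal.ofReal (s ^ 2) := volume_cell hs _
    have hQ0 : volume Q ≠ 0 := by rw [hQv]; positivity
    have hQt : volume Q ≠ ⊤ := by rw [hQv]; finiteness
    have hint : Integrable φ (volume.restrict Q) :=
      (hφ.continuous.integrable_of_hasCompactSupport hφc).restrict
    have : IsFiniteMeasure (volume.restrict Q) := ⟨by simpa using hQt.lt_top⟩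
    have e : cellMean s φ (cellIndex s x) - φ x = ⨍ y in Q, (φ y - φ x) := by
      rw [cellMean, setAverage_eq, setAverage_eq, integral_sub hint (integrable_const _),
        integral_const, smul_sub, measureReal_restrict_apply_univ, smul_smul,
        measureReal_def, inv_mul_cancel₀ (ENNReal.toReal_pos hQ0 hQt).ne', one_smul]
    rw [← enorm_neg, neg_sub, e]
    refine (enorm_setAverage_sq_le hQ0 hQt
      (hφ.continuous.sub continuous_const).measurable.aemeasurable).trans ?_
    rw [hQv]
    refine mul_le_mul_right ?_ _
    rw [← lintegral_indicator (measurableSet_cell s _),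
      ← lintegral_add_left_eq_self _ x, ← lintegral_indicator Metric.isClosed_closedBall.measurableSet]
    classical
    refine lintegral_mono fun z => ?_
    rw [Set.indicator_apply, Set.indicator_apply]
    split_ifs with h1 h2
    · exact le_rfl
    · refine absurd ?_ h2
      have h3 := norm_sub_le_of_cellIndex_eq hs (Eq.symm h1)
      rw [add_sub_cancel_left] at h3
      rwa [mem_closedBall_zero_iff]
    · exact zero_le
    · exact zero_le
  have hm : Measurable fun p : Plane × Plane => ‖φ (p.1 + p.2) - φ p.1‖ₑ ^ 2 := by
    have := hφ.continuous
    exact Measurable.pow_const (Continuous.measurable (Continuous.enorm (by fun_prop))) 2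
  calc _ ≤ ∫⁻ x, (ENNReal.ofReal (s ^ 2))⁻¹ *
        ∫⁻ z in Metric.closedBall 0 (2 * s), ‖φ (x + z) - φ x‖ₑ ^ 2 := lintegral_mono hpt
    _ = (ENNReal.ofReal (s ^ 2))⁻¹ *
        ∫⁻ z in Metric.closedBall (0 : Plane) (2 * s), ∫⁻ x, ‖φ (x + z) - φ x‖ₑ ^ 2 := by
        rw [lintegral_const_mul' _ _ (by simpa using hs.ne'),
          lintegral_lintegral_swap hm.aemeasurable]
    _ ≤ (ENNReal.ofReal (s ^ 2))⁻¹ * ∫⁻ z in Metric.closedBall (0 : Plane) (2 * s),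
          ENNReal.ofReal (2 * s) ^ 2 * ∫⁻ x, ‖fderiv ℝ φ x‖ₑ ^ 2 := by
        gcongr 1
        refine setLIntegral_mono' Metric.isClosed_closedBall.measurableSet fun z hz => ?_
        refine (lintegral_translate_sub_sq_le hφ z).trans ?_
        gcongr
        rw [← ofReal_norm]
        exact ENNReal.ofReal_le_ofReal (mem_closedBall_zero_iff.1 hz)
    _ = _ := by
        rw [setLIntegral_const, Measure.addHaar_closedBall _ _ (by positivity),
          finrank_euclideanSpace_fin, ← ofReal_measureReal, ← hB,
          ← ENNReal.ofReal_inv_of_pos (by positivity), ← ENNReal.ofReal_pow (by positivity),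
          mul_comm (ENNReal.ofReal _) (∫⁻ _, _), mul_assoc, ← ENNReal.ofReal_mul (by positivity),
          ← ENNReal.ofReal_mul (by positivity), mul_left_comm, ← ENNReal.ofReal_mul (by positivity),
          mul_comm]
        congr 2
        field_simp
        ring

theorem enorm_cellMean_sq_le {s : ℝ} (hs : 0 < s) {φ : Plane → ℝ} (hφ : Continuous φ)
    (k : Fin 2 → ℤ) :
    ‖cellMean s φ k‖ₑ ^ 2 ≤ (ENNReal.ofReal (s ^ 2))⁻¹ * ∫⁻ x, ‖φ x‖ₑ ^ 2 := by
  have hv := volume_cell hs k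
  refine (enorm_setAverage_sq_le (by rw [hv]; positivity) (by rw [hv]; finiteness)
    hφ.measurable.aemeasurable).trans ?_
  rw [hv]
  gcongr
  exact Measure.restrict_le_self

theorem norm_le_of_lintegral_enorm_sq_le {α F : Type*} [MeasurableSpace α] {μ : Measure α}
    [NormedAddCommGroup F] (f : Lp F 2 μ) {C : ℝ} (hC : 0 ≤ C)
    (h : ∫⁻ x, ‖f x‖ₑ ^ 2 ∂μ ≤ ENNReal.ofReal (C ^ 2)) : ‖f‖ ≤ C := by
  rw [lintegral_enorm_sq_eq_ofReal_norm_sq] at h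
  exact le_of_sq_le_sq ((ENNReal.ofReal_le_ofReal_iff (by positivity)).1 h) hC

theorem totallyBounded_of_forall_exists_dist_le {α : Type*} [PseudoMetricSpace α] {A : Set α}
    (h : ∀ ε > 0, ∃ B, TotallyBounded B ∧ ∀ a ∈ A, ∃ b ∈ B, dist a b ≤ ε) : TotallyBounded A := by
  refine Metric.totallyBounded_iff.2 fun ε hε => ?_
  obtain ⟨B, hB, hAB⟩ := h (ε / 2) (by positivity)
  obtain ⟨t, ht, hBt⟩ := Metric.totallyBounded_iff.1 hB (ε / 2) (by positivity)
  refine ⟨t, ht, fun a ha => ?_⟩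
  obtain ⟨b, hb, hab⟩ := hAB a ha
  obtain ⟨y, hy, hby⟩ := Set.mem_iUnion₂.1 (hBt hb)
  refine Set.mem_iUnion₂.2 ⟨y, hy, ?_⟩
  rw [Metric.mem_ball] at *
  linarith [dist_triangle a b y]

/-- Replacing φ by its cell means costs at most √C·s·M in L², and the resulting step functions have
bounded coefficients on the finitely many cells meeting Ω: a compact set in finite dimension. -/
theorem totallyBounded_fst_testPairs {Ω : Set Plane} (hΩ : Bornology.IsBounded Ω)
    (hΩm : MeasurableSet Ω) (M : ℝ) :
    TotallyBounded {f : Lp ℝ 2 (volume.restrict Ω) | ∃ p ∈ testPairs Ω, ‖p‖ ≤ M ∧ p.fst = f} := by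
  obtain ⟨C, hC, key⟩ := exists_lintegral_sub_cellMean_sq_le
  refine totallyBounded_of_forall_exists_dist_le fun ε hε => ?_
  -- Solves C s² (|M| + 1)² = ε².
  set s : ℝ := ε / (√C * (|M| + 1)) with hs
  have hs0 : 0 < s := by positivity
  set K : Finset (Fin 2 → ℤ) := (finite_cellIndex_image hΩ hs0).toFinset with hK
  have hfin : ∀ k, (volume.restrict Ω) (cellIndex s ⁻¹' {k}) ≠ ⊤ := fun k =>
    ne_top_of_le_ne_top (by rw [volume_cell hs0 k]; finiteness) (Measure.restrict_apply_le _ _)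
  set L : (K → ℝ) → Lp ℝ 2 (volume.restrict Ω) := fun c => ∑ k : K,
    c k • indicatorConstLp 2 (measurableSet_cell s k.1) (hfin k.1) (1 : ℝ) with hL
  have hLc : Continuous L := by fun_prop
  have hLx : ∀ c : (Fin 2 → ℤ) → ℝ, ∀ᵐ x ∂volume.restrict Ω,
      x ∈ Ω → L (fun k => c k.1) x = c (cellIndex s x) := by
    intro c
    have h1 : ∀ᵐ x ∂volume.restrict Ω, ∀ k : K,
        (c k.1 • indicatorConstLp 2 (measurableSet_cell s k.1) (hfin k.1) (1 : ℝ) :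
          Lp ℝ 2 (volume.restrict Ω)) x = (cellIndex s ⁻¹' {k.1}).indicator (fun _ => c k.1) x := by
      refine ae_all_iff.2 fun k => ?_
      filter_upwards [Lp.coeFn_smul (c k.1) (indicatorConstLp 2 (measurableSet_cell s k.1)
        (hfin k.1) (1 : ℝ)), indicatorConstLp_coeFn (p := 2) (hs := measurableSet_cell s k.1)
        (hμs := hfin k.1) (c := (1 : ℝ))] with x h2 h3
      rw [h2, Pi.smul_apply, h3]
      classical
      simp [Set.indicator_apply]
    filter_upwards [h1, Lp.coeFn_finsetSum Finset.univ fun k : K =>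
      (c k.1 • indicatorConstLp 2 (measurableSet_cell s k.1) (hfin k.1) (1 : ℝ) :
          Lp ℝ 2 (volume.restrict Ω))] with x h2 h3 hx
    rw [hL, h3, Finset.sum_apply]
    simp only [h2]
    have hxK : cellIndex s x ∈ K := (Set.Finite.mem_toFinset _).2 ⟨x, hx, rfl⟩
    rw [Finset.sum_eq_single_of_mem ⟨cellIndex s x, hxK⟩ (Finset.mem_univ _)]
    · exact Set.indicator_of_mem rfl _
    · intro k _ hk
      refine Set.indicator_of_notMem (fun h => hk (Subtype.ext ?_)) _
      exact Eq.symm h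
  -- By Jensen a cell mean is at most the L² norm of φ divided by the side s of the cell.
  refine ⟨L '' Metric.closedBall 0 (|M| / s),
    ((isCompact_closedBall _ _).image hLc).totallyBounded, ?_⟩
  rintro _ ⟨p, ⟨φ, hφ, h1, h2⟩, hpM, rfl⟩
  have hM : 0 ≤ M := (norm_nonneg p).trans hpM
  have hφ1 : ContDiff ℝ 1 φ := hφ.smooth.of_le (by exact_mod_cast le_top)
  have hp1 : ‖p.fst‖ ≤ M := (WithLp.norm_fst_le _ p).trans hpM
  have hp2 : ‖p.snd‖ ≤ M := (WithLp.norm_snd_le _ p).trans hpM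
  have hφ2 : ∫⁻ x, ‖φ x‖ₑ ^ 2 ≤ ENNReal.ofReal (M ^ 2) := by
    rw [← setLIntegral_eq_of_support_subset (s := Ω)]
    · calc _ = ∫⁻ x in Ω, ‖p.fst x‖ₑ ^ 2 := by
            refine lintegral_congr_ae ?_
            filter_upwards [h1] with x hx
            rw [hx]
        _ = ENNReal.ofReal (‖p.fst‖ ^ 2) := lintegral_enorm_sq_eq_ofReal_norm_sq _
        _ ≤ _ := by gcongr
    · intro x hx
      refine hφ.support (subset_tsupport φ fun h0 => hx ?_)
      simp [h0]
  have hg2 : ∫⁻ x, ‖fderiv ℝ φ x‖ₑ ^ 2 ≤ ENNReal.ofReal (M ^ 2) := by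
    rw [hφ.lintegral_fderiv]
    calc _ = ∫⁻ x in Ω, ‖p.snd x‖ₑ ^ 2 := by
          refine lintegral_congr_ae ?_
          filter_upwards [h2] with x hx
          rw [hx]
      _ = ENNReal.ofReal (‖p.snd‖ ^ 2) := lintegral_enorm_sq_eq_ofReal_norm_sq _
      _ ≤ _ := by gcongr
  refine ⟨_, ⟨fun k : K => cellMean s φ k.1, ?_, rfl⟩, ?_⟩
  · rw [mem_closedBall_zero_iff, pi_norm_le_iff_of_nonneg (by positivity)]
    intro k
    have h3 := (enorm_cellMean_sq_le hs0 hφ1.continuous k.1).trans (mul_le_mul_right hφ2 _)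
    rw [← ofReal_norm, ← ENNReal.ofReal_pow (norm_nonneg _),
      ← ENNReal.ofReal_inv_of_pos (by positivity), ← ENNReal.ofReal_mul (by positivity),
      ENNReal.ofReal_le_ofReal_iff (by positivity)] at h3
    refine le_of_sq_le_sq (h3.trans_eq ?_) (by positivity)
    rw [div_pow |M|, sq_abs, inv_mul_eq_div]
  · rw [dist_eq_norm]
    refine norm_le_of_lintegral_enorm_sq_le _ hε.le ?_
    have hmem : ∀ᵐ x ∂volume.restrict Ω, x ∈ Ω → p.fst x - L (fun k => cellMean s φ k.1) x =
        φ x - cellMean s φ (cellIndex s x) := by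
      filter_upwards [hLx (cellMean s φ), h1] with x h3 h4 hx
      rw [h3 hx, h4]
    calc _ = ∫⁻ x in Ω, ‖p.fst x - L (fun k => cellMean s φ k.1) x‖ₑ ^ 2 := by
          refine lintegral_congr_ae ?_
          filter_upwards [Lp.coeFn_sub p.fst (L fun k => cellMean s φ k.1)] with x hx
          rw [hx, Pi.sub_apply]
      _ ≤ ∫⁻ x in Ω, ‖φ x - cellMean s φ (cellIndex s x)‖ₑ ^ 2 := by
          refine lintegral_mono_ae ?_
          filter_upwards [hmem, ae_restrict_mem hΩm] with x h3 h4
          rw [h3 h4]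
      _ ≤ ENNReal.ofReal (C * s ^ 2) * ENNReal.ofReal (M ^ 2) :=
          (setLIntegral_le_lintegral _ _).trans ((key φ hφ1 hφ.compact s hs0).trans
            (mul_le_mul_right hg2 _))
      _ ≤ _ := by
          rw [← ENNReal.ofReal_mul (by positivity)]
          refine ENNReal.ofReal_le_ofReal ?_
          have h5 : C * s ^ 2 * (|M| + 1) ^ 2 = ε ^ 2 := by
            rw [hs, div_pow, mul_pow, Real.sq_sqrt hC.le]
            field_simp
          rw [← h5]
          gcongr
          rw [abs_of_nonneg hM]
          linarith

/-- The **Rellich–Kondrachov theorem** for `H^1_0(Ω)` in the plane. -/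
theorem H10.exists_subseq_tendsto_fn {Ω : Set Plane} (hΩ : Bornology.IsBounded Ω)
    (hΩm : MeasurableSet Ω) {M : ℝ} {w : ℕ → H10 Ω} (hw : ∀ n, ‖w n‖ ≤ M) :
    ∃ f : Lp ℝ 2 (volume.restrict Ω), ∃ ns : ℕ → ℕ, StrictMono ns ∧
      Tendsto (fun n => (w (ns n)).fn) atTop (𝓝 f) := by
  -- The margin 1 leaves room for test functions approximating an element of norm M.
  set A := {f : Lp ℝ 2 (volume.restrict Ω) | ∃ p ∈ testPairs Ω, ‖p‖ ≤ M + 1 ∧ p.fst = f}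
  have hA : IsCompact (closure A) := (totallyBounded_fst_testPairs hΩ hΩm (M + 1)).closure.isCompact_of_isClosed
    isClosed_closure
  have hmem : ∀ n, (w n).fn ∈ closure A := by
    intro n
    have hcl : (w n).1 ∈ closure (testPairs Ω : Set (L2Pair Ω)) := (w n).2
    obtain ⟨p, hp, hlim⟩ := mem_closure_iff_seq_limit.1 hcl
    have l1 : Tendsto (fun n => (p n).fst) atTop (𝓝 (w n).fn) :=
      ((WithLp.prod_continuous_ofLp 2 _ _).fst.tendsto _).comp hlim
    have hlt : ‖(w n).1‖ < M + 1 := lt_of_le_of_lt (hw n) (lt_add_one M)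
    refine mem_closure_of_tendsto l1 ?_
    filter_upwards [hlim.norm.eventually_lt_const hlt] with m hm
    exact ⟨p m, hp m, hm.le, rfl⟩
  obtain ⟨f, -, ns, hns, hlim⟩ := hA.tendsto_subseq hmem
  exact ⟨f, ns, hns, hlim⟩

/-! ### Growth of H and continuity of the superposition operator -/

section

variable {Ω : Set Plane} {H : Plane → Plane → ℝ}

theorem norm_le_abs_add_abs (W : Plane) : ‖W‖ ≤ |W 0| + |W 1| := by
  rw [EuclideanSpace.norm_eq, Fin.sum_univ_two]
  refine Real.sqrt_le_iff.2 ⟨by positivity, ?_⟩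
  simp only [Real.norm_eq_abs]
  nlinarith [abs_nonneg (W 0), abs_nonneg (W 1)]

theorem SubcriticalGrowth.exists_bound {h : Plane → Plane → ℝ} (hh : SubcriticalGrowth Ω h) {β : ℝ}
    (hβ : 0 < β) : ∃ r : ℝ, ∀ x ∈ Ω, ∀ W : Plane, r < ‖W‖ → |h x W| ≤ Real.exp (β * ‖W‖ ^ 2) := by
  have h1 := Metric.tendstoUniformlyOn_iff.1 (hh β hβ) 1 one_pos
  rw [← comap_norm_atTop, eventually_comap] at h1
  obtain ⟨r, hr⟩ := eventually_atTop.1 h1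
  refine ⟨r, fun x hx W hW => ?_⟩
  have h2 := hr ‖W‖ hW.le W rfl x hx
  rw [dist_zero_left, Real.norm_of_nonneg (by positivity), div_lt_one (Real.exp_pos _)] at h2
  exact h2.le

/-- Subcritical growth covers large W, boundedness of ∇H covers the rest. The resulting global
bound, for every β > 0, is the form in which the growth hypotheses are used. -/
theorem exists_norm_gradW_le_exp (hreg : Regular Ω H) (hu : SubcriticalGrowth Ω (Hu H))
    (hv : SubcriticalGrowth Ω (Hv H)) {β : ℝ} (hβ : 0 < β) :
    ∃ C : ℝ, 0 < C ∧ ∀ x ∈ Ω, ∀ W : Plane, ‖gradW H x W‖ ≤ C * Real.exp (β * ‖W‖ ^ 2) := by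
  obtain ⟨r₁, h1⟩ := hu.exists_bound hβ
  obtain ⟨r₂, h2⟩ := hv.exists_bound hβ
  obtain ⟨C, hC⟩ := hreg.bdd_gradW (max r₁ r₂)
  refine ⟨max C 2, by positivity, fun x hx W => ?_⟩
  rcases le_or_gt ‖W‖ (max r₁ r₂) with hW | hW
  · calc _ ≤ C := hC x hx W hW
      _ ≤ max C 2 := le_max_left _ _
      _ ≤ _ := le_mul_of_one_le_right (by positivity) (Real.one_le_exp (by positivity))
  · calc _ ≤ |Hu H x W| + |Hv H x W| := norm_le_abs_add_abs _
      _ ≤ 2 * Real.exp (β * ‖W‖ ^ 2) := by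
        linarith [h1 x hx W ((le_max_left _ _).trans_lt hW),
          h2 x hx W ((le_max_right _ _).trans_lt hW)]
      _ ≤ _ := by gcongr; exact le_max_right _ _

/-- (SL) only speaks of W ≠ 0; continuity carries H ≤ |W|² to the origin. -/
theorem apply_zero_eq_zero (hreg : Regular Ω H) (hH1 : CondH1 Ω H) (hSL : CondSL Ω H)
    {x : Plane} (hx : x ∈ Ω) : H x 0 = 0 := by
  refine le_antisymm ?_ (hH1 x hx 0).1
  have h1 : Tendsto (H x) (𝓝[≠] 0) (𝓝 (H x 0)) :=
    ((hreg.contDiff x hx).continuous.tendsto 0).mono_left nhdsWithin_le_nhds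
  have h2 : Tendsto (fun W : Plane => ‖W‖ ^ 2) (𝓝[≠] 0) (𝓝 0) := by
    have : Tendsto (fun W : Plane => ‖W‖ ^ 2) (𝓝 0) (𝓝 (‖(0 : Plane)‖ ^ 2)) :=
      (continuous_norm.pow 2).tendsto 0
    rw [norm_zero, zero_pow two_ne_zero] at this
    exact this.mono_left nhdsWithin_le_nhds
  refine le_of_tendsto_of_tendsto h1 h2 ?_
  filter_upwards [hSL 1 one_pos, self_mem_nhdsWithin] with W hW hW0
  have := hW x hx
  rw [div_lt_one (pow_pos (norm_pos_iff.2 hW0) 2)] at this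
  exact this.le

theorem Regular.hasGradientAt (hreg : Regular Ω H) {x : Plane} (hx : x ∈ Ω) (W : Plane) :
    HasGradientAt (H x) (gradW H x W) W :=
  ((hreg.contDiff x hx).differentiable one_ne_zero W).hasGradientAt

theorem le_of_forall_norm_gradW_le (hreg : Regular Ω H) {x : Plane} (hx : x ∈ Ω) (h0 : H x 0 = 0)
    {W : Plane} {C : ℝ} (hC : ∀ V : Plane, ‖V‖ ≤ ‖W‖ → ‖gradW H x V‖ ≤ C) :
    ‖H x W‖ ≤ C * ‖W‖ := by
  have := (convex_closedBall (0 : Plane) ‖W‖).norm_image_sub_le_of_norm_hasFDerivWithin_le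
    (f := H x) (C := C) (fun V _ => (hreg.hasGradientAt hx V).hasFDerivAt.hasFDerivWithinAt)
    (fun V hV => by
      rw [LinearIsometryEquiv.norm_map]
      exact hC V (mem_closedBall_zero_iff.1 hV))
    (Metric.mem_closedBall_self (norm_nonneg W)) (mem_closedBall_zero_iff.2 (le_refl ‖W‖))
  rwa [h0, sub_zero, sub_zero] at this

theorem norm_le_exp_of_norm_gradW_le_exp (hreg : Regular Ω H) {x : Plane} (hx : x ∈ Ω)
    (h0 : H x 0 = 0) {C β : ℝ} (hC0 : 0 ≤ C) (hβ : 0 ≤ β)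
    (hC : ∀ V : Plane, ‖gradW H x V‖ ≤ C * Real.exp (β * ‖V‖ ^ 2)) (W : Plane) :
    ‖H x W‖ ≤ C * Real.exp (β * ‖W‖ ^ 2) * ‖W‖ :=
  le_of_forall_norm_gradW_le hreg hx h0 fun V hV => (hC V).trans (by gcongr)

/-- Composition with a Carathéodory function preserves measurability. -/
theorem aestronglyMeasurable_comp_of_continuousOn {β : Type*} [TopologicalSpace β] [Zero β]
    [TopologicalSpace.PseudoMetrizableSpace β] [SecondCountableTopology β]
    [MeasurableSpace β] [BorelSpace β] (hΩ : MeasurableSet Ω)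
    {F : Plane → Plane → β} (hF : ContinuousOn (fun p : Plane × Plane => F p.1 p.2) (Ω ×ˢ Set.univ))
    {f : Plane → Plane} (hf : AEStronglyMeasurable f (volume.restrict Ω)) :
    AEStronglyMeasurable (fun x => F x (f x)) (volume.restrict Ω) := by
  classical
  have hm : Measurable ((Ω ×ˢ Set.univ).piecewise (fun p : Plane × Plane => F p.1 p.2) fun _ => 0) :=
    hF.measurable_piecewise continuousOn_const (hΩ.prod MeasurableSet.univ)
  have h1 : AEMeasurable (fun x => (x, f x)) (volume.restrict Ω) :=
    aemeasurable_id.prodMk hf.aemeasurable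
  refine (hm.comp_aemeasurable h1).aestronglyMeasurable.congr ?_
  filter_upwards [ae_restrict_mem hΩ] with x hx
  simp [Set.piecewise, hx]

/-- Fatou's lemma. The limit is merely a pointwise limit, not known to come from `H10`, so
Trudinger's inequality could not be applied to it directly. -/
theorem lintegral_exp_le_of_tendsto_ae {α : Type*} [MeasurableSpace α] {μ : Measure α} {c : ℝ}
    {A : ℝ≥0∞} {f : ℕ → α → Plane} {f' : α → Plane} (hf : ∀ n, AEStronglyMeasurable (f n) μ)
    (hexp : ∀ n, ∫⁻ x, ENNReal.ofReal (Real.exp (c * ‖f n x‖ ^ 2)) ∂μ ≤ A)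
    (hlim : ∀ᵐ x ∂μ, Tendsto (fun n => f n x) atTop (𝓝 (f' x))) :
    ∫⁻ x, ENNReal.ofReal (Real.exp (c * ‖f' x‖ ^ 2)) ∂μ ≤ A := by
  have hcont : Continuous fun W : Plane => ENNReal.ofReal (Real.exp (c * ‖W‖ ^ 2)) :=
    ENNReal.continuous_ofReal.comp (by fun_prop)
  calc _ ≤ ∫⁻ x, liminf (fun n => ENNReal.ofReal (Real.exp (c * ‖f n x‖ ^ 2))) atTop ∂μ := by
        refine lintegral_mono_ae ?_
        filter_upwards [hlim] with x hx
        exact (((hcont.tendsto _).comp hx).liminf_eq).ge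
    _ ≤ liminf (fun n => ∫⁻ x, ENNReal.ofReal (Real.exp (c * ‖f n x‖ ^ 2)) ∂μ) atTop :=
        lintegral_liminf_le' fun n => hcont.measurable.comp_aemeasurable (hf n).aemeasurable
    _ ≤ _ := liminf_le_of_frequently_le' (Frequently.of_forall hexp)

/-- The growth exponent c/4 is chosen so that the fourth power is absorbed by exp(c|f|²). An
exponent above 2 is what yields uniform integrability in L². -/
theorem lintegral_gradW_pow_four_le {C c : ℝ} (hΩ : MeasurableSet Ω)
    (hC : ∀ x ∈ Ω, ∀ W : Plane, ‖gradW H x W‖ ≤ C * Real.exp (c / 4 * ‖W‖ ^ 2))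
    {A : ℝ≥0∞} {f : Plane → Plane}
    (hexp : ∫⁻ x in Ω, ENNReal.ofReal (Real.exp (c * ‖f x‖ ^ 2)) ≤ A) :
    ∫⁻ x in Ω, ‖gradW H x (f x)‖ₑ ^ 4 ≤ ENNReal.ofReal (C ^ 4) * A := by
  calc _ ≤ ∫⁻ x in Ω, ENNReal.ofReal (C ^ 4) * ENNReal.ofReal (Real.exp (c * ‖f x‖ ^ 2)) := by
        refine setLIntegral_mono' hΩ fun x hx => ?_
        rw [← ENNReal.ofReal_mul (by positivity), ← ofReal_norm,
          ← ENNReal.ofReal_pow (norm_nonneg _)]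
        refine ENNReal.ofReal_le_ofReal ((pow_le_pow_left₀ (norm_nonneg _) (hC x hx _) 4).trans_eq ?_)
        rw [mul_pow, ← Real.exp_nat_mul]
        push_cast
        ring_nf
    _ ≤ _ := by
        rw [lintegral_const_mul' _ _ ENNReal.ofReal_ne_top]
        gcongr

theorem memLp_two_of_lintegral_pow_four {α F : Type*} [MeasurableSpace α] {μ : Measure α}
    [IsFiniteMeasure μ] [NormedAddCommGroup F] {f : α → F} (hf : AEStronglyMeasurable f μ)
    {A : ℝ≥0∞} (hA : A ≠ ⊤) (h : ∫⁻ x, ‖f x‖ₑ ^ 4 ∂μ ≤ A) : MemLp f 2 μ := by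
  have h4 : MemLp f 4 μ := by
    refine ⟨hf, ?_⟩
    rw [eLpNorm_lt_top_iff_lintegral_rpow_enorm_lt_top (by norm_num) (by norm_num)]
    refine lt_of_le_of_lt ?_ (h.trans_lt hA.lt_top)
    refine lintegral_mono fun x => le_of_eq ?_
    rw [show (4 : ℝ≥0∞).toReal = ((4 : ℕ) : ℝ) by norm_num, ENNReal.rpow_natCast]
  exact h4.mono_exponent (by norm_num)

theorem eLpNorm_two_sq {α F : Type*} [MeasurableSpace α] {μ : Measure α}
    [NormedAddCommGroup F] (f : α → F) : eLpNorm f 2 μ ^ 2 = ∫⁻ x, ‖f x‖ₑ ^ 2 ∂μ := by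
  rw [eLpNorm_eq_lintegral_rpow_enorm_toReal (by norm_num) (by norm_num), ← ENNReal.rpow_two,
    ← ENNReal.rpow_mul]
  simp

/-- Cauchy–Schwarz on s: the fourth power of the L² norm over s is at most (∫‖f‖⁴)·μ(s). -/
theorem unifIntegrable_two_of_lintegral_pow_four {α F : Type*} [MeasurableSpace α] {μ : Measure α}
    [NormedAddCommGroup F] {f : ℕ → α → F}
    (hf : ∀ n, AEStronglyMeasurable (f n) μ) {A : ℝ≥0∞} (hA : A ≠ ⊤)
    (h : ∀ n, ∫⁻ x, ‖f n x‖ₑ ^ 4 ∂μ ≤ A) : UnifIntegrable f 2 μ := by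
  intro ε hε
  have hA0 : 0 ≤ A.toReal := ENNReal.toReal_nonneg
  refine ⟨ε ^ 4 / (A.toReal + 1), by positivity, fun n s hs hμs => ?_⟩
  rw [eLpNorm_indicator_eq_eLpNorm_restrict hs, ← ENNReal.pow_le_pow_left_iff four_ne_zero]
  calc eLpNorm (f n) 2 (μ.restrict s) ^ 4 = (∫⁻ x in s, ‖f n x‖ₑ ^ 2 ∂μ) ^ 2 := by
        rw [← eLpNorm_two_sq, ← pow_mul]
    _ ≤ (∫⁻ x in s, (‖f n x‖ₑ ^ 2) ^ 2 ∂μ) * μ s :=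
        sq_setLIntegral_le μ s ((hf n).enorm.pow_const 2).restrict
    _ ≤ A * ENNReal.ofReal (ε ^ 4 / (A.toReal + 1)) := by
        gcongr
        refine le_trans (lintegral_mono' Measure.restrict_le_self fun x => ?_) (h n)
        rw [← pow_mul]
    _ ≤ ENNReal.ofReal ε ^ 4 := by
        rw [← ENNReal.ofReal_pow hε.le]
        nth_rw 1 [← ENNReal.ofReal_toReal hA]
        rw [← ENNReal.ofReal_mul hA0]
        refine ENNReal.ofReal_le_ofReal ?_
        rw [mul_div_assoc', div_le_iff₀ (by positivity)]
        nlinarith [pow_pos hε 4]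

/-- Continuity of the superposition operator of `∇H` along sequences with uniform exponential
bounds. -/
theorem tendsto_eLpNorm_gradW_sub {c : ℝ} (hΩ : MeasurableSet Ω) (hΩf : volume Ω ≠ ⊤)
    (hreg : Regular Ω H) (hu : SubcriticalGrowth Ω (Hu H))
    (hv : SubcriticalGrowth Ω (Hv H)) (hc : 0 < c) {A : ℝ≥0∞} (hA : A ≠ ⊤)
    {f : ℕ → Plane → Plane} {f' : Plane → Plane}
    (hf : ∀ n, AEStronglyMeasurable (f n) (volume.restrict Ω))
    (hexp : ∀ n, ∫⁻ x in Ω, ENNReal.ofReal (Real.exp (c * ‖f n x‖ ^ 2)) ≤ A)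
    (hlim : ∀ᵐ x ∂volume.restrict Ω, Tendsto (fun n => f n x) atTop (𝓝 (f' x))) :
    MemLp (fun x => gradW H x (f' x)) 2 (volume.restrict Ω) ∧
      Tendsto (fun n => eLpNorm ((fun x => gradW H x (f n x)) - fun x => gradW H x (f' x)) 2
        (volume.restrict Ω)) atTop (𝓝 0) := by
  have : IsFiniteMeasure (volume.restrict Ω) := ⟨by simpa using hΩf.lt_top⟩
  obtain ⟨C, hC0, hC⟩ := exists_norm_gradW_le_exp hreg hu hv (show 0 < c / 4 by positivity)
  have hB : ENNReal.ofReal (C ^ 4) * A ≠ ⊤ := by finiteness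
  have hf' : AEStronglyMeasurable f' (volume.restrict Ω) :=
    aestronglyMeasurable_of_tendsto_ae atTop hf hlim
  have hm : ∀ n, AEStronglyMeasurable (fun x => gradW H x (f n x)) (volume.restrict Ω) := fun n =>
    aestronglyMeasurable_comp_of_continuousOn hΩ hreg.cont_gradW (hf n)
  have hm' : AEStronglyMeasurable (fun x => gradW H x (f' x)) (volume.restrict Ω) :=
    aestronglyMeasurable_comp_of_continuousOn hΩ hreg.cont_gradW hf'
  have hmem : MemLp (fun x => gradW H x (f' x)) 2 (volume.restrict Ω) :=
    memLp_two_of_lintegral_pow_four hm' hB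
      (lintegral_gradW_pow_four_le hΩ hC (lintegral_exp_le_of_tendsto_ae hf hexp hlim))
  refine ⟨hmem, tendsto_Lp_finite_of_tendsto_ae (by norm_num) (by norm_num) hm hmem
    (unifIntegrable_two_of_lintegral_pow_four hm hB
      fun n => lintegral_gradW_pow_four_le hΩ hC (hexp n)) ?_⟩
  filter_upwards [hlim, ae_restrict_mem hΩ] with x hx hxΩ
  have h1 : ContinuousOn (fun W => gradW H x W) Set.univ :=
    hreg.cont_gradW.comp (f := fun W : Plane => (x, W)) (by fun_prop) fun W _ => ⟨hxΩ, trivial⟩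
  exact ((continuousOn_univ.1 h1).tendsto _).comp hx

end

/-! ### The potential energy on the product space -/

section

/-- The Hilbert space `H^1_0(Ω) × H^1_0(Ω)`. -/
abbrev H10Sq (Ω : Set Plane) : Type := WithLp 2 (H10 Ω × H10 Ω)

variable {Ω : Set Plane} {H : Plane → Plane → ℝ}

namespace H10

/-- `w ↦ w` as a continuous linear map from `H^1_0(Ω)` to `L²(Ω)`. -/
def fnL (Ω : Set Plane) : H10 Ω →L[ℝ] Lp ℝ 2 (volume.restrict Ω) :=
  (WithLp.fstL 2 ℝ _ _).comp (Submodule.subtypeL _)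

/-- `w ↦ ∇w` as a continuous linear map from `H^1_0(Ω)` to `L²(Ω, ℝ²)`. -/
def gradL (Ω : Set Plane) : H10 Ω →L[ℝ] Lp Plane 2 (volume.restrict Ω) :=
  (WithLp.sndL 2 ℝ _ _).comp (Submodule.subtypeL _)

theorem gradL_apply (w : H10 Ω) : gradL Ω w = w.grad := rfl

theorem dnorm_le_norm (w : H10 Ω) : w.dnorm ≤ ‖w‖ := by
  rw [dnorm_eq_norm]
  exact WithLp.norm_snd_le _ w.1

theorem norm_sq_eq (w : H10 Ω) : ‖w‖ ^ 2 = ‖w.fn‖ ^ 2 + w.dnorm ^ 2 := by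
  rw [dnorm_eq_norm]
  exact WithLp.prod_norm_sq_eq_of_L2 w.1

theorem dirichlet_eq_inner (w φ : H10 Ω) : w.dirichlet φ = inner ℝ (gradL Ω w) (gradL Ω φ) := by
  rw [L2.inner_def]
  rfl

/-- The **Poincaré inequality** in `H^1_0(Ω)`. -/
theorem exists_norm_fn_le_mul_dnorm (hΩ : volume Ω ≠ ⊤) :
    ∃ P : ℝ, 0 < P ∧ ∀ w : H10 Ω, ‖w.fn‖ ≤ P * w.dnorm := by
  -- Trudinger's inequality already contains Poincaré's, through t ≤ exp t with t = c(w/M)².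
  obtain ⟨c, hc, C, h⟩ := exists_lintegral_exp_sq_le
  set V : ℝ := max C 0 * (volume Ω).toReal with hV
  have hV0 : 0 ≤ V := by positivity
  set P : ℝ := √(V / c) + 1 with hP
  have hP0 : 0 < P := by positivity
  have key : ∀ (w : H10 Ω) (M : ℝ), 0 < M → w.dnorm ≤ M → ‖w.fn‖ ≤ P * M := by
    intro w M hM hw
    refine norm_le_of_lintegral_enorm_sq_le _ (by positivity) ?_
    calc ∫⁻ x in Ω, ‖w.fn x‖ₑ ^ 2
        ≤ ∫⁻ x in Ω, ENNReal.ofReal (M ^ 2 / c) *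
            ENNReal.ofReal (Real.exp (c * (w.fn x / M) ^ 2)) := by
          refine lintegral_mono fun x => ?_
          rw [← ENNReal.ofReal_mul (by positivity), ← ofReal_norm,
            ← ENNReal.ofReal_pow (norm_nonneg _), Real.norm_eq_abs, sq_abs]
          refine ENNReal.ofReal_le_ofReal ?_
          calc w.fn x ^ 2 = M ^ 2 / c * (c * (w.fn x / M) ^ 2) := by field_simp
            _ ≤ _ := by
              gcongr
              linarith [Real.add_one_le_exp (c * (w.fn x / M) ^ 2)]
      _ ≤ ENNReal.ofReal (M ^ 2 / c) * (ENNReal.ofReal C * volume Ω) := by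
          rw [lintegral_const_mul' _ _ ENNReal.ofReal_ne_top]
          gcongr
          exact h Ω w M hM hw
      _ ≤ ENNReal.ofReal (M ^ 2 / c) * ENNReal.ofReal V := by
          gcongr
          rw [hV, ENNReal.ofReal_mul (by positivity), ENNReal.ofReal_toReal hΩ]
          gcongr
          exact le_max_left _ _
      _ ≤ _ := by
          rw [← ENNReal.ofReal_mul (by positivity)]
          refine ENNReal.ofReal_le_ofReal ?_
          calc M ^ 2 / c * V = (√(V / c)) ^ 2 * M ^ 2 := by
                rw [Real.sq_sqrt (by positivity)]; field_simp
            _ ≤ P ^ 2 * M ^ 2 := by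
                gcongr
                linarith
            _ = _ := by ring
  -- M = dnorm + ε/P stays positive when the gradient vanishes; then ε → 0.
  refine ⟨P, hP0, fun w => le_of_forall_pos_le_add fun ε hε => ?_⟩
  have hd : 0 ≤ w.dnorm := Real.sqrt_nonneg _
  refine (key w (w.dnorm + ε / P) (by positivity) (by linarith [div_pos hε hP0])).trans_eq ?_
  rw [mul_add, mul_div_cancel₀ _ hP0.ne']

end H10

/-- The `ℝ²`-valued function `(u, v)` as an element of `L²(Ω, ℝ²)`. -/
def vecL (Ω : Set Plane) : H10Sq Ω →L[ℝ] Lp Plane 2 (volume.restrict Ω) :=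
  (((ContinuousLinearMap.toSpanSingleton ℝ (!₂[1, 0] : Plane)).compLpL 2 (volume.restrict Ω)).comp
      (H10.fnL Ω)).comp (WithLp.fstL 2 ℝ _ _) +
    (((ContinuousLinearMap.toSpanSingleton ℝ (!₂[0, 1] : Plane)).compLpL 2
      (volume.restrict Ω)).comp (H10.fnL Ω)).comp (WithLp.sndL 2 ℝ _ _)

theorem Lp_coeFn_add_smul {α F : Type*} [MeasurableSpace α] {μ : Measure α} [NormedAddCommGroup F]
    [NormedSpace ℝ F] (f g : Lp F 2 μ) (s : ℝ) : ⇑(f + s • g) =ᵐ[μ] fun x => f x + s • g x := by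
  filter_upwards [Lp.coeFn_add f (s • g), Lp.coeFn_smul s g] with x h1 h2
  rw [h1, Pi.add_apply, h2, Pi.smul_apply]

theorem vecL_add_smul (W Z : H10Sq Ω) (s : ℝ) :
    vecL Ω (W + s • Z) = vecL Ω W + s • vecL Ω Z := by
  have h1 := (vecL Ω).map_add W (s • Z)
  have h2 := (vecL Ω).map_smul s Z
  exact h1.trans (congrArg (vecL Ω W + ·) h2)

theorem coeFn_vecL (W : H10Sq Ω) :
    vecL Ω W =ᵐ[volume.restrict Ω] fun x => !₂[W.fst.fn x, W.snd.fn x] := by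
  have h1 := ContinuousLinearMap.coeFn_compLp
    (ContinuousLinearMap.toSpanSingleton ℝ (!₂[1, 0] : Plane)) W.fst.fn
  have h2 := ContinuousLinearMap.coeFn_compLp
    (ContinuousLinearMap.toSpanSingleton ℝ (!₂[0, 1] : Plane)) W.snd.fn
  have h3 := Lp.coeFn_add
    ((ContinuousLinearMap.toSpanSingleton ℝ (!₂[1, 0] : Plane)).compLp W.fst.fn)
    ((ContinuousLinearMap.toSpanSingleton ℝ (!₂[0, 1] : Plane)).compLp W.snd.fn)
  filter_upwards [h1, h2, h3] with x e1 e2 e3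
  change ((ContinuousLinearMap.toSpanSingleton ℝ (!₂[1, 0] : Plane)).compLp W.fst.fn +
    (ContinuousLinearMap.toSpanSingleton ℝ (!₂[0, 1] : Plane)).compLp W.snd.fn :
      Lp Plane 2 (volume.restrict Ω)) x = _
  rw [e3, Pi.add_apply, e1, e2]
  ext i
  fin_cases i <;> simp

attribute [irreducible] vecL

theorem norm_vec_sq (a b : ℝ) : ‖(!₂[a, b] : Plane)‖ ^ 2 = a ^ 2 + b ^ 2 := by
  rw [EuclideanSpace.norm_sq_eq, Fin.sum_univ_two]
  simp

/-- The Trudinger inequality in `H^1_0(Ω, ℝ²)`, with non-optimal constants. -/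
theorem exists_lintegral_exp_vecL_le :
    ∃ c : ℝ, 0 < c ∧ ∃ C : ℝ, ∀ (Ω : Set Plane) (W : H10Sq Ω) (M : ℝ), 0 < M →
      W.fst.dnorm ≤ M → W.snd.dnorm ≤ M →
      ∫⁻ x in Ω, ENNReal.ofReal (Real.exp (c / M ^ 2 * ‖vecL Ω W x‖ ^ 2)) ≤
        ENNReal.ofReal C * volume Ω := by
  obtain ⟨c, hc, C, h⟩ := H10.exists_lintegral_exp_sq_le
  -- Halving c allows exp((p+q)/2) ≤ exp p + exp q, which separates the two components.
  refine ⟨c / 2, by positivity, 2 * C, fun Ω W M hM h1 h2 => ?_⟩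
  calc _ ≤ ∫⁻ x in Ω, (ENNReal.ofReal (Real.exp (c * (W.fst.fn x / M) ^ 2)) +
        ENNReal.ofReal (Real.exp (c * (W.snd.fn x / M) ^ 2))) := by
        refine lintegral_mono_ae ?_
        filter_upwards [coeFn_vecL W] with x hx
        rw [← ENNReal.ofReal_add (Real.exp_pos _).le (Real.exp_pos _).le, hx, norm_vec_sq]
        refine ENNReal.ofReal_le_ofReal ?_
        set p := c * (W.fst.fn x / M) ^ 2
        set q := c * (W.snd.fn x / M) ^ 2
        have e : c / 2 / M ^ 2 * (W.fst.fn x ^ 2 + W.snd.fn x ^ 2) = (p + q) / 2 := by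
          simp only [p, q]; field_simp
        rw [e]
        rcases le_total p q with hpq | hpq
        · calc _ ≤ Real.exp q := Real.exp_le_exp.2 (by linarith)
            _ ≤ _ := by linarith [Real.exp_pos p]
        · calc _ ≤ Real.exp p := Real.exp_le_exp.2 (by linarith)
            _ ≤ _ := by linarith [Real.exp_pos q]
    _ ≤ ENNReal.ofReal C * volume Ω + ENNReal.ofReal C * volume Ω := by
        have hm : AEMeasurable (fun x => ENNReal.ofReal (Real.exp (c * (W.fst.fn x / M) ^ 2)))
            (volume.restrict Ω) := (Real.measurable_exp.comp_aemeasurable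
          (((Lp.aestronglyMeasurable W.fst.fn).aemeasurable.div_const M).pow_const 2 |>.const_mul
            c)).ennreal_ofReal
        rw [lintegral_add_left' hm]
        exact add_le_add (h Ω _ M hM h1) (h Ω _ M hM h2)
    _ = _ := by
        rw [ENNReal.ofReal_mul zero_le_two, ENNReal.ofReal_ofNat, ← two_mul, mul_assoc]

/-- The data of the problem, without the conditions at infinity: `H` is regular, has subcritical
growth and vanishes at `W = 0`. -/
structure Admissible (Ω : Set Plane) (H : Plane → Plane → ℝ) : Prop where
  isOpen : IsOpen Ω
  isBounded : Bornology.IsBounded Ω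
  regular : Regular Ω H
  growth_u : SubcriticalGrowth Ω (Hu H)
  growth_v : SubcriticalGrowth Ω (Hv H)
  zero : ∀ x ∈ Ω, H x 0 = 0

/-- The superposition operator `f ↦ ∇H(·, f)` on `L²(Ω, ℝ²)`, with value `0` where `∇H(·, f)` is not
square integrable. -/
def superpose (Ω : Set Plane) (H : Plane → Plane → ℝ) (f : Lp Plane 2 (volume.restrict Ω)) :
    Lp Plane 2 (volume.restrict Ω) :=
  open Classical in
  if h : MemLp (fun x => gradW H x (f x)) 2 (volume.restrict Ω) then h.toLp _ else 0

/-- The potential energy `∫_Ω H(x, W) dx`. -/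
def potential (Ω : Set Plane) (H : Plane → Plane → ℝ) (W : H10Sq Ω) : ℝ :=
  ∫ x in Ω, H x (vecL Ω W x)

theorem potential_add_smul (W Z : H10Sq Ω) (s : ℝ) : potential Ω H (W + s • Z) =
    ∫ x in Ω, H x (vecL Ω W x + s • vecL Ω Z x) := by
  rw [potential, vecL_add_smul]
  refine integral_congr_ae ?_
  filter_upwards [Lp_coeFn_add_smul (vecL Ω W) (vecL Ω Z) s] with x hx
  exact congrArg (H x) hx

theorem le_mul_exp_sq {β : ℝ} (hβ : 0 < β) (t : ℝ) : t ≤ (1 + 1 / β) * Real.exp (β * t ^ 2) := by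
  calc t ≤ 1 + t ^ 2 := by nlinarith [sq_nonneg (t - 1)]
    _ ≤ (1 + 1 / β) * (β * t ^ 2 + 1) := by
      have : (1 + 1 / β) * (β * t ^ 2 + 1) = β * t ^ 2 + 1 + t ^ 2 + 1 / β := by field_simp; ring
      rw [this]
      have : 0 ≤ β * t ^ 2 := by positivity
      have : 0 < 1 / β := by positivity
      linarith
    _ ≤ _ := by
      gcongr
      exact Real.add_one_le_exp _

namespace Admissible

theorem volume_ne_top (hA : Admissible Ω H) : volume Ω ≠ ⊤ := hA.isBounded.measure_lt_top.ne

theorem measurableSet (hA : Admissible Ω H) : MeasurableSet Ω := hA.isOpen.measurableSet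

theorem isFiniteMeasure (hA : Admissible Ω H) : IsFiniteMeasure (volume.restrict Ω) :=
  ⟨by simpa using hA.volume_ne_top.lt_top⟩

/-- The exponent shrinks like M^{-2}; this is harmless because the growth bound on ∇H is available
for every β > 0. -/
theorem exists_lintegral_exp_le (hA : Admissible Ω H) (M : ℝ) : ∃ c : ℝ, 0 < c ∧ ∃ A : ℝ≥0∞, A ≠ ⊤ ∧
    ∀ W : H10Sq Ω, ‖W‖ ≤ M →
      ∫⁻ x in Ω, ENNReal.ofReal (Real.exp (c * ‖vecL Ω W x‖ ^ 2)) ≤ A := by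
  obtain ⟨c, hc, C, h⟩ := exists_lintegral_exp_vecL_le
  have hV := hA.volume_ne_top
  refine ⟨c / (|M| + 1) ^ 2, by positivity, ENNReal.ofReal C * volume Ω, by finiteness,
    fun W hW => h Ω W (|M| + 1) (by positivity) ?_ ?_⟩
  · linarith [W.fst.dnorm_le_norm, WithLp.norm_fst_le _ W, le_abs_self M]
  · linarith [W.snd.dnorm_le_norm, WithLp.norm_snd_le _ W, le_abs_self M]

theorem exists_integrable_exp (hA : Admissible Ω H) (M : ℝ) : ∃ c : ℝ, 0 < c ∧
    ∀ W : H10Sq Ω, ‖W‖ ≤ M →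
      Integrable (fun x => Real.exp (c * ‖vecL Ω W x‖ ^ 2)) (volume.restrict Ω) := by
  obtain ⟨c, hc, A, hAt, h⟩ := hA.exists_lintegral_exp_le M
  refine ⟨c, hc, fun W hW => ⟨?_, ?_⟩⟩
  · exact (Real.measurable_exp.comp_aemeasurable
      (((Lp.aestronglyMeasurable _).aemeasurable.norm.pow_const 2).const_mul c)).aestronglyMeasurable
  · rw [hasFiniteIntegral_iff_ofReal (Eventually.of_forall fun x => (Real.exp_pos _).le)]
    exact (h W hW).trans_lt hAt.lt_top

/-- The common source of square integrability (constant sequences), continuity and compactness of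
the superposition operator. The limit f is an arbitrary function, so no weak limit in `H10Sq` has to
be identified. -/
theorem exists_tendsto_superpose (hA : Admissible Ω H) {M : ℝ} {W : ℕ → H10Sq Ω}
    (hW : ∀ n, ‖W n‖ ≤ M) {f : Plane → Plane}
    (hf : ∀ᵐ x ∂volume.restrict Ω, Tendsto (fun n => vecL Ω (W n) x) atTop (𝓝 (f x))) :
    ∃ h : MemLp (fun x => gradW H x (f x)) 2 (volume.restrict Ω),
      Tendsto (fun n => superpose Ω H (vecL Ω (W n))) atTop (𝓝 (h.toLp _)) := by
  obtain ⟨c, hc, A, hAt, h⟩ := hA.exists_lintegral_exp_le M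
  obtain ⟨hmem, hlim⟩ := tendsto_eLpNorm_gradW_sub hA.measurableSet hA.volume_ne_top hA.regular
    hA.growth_u hA.growth_v hc hAt (fun n => Lp.aestronglyMeasurable (vecL Ω (W n)))
    (fun n => h _ (hW n)) hf
  have hmemn : ∀ n, MemLp (fun x => gradW H x (vecL Ω (W n) x)) 2 (volume.restrict Ω) := fun n =>
    (tendsto_eLpNorm_gradW_sub hA.measurableSet hA.volume_ne_top hA.regular
      hA.growth_u hA.growth_v hc hAt (fun _ => Lp.aestronglyMeasurable (vecL Ω (W n)))
      (fun _ => h _ (hW n)) (Eventually.of_forall fun _ => tendsto_const_nhds)).1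
  refine ⟨hmem, ?_⟩
  have e : ∀ n, superpose Ω H (vecL Ω (W n)) = (hmemn n).toLp _ := fun n => dif_pos (hmemn n)
  simp only [e]
  exact (Lp.tendsto_Lp_iff_tendsto_eLpNorm'' _ hmemn _ hmem).2 hlim

theorem memLp_gradW (hA : Admissible Ω H) (W : H10Sq Ω) :
    MemLp (fun x => gradW H x (vecL Ω W x)) 2 (volume.restrict Ω) :=
  (hA.exists_tendsto_superpose (W := fun _ => W) (fun _ => le_rfl)
    (Eventually.of_forall fun _ => tendsto_const_nhds)).1

theorem superpose_vecL (hA : Admissible Ω H) (W : H10Sq Ω) :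
    superpose Ω H (vecL Ω W) = (hA.memLp_gradW W).toLp _ :=
  dif_pos (hA.memLp_gradW W)

/-- Every subsequence has a further one converging a.e., along which the images converge to the same
limit. -/
theorem continuous_superpose (hA : Admissible Ω H) :
    Continuous fun W : H10Sq Ω => superpose Ω H (vecL Ω W) := by
  refine continuous_iff_seqContinuous.2 fun W W' hW => ?_
  refine tendsto_of_subseq_tendsto fun ns hns => ?_
  have h1 : Tendsto (fun n => vecL Ω (W (ns n))) atTop (𝓝 (vecL Ω W')) :=
    ((vecL Ω).continuous.tendsto W').comp (hW.comp hns)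
  obtain ⟨ms, hms, hae⟩ := (tendstoInMeasure_of_tendsto_Lp h1).exists_seq_tendsto_ae
  obtain ⟨M, hM⟩ := (Metric.isBounded_range_of_tendsto W hW).exists_norm_le
  obtain ⟨h, hlim⟩ := hA.exists_tendsto_superpose (W := fun n => W (ns (ms n)))
    (fun n => hM _ ⟨_, rfl⟩) hae
  refine ⟨ms, ?_⟩
  rw [hA.superpose_vecL W']
  exact hlim

theorem inner_superpose (hA : Admissible Ω H) (W Z : H10Sq Ω) :
    inner ℝ (superpose Ω H (vecL Ω W)) (vecL Ω Z) =
      ∫ x in Ω, inner ℝ (gradW H x (vecL Ω W x)) (vecL Ω Z x) := by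
  rw [hA.superpose_vecL, L2.inner_def]
  refine integral_congr_ae ?_
  filter_upwards [(hA.memLp_gradW W).coeFn_toLp] with x hx
  exact congrArg (fun t => inner ℝ t (vecL Ω Z x)) hx

theorem aestronglyMeasurable_gradW (hA : Admissible Ω H) {f : Plane → Plane}
    (hf : AEStronglyMeasurable f (volume.restrict Ω)) :
    AEStronglyMeasurable (fun x => gradW H x (f x)) (volume.restrict Ω) :=
  aestronglyMeasurable_comp_of_continuousOn hA.measurableSet hA.regular.cont_gradW hf

theorem aestronglyMeasurable_comp (hA : Admissible Ω H) {f : Plane → Plane}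
    (hf : AEStronglyMeasurable f (volume.restrict Ω)) :
    AEStronglyMeasurable (fun x => H x (f x)) (volume.restrict Ω) :=
  aestronglyMeasurable_comp_of_continuousOn hA.measurableSet hA.regular.cont hf

theorem integrable_comp_of_integrable_exp (hA : Admissible Ω H) {c : ℝ} (hc : 0 < c)
    {a : Plane → Plane} (ha : AEStronglyMeasurable a (volume.restrict Ω))
    (hint : Integrable (fun x => Real.exp (c * ‖a x‖ ^ 2)) (volume.restrict Ω)) :
    Integrable (fun x => H x (a x)) (volume.restrict Ω) := by
  obtain ⟨C, hC0, hC⟩ := exists_norm_gradW_le_exp hA.regular hA.growth_u hA.growth_v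
    (show 0 < c / 2 by positivity)
  refine (hint.const_mul (C * (1 + 1 / (c / 2)))).mono' (hA.aestronglyMeasurable_comp ha) ?_
  filter_upwards [ae_restrict_mem hA.measurableSet] with x hx
  set y := a x
  calc ‖H x y‖ ≤ C * Real.exp (c / 2 * ‖y‖ ^ 2) * ‖y‖ :=
        norm_le_exp_of_norm_gradW_le_exp hA.regular hx (hA.zero x hx) hC0.le (by positivity)
          (hC x hx) y
    _ ≤ C * Real.exp (c / 2 * ‖y‖ ^ 2) *
        ((1 + 1 / (c / 2)) * Real.exp (c / 2 * ‖y‖ ^ 2)) := by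
        gcongr
        exact le_mul_exp_sq (by positivity) _
    _ = C * (1 + 1 / (c / 2)) * (Real.exp (c / 2 * ‖y‖ ^ 2) * Real.exp (c / 2 * ‖y‖ ^ 2)) := by ring
    _ = _ := by
        rw [← Real.exp_add]
        ring_nf

/-- Differentiation under the integral sign, dominated for |s| < 1 through the exponential bounds on
a and z. -/
theorem hasDerivAt_integral_comp (hA : Admissible Ω H) {c : ℝ} (hc : 0 < c)
    {a z : Plane → Plane} (ha : AEStronglyMeasurable a (volume.restrict Ω))
    (hz : AEStronglyMeasurable z (volume.restrict Ω))
    (ia : Integrable (fun x => Real.exp (c * ‖a x‖ ^ 2)) (volume.restrict Ω))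
    (iz : Integrable (fun x => Real.exp (c * ‖z x‖ ^ 2)) (volume.restrict Ω)) :
    HasDerivAt (fun s : ℝ => ∫ x in Ω, H x (a x + s • z x))
      (∫ x in Ω, inner ℝ (gradW H x (a x)) (z x)) 0 := by
  -- The exponents met below add up to at most 2β|a|² + 3β|z|² ≤ 5β max(|a|², |z|²), within c
  -- max(|a|², |z|²).
  set β := c / 6 with hβ
  have hβ0 : 0 < β := by positivity
  have hcβ : c = 6 * β := by rw [hβ]; ring
  obtain ⟨C, hC0, hC⟩ := exists_norm_gradW_le_exp hA.regular hA.growth_u hA.growth_v hβ0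
  have hms : ∀ s : ℝ, AEStronglyMeasurable (fun x => a x + s • z x) (volume.restrict Ω) :=
    fun s => ha.add (hz.const_smul s)
  have key := hasDerivAt_integral_of_dominated_loc_of_deriv_le (μ := volume.restrict Ω)
    (F := fun (s : ℝ) x => H x (a x + s • z x))
    (F' := fun (s : ℝ) x => inner ℝ (gradW H x (a x + s • z x)) (z x))
    (x₀ := 0) (s := Metric.ball 0 1)
    (bound := fun x => C * (1 + 1 / β) * (Real.exp (c * ‖a x‖ ^ 2) + Real.exp (c * ‖z x‖ ^ 2)))
    (Metric.ball_mem_nhds 0 one_pos)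
    (Eventually.of_forall fun s => hA.aestronglyMeasurable_comp (hms s))
    (by simpa only [zero_smul, add_zero] using hA.integrable_comp_of_integrable_exp hc ha ia)
    ((hA.aestronglyMeasurable_gradW (hms 0)).inner hz)
    ?_ ((ia.add iz).const_mul _) ?_
  · simpa only [zero_smul, add_zero] using key.2
  · filter_upwards [ae_restrict_mem hA.measurableSet] with x hx s hs
    rw [mem_ball_zero_iff] at hs
    generalize a x = a
    generalize z x = z
    have h1 : ‖a + s • z‖ ≤ ‖a‖ + ‖z‖ := (norm_add_le _ _).trans (by
      rw [norm_smul]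
      gcongr
      exact mul_le_of_le_one_left (norm_nonneg _) hs.le)
    have h2 : ‖a + s • z‖ ^ 2 ≤ (‖a‖ + ‖z‖) ^ 2 := by gcongr
    have h3 : β * ‖a + s • z‖ ^ 2 + β * ‖z‖ ^ 2 ≤ 2 * (β * ‖a‖ ^ 2) + 3 * (β * ‖z‖ ^ 2) := by
      nlinarith [sq_nonneg (‖a‖ - ‖z‖)]
    have h4 : 0 ≤ β * ‖a‖ ^ 2 := by positivity
    have h5 : 0 ≤ β * ‖z‖ ^ 2 := by positivity
    calc ‖inner ℝ (gradW H x (a + s • z)) z‖ ≤ ‖gradW H x (a + s • z)‖ * ‖z‖ :=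
          norm_inner_le_norm _ _
      _ ≤ (C * Real.exp (β * ‖a + s • z‖ ^ 2)) * ((1 + 1 / β) * Real.exp (β * ‖z‖ ^ 2)) := by
          gcongr
          · exact hC x hx _
          · exact le_mul_exp_sq hβ0 _
      _ = C * (1 + 1 / β) * Real.exp (β * ‖a + s • z‖ ^ 2 + β * ‖z‖ ^ 2) := by
          rw [Real.exp_add]; ring
      _ ≤ _ := by
          gcongr
          rcases le_total (β * ‖a‖ ^ 2) (β * ‖z‖ ^ 2) with h | h
          · calc _ ≤ Real.exp (c * ‖z‖ ^ 2) := Real.exp_le_exp.2 (by rw [hcβ]; linarith)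
              _ ≤ _ := by linarith [Real.exp_pos (c * ‖a‖ ^ 2)]
          · calc _ ≤ Real.exp (c * ‖a‖ ^ 2) := Real.exp_le_exp.2 (by rw [hcβ]; linarith)
              _ ≤ _ := by linarith [Real.exp_pos (c * ‖z‖ ^ 2)]
  · filter_upwards [ae_restrict_mem hA.measurableSet] with x hx s _
    have h1 : HasDerivAt (fun s : ℝ => a x + s • z x) (z x) s := by
      simpa using ((hasDerivAt_id s).smul_const (z x)).const_add (a x)
    exact (hA.regular.hasGradientAt hx _).hasFDerivAt.comp_hasDerivAt s h1

theorem integrable_comp (hA : Admissible Ω H) (W : H10Sq Ω) :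
    Integrable (fun x => H x (vecL Ω W x)) (volume.restrict Ω) := by
  obtain ⟨c, hc, hint⟩ := hA.exists_integrable_exp ‖W‖
  exact hA.integrable_comp_of_integrable_exp hc (Lp.aestronglyMeasurable _) (hint W le_rfl)

theorem hasDerivAt_potential (hA : Admissible Ω H) (W Z : H10Sq Ω) :
    HasDerivAt (fun s : ℝ => potential Ω H (W + s • Z))
      (inner ℝ (superpose Ω H (vecL Ω W)) (vecL Ω Z)) 0 := by
  simp only [potential_add_smul]
  obtain ⟨c, hc, hint⟩ := hA.exists_integrable_exp (max ‖W‖ ‖Z‖)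
  have h := hA.hasDerivAt_integral_comp hc (Lp.aestronglyMeasurable _) (Lp.aestronglyMeasurable _)
    (hint W (le_max_left _ _)) (hint Z (le_max_right _ _))
  exact h.congr_deriv (hA.inner_superpose W Z).symm

end Admissible

end

/-! ### Kirchhoff functionals in Hilbert spaces -/

section

variable {E F : Type*} [NormedAddCommGroup E] [InnerProductSpace ℝ E] [CompleteSpace E]
  [NormedAddCommGroup F] [InnerProductSpace ℝ F] [CompleteSpace F]

/-- The energy `(a/2) ‖Au‖² + (b/2θ) ‖Au‖^{2θ}` of a Kirchhoff operator. -/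
def energy (A : E →L[ℝ] F) (a b θ : ℝ) (u : E) : ℝ :=
  a / 2 * ‖A u‖ ^ 2 + b / (2 * θ) * (‖A u‖ ^ 2) ^ θ

/-- The Kirchhoff operator `(a + b ‖Au‖^{2(θ-1)}) A*A u`, the gradient of `energy`. -/
def energyGrad (A : E →L[ℝ] F) (a b θ : ℝ) (u : E) : E :=
  (a + b * (‖A u‖ ^ 2) ^ (θ - 1)) • ContinuousLinearMap.adjoint A (A u)

section
variable {A : E →L[ℝ] F} {a b θ : ℝ}

theorem inner_energyGrad (u z : E) : inner ℝ (energyGrad A a b θ u) z =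
    (a + b * (‖A u‖ ^ 2) ^ (θ - 1)) * inner ℝ (A u) (A z) := by
  rw [energyGrad, real_inner_smul_left, ContinuousLinearMap.adjoint_inner_left]

theorem hasDerivAt_energy (hθ : 1 < θ) (u z : E) :
    HasDerivAt (fun s : ℝ => energy A a b θ (u + s • z)) (inner ℝ (energyGrad A a b θ u) z) 0 := by
  have h1 : HasDerivAt (fun s : ℝ => A (u + s • z)) (A z) 0 := by
    simp only [map_add, map_smul]
    simpa using ((hasDerivAt_id (0 : ℝ)).smul_const (A z)).const_add (A u)
  have h2 := h1.norm_sq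
  -- As θ ≥ 1, q ↦ q^θ is differentiable at q = 0 too, so Au = 0 needs no separate case.
  have h3 := h2.rpow_const (p := θ) (Or.inr hθ.le)
  refine ((h2.const_mul (a / 2)).add (h3.const_mul (b / (2 * θ)))).congr_deriv ?_
  have : θ ≠ 0 := by positivity
  rw [inner_energyGrad, zero_smul, add_zero]
  field_simp

theorem continuous_energyGrad (hθ : 1 < θ) : Continuous (energyGrad A a b θ) := by
  have h1 : Continuous fun u => (‖A u‖ ^ 2) ^ (θ - 1) :=
    (A.continuous.norm.pow 2).rpow_const fun _ => Or.inr (by linarith)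
  exact (continuous_const.add (continuous_const.mul h1)).smul
    ((ContinuousLinearMap.adjoint A).continuous.comp A.continuous)

theorem rpow_sub_one_mul_self {q : ℝ} (hq : 0 ≤ q) (hθ : 1 < θ) : q ^ (θ - 1) * q = q ^ θ := by
  rcases hq.eq_or_lt with rfl | hq
  · rw [mul_zero, Real.zero_rpow (by linarith)]
  · rw [Real.rpow_sub_one hq.ne', div_mul_cancel₀ _ hq.ne']

/-- The Kirchhoff term contributes (μ/(2θ) - 1)·b·‖Au‖^{2θ}, nonnegative because μ ≥ 2θ; only the
quadratic part is kept. This bounds Palais–Smale sequences. -/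
theorem mul_energy_sub_inner_energyGrad (hb : 0 ≤ b) (hθ : 1 < θ) {μ : ℝ}
    (hμ : 2 * θ ≤ μ) (u : E) :
    (μ / 2 - 1) * (a * ‖A u‖ ^ 2) ≤ μ * energy A a b θ u - inner ℝ (energyGrad A a b θ u) u := by
  have h0 : (0 : ℝ) ≤ ‖A u‖ ^ 2 := by positivity
  rw [inner_energyGrad, real_inner_self_eq_norm_sq, add_mul, mul_assoc b,
    rpow_sub_one_mul_self h0 hθ, energy]
  have h1 : 1 ≤ μ / (2 * θ) := by rw [le_div_iff₀ (by positivity)]; linarith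
  have h2 : 0 ≤ b * (‖A u‖ ^ 2) ^ θ := by positivity
  have h3 : μ * (a / 2 * ‖A u‖ ^ 2 + b / (2 * θ) * (‖A u‖ ^ 2) ^ θ) -
      (a * ‖A u‖ ^ 2 + b * (‖A u‖ ^ 2) ^ θ) - (μ / 2 - 1) * (a * ‖A u‖ ^ 2) =
      (μ / (2 * θ) - 1) * (b * (‖A u‖ ^ 2) ^ θ) := by ring
  have h4 : 0 ≤ (μ / (2 * θ) - 1) * (b * (‖A u‖ ^ 2) ^ θ) := mul_nonneg (by linarith) h2
  linarith

/-- Compactness property of the Kirchhoff operator. -/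
theorem exists_tendsto_of_tendsto_energyGrad (ha : 0 < a) (hb : 0 ≤ b) (hθ : 1 < θ) {K : ℝ}
    (hK : ∀ u, ‖u‖ ≤ K * ‖A u‖) {M : ℝ} {u : ℕ → E} (hu : ∀ n, ‖u n‖ ≤ M) {y : E}
    (hy : Tendsto (fun n => energyGrad A a b θ (u n)) atTop (𝓝 y)) :
    ∃ u', ∃ ns : ℕ → ℕ, StrictMono ns ∧ Tendsto (fun n => u (ns n)) atTop (𝓝 u') := by
  set R := (‖A‖ * M) ^ 2 with hR
  -- Along a subsequence ‖Au_n‖² converges, so the scalar coefficient tends to m ≥ a > 0 and can be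
  -- divided out, leaving convergence of A*Au_n.
  have hq : ∀ n, ‖A (u n)‖ ^ 2 ∈ Set.Icc 0 R := fun n =>
    ⟨by positivity, pow_le_pow_left₀ (norm_nonneg _) ((A.le_opNorm _).trans (by gcongr; exact hu n)) 2⟩
  obtain ⟨q, hq0, ns, hns, hlim⟩ := isCompact_Icc.tendsto_subseq hq
  set m : ℝ := a + b * q ^ (θ - 1) with hm
  have hm0 : 0 < m := by have := hq0.1; positivity
  have hml : Tendsto (fun n => a + b * (‖A (u (ns n))‖ ^ 2) ^ (θ - 1)) atTop (𝓝 m) :=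
    ((hlim.rpow_const (Or.inr (by linarith))).const_mul b).const_add a
  have hB : Tendsto (fun n => ContinuousLinearMap.adjoint A (A (u (ns n)))) atTop (𝓝 (m⁻¹ • y)) := by
    refine ((hml.inv₀ hm0.ne').smul (hy.comp hns.tendsto_atTop)).congr fun n => ?_
    have : 0 < a + b * (‖A (u (ns n))‖ ^ 2) ^ (θ - 1) := by positivity
    simp only [Function.comp_apply, energyGrad]
    rw [smul_smul, inv_mul_cancel₀ this.ne', one_smul]
  -- Coercivity: ‖w‖² ≤ K²‖Aw‖² = K²⟨A*Aw, w⟩, so A*A has a Lipschitz inverse on its range.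
  have hanti : ∀ x z : E, ‖x - z‖ ≤ K ^ 2 *
      ‖ContinuousLinearMap.adjoint A (A x) - ContinuousLinearMap.adjoint A (A z)‖ := by
    intro x z
    rw [← map_sub, ← map_sub]
    generalize x - z = w
    rcases eq_or_ne w 0 with rfl | hw
    · simp
    have h1 : ‖A w‖ ^ 2 ≤ ‖ContinuousLinearMap.adjoint A (A w)‖ * ‖w‖ := by
      rw [← real_inner_self_eq_norm_sq, ← ContinuousLinearMap.adjoint_inner_left]
      exact real_inner_le_norm _ _
    have h2 : ‖w‖ ^ 2 ≤ K ^ 2 * ‖A w‖ ^ 2 := by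
      rw [← mul_pow]; exact pow_le_pow_left₀ (norm_nonneg _) (hK w) 2
    have hw0 : 0 < ‖w‖ := norm_pos_iff.2 hw
    refine le_of_mul_le_mul_right ?_ hw0
    calc ‖w‖ * ‖w‖ = ‖w‖ ^ 2 := by ring
      _ ≤ K ^ 2 * (‖ContinuousLinearMap.adjoint A (A w)‖ * ‖w‖) := h2.trans (by gcongr)
      _ = _ := by ring
  have hcau : CauchySeq fun n => u (ns n) := by
    refine Metric.cauchySeq_iff.2 fun ε hε => ?_
    obtain ⟨n₀, hn₀⟩ := Metric.cauchySeq_iff.1 hB.cauchySeq (ε / (K ^ 2 + 1)) (by positivity)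
    refine ⟨n₀, fun i hi j hj => ?_⟩
    have h1 := hn₀ i hi j hj
    rw [lt_div_iff₀ (by positivity), dist_eq_norm] at h1
    rw [dist_eq_norm]
    refine (hanti _ _).trans_lt (lt_of_le_of_lt ?_ h1)
    rw [mul_comm]
    gcongr
    linarith
  obtain ⟨u', hu'⟩ := cauchySeq_tendsto_of_complete hcau
  exact ⟨u', ns, hns, hu'⟩

end

theorem le_of_sq_le_mul_add {x B D : ℝ} (hB : 0 ≤ B) (hD : 0 ≤ D) (hx : 0 ≤ x)
    (h : x ^ 2 ≤ B * (D + x)) : x ≤ B + D + 1 := by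
  by_contra! hlt
  nlinarith [mul_nonneg hB hD]

set_option maxHeartbeats 800000 in
/-- Existence of a critical point of mountain pass type for a functional
`energy u + energy v - P (u, v)` with a compact superquadratic perturbation `P`. -/
theorem exists_kirchhoff_critical_point {A : E →L[ℝ] F} {T : WithLp 2 (E × E) →L[ℝ] F}
    {a₁ a₂ b₁ b₂ θ₁ θ₂ μ K : ℝ} (ha₁ : 0 < a₁) (ha₂ : 0 < a₂) (hb₁ : 0 ≤ b₁) (hb₂ : 0 ≤ b₂)
    (hθ₁ : 1 < θ₁) (hθ₂ : 1 < θ₂) (hμ₁ : 2 * θ₁ ≤ μ) (hμ₂ : 2 * θ₂ ≤ μ)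
    (hK : ∀ u, ‖u‖ ≤ K * ‖A u‖) {P : WithLp 2 (E × E) → ℝ} {N : WithLp 2 (E × E) → F}
    (hP : ∀ W Z, HasDerivAt (fun s : ℝ => P (W + s • Z)) (inner ℝ (N W) (T Z)) 0)
    (hN : Continuous N)
    (hcpt : ∀ (W : ℕ → WithLp 2 (E × E)) (M : ℝ), (∀ n, ‖W n‖ ≤ M) →
      ∃ y, ∃ ns : ℕ → ℕ, StrictMono ns ∧ Tendsto (fun n => N (W (ns n))) atTop (𝓝 y))
    {C : ℝ} (hAR : ∀ W, μ * P W ≤ inner ℝ (N W) (T W) + C) (hP0 : P 0 = 0)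
    (hsmall : ∀ ε > 0, ∃ ρ > 0, ∀ W : WithLp 2 (E × E), ‖A W.fst‖ ^ 2 + ‖A W.snd‖ ^ 2 = ρ ^ 2 →
      P W ≤ ε * ρ ^ 2)
    (hlarge : ∀ ρ : ℝ, ∃ W : WithLp 2 (E × E), ρ ≤ ‖A W.fst‖ ^ 2 + ‖A W.snd‖ ^ 2 ∧
      energy A a₁ b₁ θ₁ W.fst + energy A a₂ b₂ θ₂ W.snd ≤ P W) :
    ∃ W : WithLp 2 (E × E),
      P W < energy A a₁ b₁ θ₁ W.fst + energy A a₂ b₂ θ₂ W.snd ∧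
      ∀ Z : WithLp 2 (E × E), inner ℝ (energyGrad A a₁ b₁ θ₁ W.fst) Z.fst +
        inner ℝ (energyGrad A a₂ b₂ θ₂ W.snd) Z.snd = inner ℝ (N W) (T Z) := by
  set J : WithLp 2 (E × E) → ℝ := fun W =>
    energy A a₁ b₁ θ₁ W.fst + energy A a₂ b₂ θ₂ W.snd - P W with hJ
  set D : WithLp 2 (E × E) → WithLp 2 (E × E) := fun W =>
    WithLp.toLp 2 (energyGrad A a₁ b₁ θ₁ W.fst, energyGrad A a₂ b₂ θ₂ W.snd) with hD
  set G : WithLp 2 (E × E) → WithLp 2 (E × E) := fun W =>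
    D W - ContinuousLinearMap.adjoint T (N W) with hG
  have hfst : Continuous fun W : WithLp 2 (E × E) => W.fst := (WithLp.prod_continuous_ofLp 2 E E).fst
  have hsnd : Continuous fun W : WithLp 2 (E × E) => W.snd := (WithLp.prod_continuous_ofLp 2 E E).snd
  have hDc : Continuous D := (WithLp.prod_continuous_toLp 2 E E).comp
    (((continuous_energyGrad hθ₁).comp hfst).prodMk ((continuous_energyGrad hθ₂).comp hsnd))
  have hGc : Continuous G := hDc.sub ((ContinuousLinearMap.adjoint T).continuous.comp hN)
  have hGi : ∀ W Z, inner ℝ (G W) Z = inner ℝ (energyGrad A a₁ b₁ θ₁ W.fst) Z.fst +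
      inner ℝ (energyGrad A a₂ b₂ θ₂ W.snd) Z.snd - inner ℝ (N W) (T Z) := by
    intro W Z
    rw [hG, inner_sub_left, ContinuousLinearMap.adjoint_inner_left, WithLp.prod_inner_apply]
    rfl
  have hJG : ∀ W Z, HasDerivAt (fun s : ℝ => J (W + s • Z)) (inner ℝ (G W) Z) 0 := by
    intro W Z
    rw [hGi]
    exact ((hasDerivAt_energy hθ₁ W.fst Z.fst).add (hasDerivAt_energy hθ₂ W.snd Z.snd)).sub (hP W Z)
  have hstrict := hasStrictFDerivAt_of_hasDerivAt_line hGc hJG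
  have hJc : Continuous J := continuous_iff_continuousAt.2 fun x => (hstrict x).continuousAt
  set Q : WithLp 2 (E × E) → ℝ := fun W => ‖A W.fst‖ ^ 2 + ‖A W.snd‖ ^ 2 with hQ
  have hQc : Continuous Q :=
    ((A.continuous.comp hfst).norm.pow 2).add ((A.continuous.comp hsnd).norm.pow 2)
  set a : ℝ := min a₁ a₂ with ha
  have ha0 : 0 < a := lt_min ha₁ ha₂
  have hQn : ∀ W, ‖W‖ ^ 2 ≤ K ^ 2 * Q W := by
    intro W
    rw [WithLp.prod_norm_sq_eq_of_L2, hQ, mul_add, ← mul_pow, ← mul_pow]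
    exact add_le_add (pow_le_pow_left₀ (norm_nonneg _) (hK _) 2)
      (pow_le_pow_left₀ (norm_nonneg _) (hK _) 2)
  have hJ0 : J 0 = 0 := by
    simp only [hJ, energy, hP0, WithLp.zero_fst, WithLp.zero_snd, map_zero, norm_zero]
    rw [zero_pow two_ne_zero, Real.zero_rpow (by linarith), Real.zero_rpow (by linarith)]
    simp
  have henergy : ∀ W, a / 2 * Q W ≤
      energy A a₁ b₁ θ₁ W.fst + energy A a₂ b₂ θ₂ W.snd := by
    intro W
    have h1 : a / 2 * ‖A W.fst‖ ^ 2 ≤ energy A a₁ b₁ θ₁ W.fst := by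
      have h2 : 0 ≤ b₁ / (2 * θ₁) * (‖A W.fst‖ ^ 2) ^ θ₁ := by positivity
      have h3 : a / 2 * ‖A W.fst‖ ^ 2 ≤ a₁ / 2 * ‖A W.fst‖ ^ 2 := by
        gcongr; exact min_le_left _ _
      rw [energy]; linarith
    have h1' : a / 2 * ‖A W.snd‖ ^ 2 ≤ energy A a₂ b₂ θ₂ W.snd := by
      have h2 : 0 ≤ b₂ / (2 * θ₂) * (‖A W.snd‖ ^ 2) ^ θ₂ := by positivity
      have h3 : a / 2 * ‖A W.snd‖ ^ 2 ≤ a₂ / 2 * ‖A W.snd‖ ^ 2 := by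
        gcongr; exact min_le_right _ _
      rw [energy]; linarith
    rw [hQ, mul_add]
    exact add_le_add h1 h1'
  -- Half of the lower bound (a/2)Q for the energy is spent on P, leaving J ≥ (a/4)ρ² on {Q = ρ²}.
  obtain ⟨ρ, hρ, hPρ⟩ := hsmall (a / 4) (by positivity)
  obtain ⟨q, hq1, hq2⟩ := hlarge (ρ ^ 2)
  obtain ⟨c, hc, w, hw1, hw2⟩ := exists_palaisSmale_sequence hstrict hGc (p := 0) (q := q)
    (α := a / 4 * ρ ^ 2) (by rw [hJ0]; positivity)
    (lt_of_le_of_lt (show J q ≤ 0 by simp only [hJ]; linarith) (by positivity)) (by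
      intro γ h0 h1
      -- The sphere is a level set of Q, which every path from 0 to q crosses.
      have hi := intermediate_value_univ (0 : unitInterval) 1 (hQc.comp γ.continuous)
      obtain ⟨t, ht⟩ := hi (show ρ ^ 2 ∈ Set.Icc _ _ from ⟨by
        simp only [Function.comp_apply, h0, hQ, WithLp.zero_fst, WithLp.zero_snd, map_zero,
          norm_zero]
        rw [zero_pow two_ne_zero, add_zero]
        positivity, by simpa only [Function.comp_apply, h1] using hq1⟩)
      refine ⟨t, ?_⟩
      have h2 := hPρ (γ t) ht
      have h3 := henergy (γ t)
      rw [show Q (γ t) = ρ ^ 2 from ht] at h3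
      simp only [hJ]
      linarith)
  have hc0 : 0 < c := lt_of_lt_of_le (by positivity) hc
  have hμ0 : 1 < μ / 2 := by linarith
  set B : ℝ := K ^ 2 / ((μ / 2 - 1) * a) with hB
  have hB0 : 0 ≤ B := div_nonneg (sq_nonneg K) (mul_pos (by linarith) ha0).le
  set D' : ℝ := μ * (c + 1) + |C| with hD'
  have hD0 : 0 ≤ D' := by
    have : 0 ≤ μ := by linarith
    positivity
  have hbdd : ∀ᶠ n in atTop, ‖w n‖ ≤ B + D' + 1 := by
    filter_upwards [hw1.eventually_le_const (lt_add_one c),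
      hw2.norm.eventually_le_const (by rw [norm_zero]; exact one_pos)] with n h1 h2
    have e1 := mul_energy_sub_inner_energyGrad (A := A) (a := a₁) hb₁ hθ₁ hμ₁ (w n).fst
    have e2 := mul_energy_sub_inner_energyGrad (A := A) (a := a₂) hb₂ hθ₂ hμ₂ (w n).snd
    have e3 := hAR (w n)
    have e4 := hGi (w n) (w n)
    have e5 : -‖w n‖ ≤ inner ℝ (G (w n)) (w n) := by
      have := abs_real_inner_le_norm (G (w n)) (w n)
      have h3 : ‖G (w n)‖ * ‖w n‖ ≤ 1 * ‖w n‖ := by gcongr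
      linarith [neg_abs_le (inner ℝ (G (w n)) (w n) : ℝ)]
    have e6 : μ * J (w n) ≤ μ * (c + 1) := mul_le_mul_of_nonneg_left h1 (by linarith)
    have e7 : (μ / 2 - 1) * (a * Q (w n)) ≤ (μ / 2 - 1) * (a₁ * ‖A (w n).fst‖ ^ 2) +
        (μ / 2 - 1) * (a₂ * ‖A (w n).snd‖ ^ 2) := by
      rw [← mul_add]
      refine mul_le_mul_of_nonneg_left ?_ (by linarith)
      rw [hQ, mul_add]
      gcongr
      · exact min_le_left _ _
      · exact min_le_right _ _
    have e8 : (μ / 2 - 1) * a * Q (w n) ≤ D' + ‖w n‖ := by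
      have := le_abs_self C
      simp only [hJ] at e6
      rw [hD']
      linarith
    have e9 : ‖w n‖ ^ 2 ≤ B * (D' + ‖w n‖) := by
      have hpos : 0 < (μ / 2 - 1) * a := mul_pos (by linarith) ha0
      calc ‖w n‖ ^ 2 ≤ K ^ 2 * Q (w n) := hQn _
        _ = B * ((μ / 2 - 1) * a * Q (w n)) := by
          rw [hB, ← mul_assoc, div_mul_cancel₀ _ hpos.ne']
        _ ≤ _ := by gcongr
    exact le_of_sq_le_mul_add hB0 hD0 (norm_nonneg _) e9
  obtain ⟨n₀, hn₀⟩ := eventually_atTop.1 hbdd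
  obtain ⟨y, ns, hns, hy⟩ := hcpt (fun n => w (n + n₀)) (B + D' + 1)
    (fun n => hn₀ _ (Nat.le_add_left _ _))
  have hsub : Tendsto (fun n => ns n + n₀) atTop atTop :=
    (tendsto_add_atTop_nat n₀).comp hns.tendsto_atTop
  -- D = G + T*N: the gradients tend to 0 and N converges by compactness, so both Kirchhoff
  -- operators converge along the sequence.
  have hDl : Tendsto (fun n => D (w (ns n + n₀))) atTop (𝓝 (ContinuousLinearMap.adjoint T y)) := by
    have := (hw2.comp hsub).add (((ContinuousLinearMap.adjoint T).continuous.tendsto y).comp hy)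
    rw [zero_add] at this
    refine this.congr fun n => ?_
    simp only [hG, Function.comp_apply, sub_add_cancel]
  obtain ⟨u, ms, hms, hu⟩ := exists_tendsto_of_tendsto_energyGrad ha₁ hb₁ hθ₁ hK
    (u := fun n => (w (ns n + n₀)).fst) (M := B + D' + 1)
    (fun n => (WithLp.norm_fst_le _ _).trans (hn₀ _ (Nat.le_add_left _ _)))
    ((hfst.tendsto _).comp hDl)
  obtain ⟨v, ls, hls, hv⟩ := exists_tendsto_of_tendsto_energyGrad ha₂ hb₂ hθ₂ hK
    (u := fun n => (w (ns (ms n) + n₀)).snd) (M := B + D' + 1)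
    (fun n => (WithLp.norm_snd_le _ _).trans (hn₀ _ (Nat.le_add_left _ _)))
    ((hsnd.tendsto _).comp (hDl.comp hms.tendsto_atTop))
  set W : WithLp 2 (E × E) := WithLp.toLp 2 (u, v) with hW
  have hks : Tendsto (fun n => ns (ms (ls n)) + n₀) atTop atTop :=
    hsub.comp (hms.tendsto_atTop.comp hls.tendsto_atTop)
  have hlim : Tendsto (fun n => w (ns (ms (ls n)) + n₀)) atTop (𝓝 W) :=
    ((WithLp.prod_continuous_toLp 2 E E).tendsto (u, v)).comp
      ((hu.comp hls.tendsto_atTop).prodMk_nhds hv)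
  have hJW : J W = c := tendsto_nhds_unique ((hJc.tendsto W).comp hlim) (hw1.comp hks)
  have hGW : G W = 0 := tendsto_nhds_unique ((hGc.tendsto W).comp hlim) (hw2.comp hks)
  refine ⟨W, ?_, fun Z => ?_⟩
  · have : 0 < J W := hJW ▸ hc0
    simp only [hJ] at this
    linarith
  · have := hGi W Z
    rw [hGW, inner_zero_left] at this
    linarith

end

/-! ### Pointwise consequences of the conditions on H -/

section

variable {Ω : Set Plane} {H : Plane → Plane → ℝ}

theorem inner_gradW_eq (x V W : Plane) :
    inner ℝ V (gradW H x W) = V 0 * Hu H x W + V 1 * Hv H x W := by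
  rw [PiLp.inner_apply, Fin.sum_univ_two]
  simp [Hu, Hv, mul_comm]

theorem inner_gradW_self_nonneg (hH1 : CondH1 Ω H) {x : Plane} (hx : x ∈ Ω) (W : Plane) :
    0 ≤ inner ℝ W (gradW H x W) := by
  rw [inner_gradW_eq]
  exact add_nonneg (hH1 x hx W).2.1 (hH1 x hx W).2.2

/-- The Ambrosetti–Rabinowitz inequality up to a constant. -/
theorem exists_mul_le_inner_gradW_add (hreg : Regular Ω H) (hH1 : CondH1 Ω H)
    (h0 : ∀ x ∈ Ω, H x 0 = 0) {μ R : ℝ} (hμ : 0 ≤ μ)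
    (hAR : ∀ x ∈ Ω, ∀ W : Plane, R ≤ ‖W‖ → μ * H x W ≤ inner ℝ W (gradW H x W)) :
    ∃ C : ℝ, 0 ≤ C ∧ ∀ x ∈ Ω, ∀ W : Plane, μ * H x W ≤ inner ℝ W (gradW H x W) + C := by
  obtain ⟨B, hB⟩ := hreg.bdd_gradW |R|
  refine ⟨μ * (|B| * |R|), by positivity, fun x hx W => ?_⟩
  have hin := inner_gradW_self_nonneg hH1 hx W
  rcases le_or_gt R ‖W‖ with hW | hW
  · have := hAR x hx W hW
    have h2 : 0 ≤ μ * (|B| * |R|) := by positivity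
    linarith
  -- On the ball the scalar product is nonnegative by (H₁), and H is bounded by the mean value
  -- inequality from H(x,0) = 0.
  · have hW' : ‖W‖ ≤ |R| := hW.le.trans (le_abs_self R)
    have h1 := le_of_forall_norm_gradW_le hreg hx (h0 x hx) (W := W) (C := |B|)
      fun V hV => (hB x hx V (hV.trans hW')).trans (le_abs_self B)
    have h2 : H x W ≤ |B| * |R| := (le_abs_self _).trans (h1.trans (by gcongr))
    have h3 := mul_le_mul_of_nonneg_left h2 hμ
    linarith

/-- (SL) handles |W| < δ; for |W| ≥ δ the growth bound is multiplied by (|W|/δ)² ≥ 1. A power above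
2 makes this second part o(ρ²) on small spheres. -/
theorem exists_le_sq_add_cube_mul_exp (hA : Admissible Ω H) (hSL : CondSL Ω H) {ε : ℝ}
    (hε : 0 < ε) : ∃ C : ℝ, 0 < C ∧ ∀ x ∈ Ω, ∀ W : Plane,
      H x W ≤ ε * ‖W‖ ^ 2 + C * (‖W‖ ^ 3 * Real.exp (‖W‖ ^ 2)) := by
  obtain ⟨δ, hδ, hball⟩ := Metric.mem_nhdsWithin_iff.1 (hSL ε hε)
  obtain ⟨B, hB0, hB⟩ := exists_norm_gradW_le_exp hA.regular hA.growth_u hA.growth_v one_pos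
  refine ⟨B / δ ^ 2, by positivity, fun x hx W => ?_⟩
  rcases eq_or_ne W 0 with rfl | hW0
  · simp [hA.zero x hx]
  have hWn : 0 < ‖W‖ := norm_pos_iff.2 hW0
  rcases lt_or_ge ‖W‖ δ with hW | hW
  · have h1 := hball ⟨mem_ball_zero_iff.2 hW, hW0⟩ x hx
    rw [div_lt_iff₀ (by positivity)] at h1
    have h2 : 0 ≤ B / δ ^ 2 * (‖W‖ ^ 3 * Real.exp (‖W‖ ^ 2)) := by positivity
    linarith
  · have h1 := norm_le_exp_of_norm_gradW_le_exp hA.regular hx (hA.zero x hx) hB0.le zero_le_one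
      (hB x hx) W
    rw [one_mul] at h1
    have h2 : B * Real.exp (‖W‖ ^ 2) * ‖W‖ ≤ B / δ ^ 2 * (‖W‖ ^ 3 * Real.exp (‖W‖ ^ 2)) := by
      have h3 : δ ^ 2 ≤ ‖W‖ ^ 2 := by gcongr
      rw [div_mul_eq_mul_div, le_div_iff₀ (by positivity)]
      calc _ = B * Real.exp (‖W‖ ^ 2) * ‖W‖ * δ ^ 2 := by ring
        _ ≤ B * Real.exp (‖W‖ ^ 2) * ‖W‖ * ‖W‖ ^ 2 := by gcongr
        _ = _ := by ring
    have h3 : 0 ≤ ε * ‖W‖ ^ 2 := by positivity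
    linarith [le_abs_self (H x W), Real.norm_eq_abs (H x W)]

theorem cube_le_mul_exp (t : ℝ) : t ^ 3 ≤ 8 * Real.exp (t ^ 2 / 2) := by
  have h1 := Real.quadratic_le_exp_of_nonneg (show 0 ≤ t ^ 2 / 2 by positivity)
  nlinarith [sq_nonneg (t ^ 2 - t), sq_nonneg t]

/-- Put t = (ρ/√c)τ: the powers of t give the powers of ρ/√c, and ρ² ≤ c/2 makes exp(t²) ≤
exp(τ²/2), leaving the other half of the exponent to absorb τ³. -/
theorem sq_add_cube_mul_exp_le {c ρ ε C t : ℝ} (hc : 0 < c) (hρ : 0 < ρ) (hρc : ρ ^ 2 ≤ c / 2)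
    (hε : 0 ≤ ε) (hC : 0 ≤ C) :
    ε * t ^ 2 + C * (t ^ 3 * Real.exp (t ^ 2)) ≤
      (ε * (ρ ^ 2 / c) + C * (8 * (ρ / √c) ^ 3)) * Real.exp (c / ρ ^ 2 * t ^ 2) := by
  rw [add_mul, mul_assoc, mul_assoc C]
  have hsc : √c ^ 2 = c := Real.sq_sqrt hc.le
  have hsc0 : 0 < √c := Real.sqrt_pos.2 hc
  gcongr ε * ?_ + C * ?_
  · calc t ^ 2 = ρ ^ 2 / c * (c / ρ ^ 2 * t ^ 2) := by field_simp
      _ ≤ _ := by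
        gcongr
        linarith [Real.add_one_le_exp (c / ρ ^ 2 * t ^ 2)]
  · have h1 := cube_le_mul_exp (√c / ρ * t)
    have h2 : (√c / ρ * t) ^ 2 / 2 = c / ρ ^ 2 * t ^ 2 / 2 := by rw [mul_pow, div_pow, hsc]
    rw [h2] at h1
    have h3 : t ^ 2 ≤ c / ρ ^ 2 * t ^ 2 / 2 := by
      have : 2 ≤ c / ρ ^ 2 := by rw [le_div_iff₀ (by positivity)]; linarith
      nlinarith [sq_nonneg t]
    calc t ^ 3 * Real.exp (t ^ 2) = (ρ / √c) ^ 3 * (√c / ρ * t) ^ 3 * Real.exp (t ^ 2) := by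
          congr 1; field_simp
      _ ≤ (ρ / √c) ^ 3 * (8 * Real.exp (c / ρ ^ 2 * t ^ 2 / 2)) *
          Real.exp (c / ρ ^ 2 * t ^ 2 / 2) := by gcongr
      _ = 8 * (ρ / √c) ^ 3 * (Real.exp (c / ρ ^ 2 * t ^ 2 / 2) *
          Real.exp (c / ρ ^ 2 * t ^ 2 / 2)) := by ring
      _ = _ := by rw [← Real.exp_add, add_halves]

theorem eq_zero_of_forall_mul_self_nonneg {f : ℝ → ℝ} (hf : Continuous f) (h : ∀ t, 0 ≤ t * f t) :
    f 0 = 0 := by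
  refine le_antisymm ?_ ?_
  · have h1 : Tendsto f (𝓝[<] 0) (𝓝 (f 0)) := (hf.tendsto 0).mono_left nhdsWithin_le_nhds
    refine le_of_tendsto h1 (eventually_mem_nhdsWithin.mono fun t ht => ?_)
    exact nonpos_of_mul_nonneg_right (h t) ht
  · have h1 : Tendsto f (𝓝[>] 0) (𝓝 (f 0)) := (hf.tendsto 0).mono_left nhdsWithin_le_nhds
    refine ge_of_tendsto h1 (eventually_mem_nhdsWithin.mono fun t ht => ?_)
    exact nonneg_of_mul_nonneg_right (h t) ht

theorem continuous_gradW (hreg : Regular Ω H) {x : Plane} (hx : x ∈ Ω) :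
    Continuous (gradW H x) := by
  have h1 : ContinuousOn (fun W => gradW H x W) Set.univ :=
    hreg.cont_gradW.comp (f := fun W : Plane => (x, W)) (by fun_prop) fun W _ => ⟨hx, trivial⟩
  exact continuousOn_univ.1 h1

/-- v H_v ≥ 0 makes H_v change sign across v = 0, so it vanishes there. Hence ∇H is parallel to the
axis, and (H₂) becomes a differential inequality in one variable. -/
theorem Hv_axis_eq_zero (hreg : Regular Ω H) (hH1 : CondH1 Ω H) {x : Plane} (hx : x ∈ Ω) (s : ℝ) :
    Hv H x !₂[s, 0] = 0 := by
  refine eq_zero_of_forall_mul_self_nonneg (f := fun t => Hv H x !₂[s, t]) ?_ fun t => ?_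
  · have h1 : Continuous fun t : ℝ => (!₂[s, t] : Plane) := by fun_prop
    exact (EuclideanSpace.proj (𝕜 := ℝ) (1 : Fin 2)).continuous.comp
      ((continuous_gradW hreg hx).comp h1)
  · simpa using (hH1 x hx !₂[s, t]).2.2

theorem norm_axis {s : ℝ} (hs : 0 ≤ s) : ‖(!₂[s, 0] : Plane)‖ = s := by
  have := norm_vec_sq s 0
  rw [zero_pow two_ne_zero, add_zero] at this
  exact (sq_eq_sq₀ (norm_nonneg _) hs).1 this

/-- Along the axis `v = 0` the condition `(H₂)` forces exponential growth. -/
theorem exp_mul_le_axis (hreg : Regular Ω H) (hH1 : CondH1 Ω H) {S M : ℝ} (hS : 0 < S) (hM : 0 < M)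
    {x : Plane} (hx : x ∈ Ω) (hH2 : ∀ W : Plane, S ≤ ‖W‖ → H x W ≤ M * ‖gradW H x W‖)
    {s : ℝ} (hs : S ≤ s) :
    Real.exp ((s - S) / M) * H x !₂[S, 0] ≤ H x !₂[s, 0] := by
  have hd : ∀ t : ℝ, HasDerivAt (fun t : ℝ => H x !₂[t, 0]) (Hu H x !₂[t, 0]) t := by
    intro t
    have h1 : HasDerivAt (fun t : ℝ => (!₂[t, 0] : Plane)) !₂[1, 0] t := by
      have h2 := (hasDerivAt_id t).smul_const (!₂[1, 0] : Plane)
      rw [one_smul] at h2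
      refine h2.congr_of_eventuallyEq (Eventually.of_forall fun r => ?_)
      ext i
      fin_cases i <;> simp
    have h3 := (hreg.hasGradientAt hx (!₂[t, 0] : Plane)).hasFDerivAt.comp_hasDerivAt t h1
    refine h3.congr_deriv ?_
    rw [InnerProductSpace.toDual_apply_apply, real_inner_comm, inner_gradW_eq]
    simp
  have hHu : ∀ t : ℝ, S ≤ t → H x !₂[t, 0] ≤ M * Hu H x !₂[t, 0] := by
    intro t ht
    have ht0 : 0 < t := hS.trans_le ht
    have h1 := hH2 !₂[t, 0] (by rwa [norm_axis ht0.le])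
    have h2 : 0 ≤ Hu H x !₂[t, 0] := by
      have := (hH1 x hx !₂[t, 0]).2.1
      exact nonneg_of_mul_nonneg_right (by simpa using this) ht0
    have h3 := norm_le_abs_add_abs (gradW H x !₂[t, 0])
    have h4 : |gradW H x !₂[t, 0] 1| = 0 := by
      rw [abs_eq_zero]; exact Hv_axis_eq_zero hreg hH1 hx t
    have h5 : |gradW H x !₂[t, 0] 0| = Hu H x !₂[t, 0] := abs_of_nonneg h2
    rw [h4, h5, add_zero] at h3
    exact h1.trans (by gcongr)
  have hdg : ∀ t : ℝ, HasDerivAt (fun t : ℝ => H x !₂[t, 0] * Real.exp (-(t / M)))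
      (Hu H x !₂[t, 0] * Real.exp (-(t / M)) +
        H x !₂[t, 0] * (Real.exp (-(t / M)) * -(1 / M))) t := by
    intro t
    exact (hd t).mul (((hasDerivAt_id t).div_const M).neg.exp)
  -- Integrating factor for H ≤ M H_u: the function H·exp(-t/M) is nondecreasing on t ≥ S.
  have hmono : MonotoneOn (fun t : ℝ => H x !₂[t, 0] * Real.exp (-(t / M))) (Set.Ici S) := by
    refine monotoneOn_of_deriv_nonneg (convex_Ici S)
      (fun t _ => (hdg t).continuousAt.continuousWithinAt)
      (fun t _ => (hdg t).differentiableAt.differentiableWithinAt) fun t ht => ?_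
    rw [interior_Ici] at ht
    rw [(hdg t).deriv]
    have h1 := hHu t (le_of_lt ht)
    have h2 : Hu H x !₂[t, 0] * Real.exp (-(t / M)) +
        H x !₂[t, 0] * (Real.exp (-(t / M)) * -(1 / M)) =
        Real.exp (-(t / M)) / M * (M * Hu H x !₂[t, 0] - H x !₂[t, 0]) := by
      field_simp
      ring
    rw [h2]
    exact mul_nonneg (by positivity) (by linarith)
  have h := hmono (Set.mem_Ici.2 le_rfl) (Set.mem_Ici.2 hs) hs
  have e : Real.exp ((s - S) / M) = Real.exp (-(S / M)) / Real.exp (-(s / M)) := by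
    rw [← Real.exp_sub]; congr 1; ring
  rw [e, div_mul_eq_mul_div, div_le_iff₀ (Real.exp_pos _), mul_comm (Real.exp _)]
  exact h

/-- The element of `H^1_0(Ω)` given by a test function. -/
theorem IsTestFunction.exists_H10 {φ : Plane → ℝ} (hφ : IsTestFunction Ω φ) :
    ∃ w : H10 Ω, w.fn =ᵐ[volume.restrict Ω] φ := by
  have m1 : MemLp φ 2 (volume.restrict Ω) :=
    (hφ.smooth.continuous.memLp_of_hasCompactSupport hφ.compact).restrict Ω
  have hg : gradient φ = fun x => (InnerProductSpace.toDual ℝ Plane).symm (fderiv ℝ φ x) := rfl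
  have c2 : Continuous (gradient φ) := by
    rw [hg]
    exact (LinearIsometryEquiv.continuous _).comp (hφ.smooth.continuous_fderiv (by simp))
  have s2 : HasCompactSupport (gradient φ) := by
    rw [hg]
    exact (hφ.compact.fderiv (𝕜 := ℝ)).comp_left (map_zero _)
  have m2 : MemLp (gradient φ) 2 (volume.restrict Ω) :=
    (c2.memLp_of_hasCompactSupport s2).restrict Ω
  have hmem : WithLp.toLp 2 (m1.toLp φ, m2.toLp (gradient φ)) ∈ testPairs Ω :=
    ⟨φ, hφ, m1.coeFn_toLp, m2.coeFn_toLp⟩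
  exact ⟨⟨_, Submodule.le_topologicalClosure _ hmem⟩, m1.coeFn_toLp⟩

/-- On a ray the energy is a combination of t² and t^{2θ}, each negligible against exp(δt). -/
theorem eventually_energy_smul_le {E F : Type*} [NormedAddCommGroup E] [InnerProductSpace ℝ E]
    [NormedAddCommGroup F] [InnerProductSpace ℝ F]
    (A : E →L[ℝ] F) (a b θ : ℝ) {κ δ : ℝ} (hκ : 0 < κ) (hδ : 0 < δ) (w : E) :
    ∀ᶠ t : ℝ in atTop, energy A a b θ (t • w) ≤ κ * Real.exp (δ * t) := by
  set q := ‖A w‖ ^ 2 with hq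
  have hq0 : 0 ≤ q := by positivity
  have o1 := ((isLittleO_rpow_exp_pos_mul_atTop 2 hδ).const_mul_left (a / 2 * q)).bound
    (show 0 < κ / 2 by positivity)
  have o2 := ((isLittleO_rpow_exp_pos_mul_atTop (2 * θ) hδ).const_mul_left
    (b / (2 * θ) * q ^ θ)).bound (show 0 < κ / 2 by positivity)
  filter_upwards [o1, o2, eventually_ge_atTop 0] with t h1 h2 ht
  have e1 : ‖A (t • w)‖ ^ 2 = t ^ 2 * q := by
    rw [map_smul, norm_smul, mul_pow, Real.norm_eq_abs, sq_abs]
  have e2 : (t ^ 2 * q) ^ θ = q ^ θ * t ^ (2 * θ) := by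
    rw [Real.mul_rpow (by positivity) hq0, Real.rpow_mul ht, Real.rpow_two, mul_comm]
  rw [energy, e1, e2]
  rw [Real.norm_eq_abs, Real.norm_of_nonneg (Real.exp_pos _).le] at h1 h2
  rw [Real.rpow_two] at h1
  have h3 := (le_abs_self _).trans h1
  have h4 := (le_abs_self _).trans h2
  linarith

end

/-! ### Compactness and smallness of the potential term -/

section

variable {Ω : Set Plane} {H : Plane → Plane → ℝ}

theorem integrable_inner_of_memLp {α F : Type*} [MeasurableSpace α] {μ : Measure α}
    [NormedAddCommGroup F] [InnerProductSpace ℝ F] {f g : α → F} (hf : MemLp f 2 μ)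
    (hg : MemLp g 2 μ) : Integrable (fun x => inner ℝ (f x) (g x)) μ := by
  refine (L2.integrable_inner (hf.toLp f) (hg.toLp g)).congr ?_
  filter_upwards [hf.coeFn_toLp, hg.coeFn_toLp] with x h1 h2
  rw [h1, h2]

theorem H10.exists_norm_le_mul_norm_gradL (hΩ : volume Ω ≠ ⊤) :
    ∃ K : ℝ, 0 < K ∧ ∀ w : H10 Ω, ‖w‖ ≤ K * ‖gradL Ω w‖ := by
  obtain ⟨P, hP, h⟩ := exists_norm_fn_le_mul_dnorm hΩ
  refine ⟨P + 1, by positivity, fun w => ?_⟩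
  have h1 := norm_sq_eq w
  rw [gradL_apply, ← dnorm_eq_norm]
  have hd : 0 ≤ w.dnorm := Real.sqrt_nonneg _
  refine le_of_sq_le_sq ?_ (by positivity)
  have h2 : ‖w.fn‖ ^ 2 ≤ (P * w.dnorm) ^ 2 := by gcongr; exact h w
  nlinarith [mul_nonneg hP.le (mul_nonneg hd hd)]

namespace Admissible

set_option maxHeartbeats 1000000 in
-- Rellich's theorem in each component, then a.e. convergence along a further subsequence;
-- `exists_tendsto_superpose` does the rest.
theorem exists_subseq_tendsto_superpose (hA : Admissible Ω H) (W : ℕ → H10Sq Ω) (M : ℝ)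
    (hW : ∀ n, ‖W n‖ ≤ M) : ∃ y, ∃ ns : ℕ → ℕ, StrictMono ns ∧
      Tendsto (fun n => superpose Ω H (vecL Ω (W (ns n)))) atTop (𝓝 y) := by
  obtain ⟨f, n₁, hn₁, hf⟩ := H10.exists_subseq_tendsto_fn hA.isBounded hA.measurableSet
    (w := fun n => (W n).fst) (fun n => (WithLp.norm_fst_le _ _).trans (hW n))
  obtain ⟨g, n₂, hn₂, hg⟩ := H10.exists_subseq_tendsto_fn hA.isBounded hA.measurableSet
    (w := fun n => (W (n₁ n)).snd) (fun n => (WithLp.norm_snd_le _ _).trans (hW _))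
  obtain ⟨n₃, hn₃, hf'⟩ := (tendstoInMeasure_of_tendsto_Lp
    (hf.comp hn₂.tendsto_atTop)).exists_seq_tendsto_ae
  obtain ⟨n₄, hn₄, hg'⟩ := (tendstoInMeasure_of_tendsto_Lp
    (hg.comp hn₃.tendsto_atTop)).exists_seq_tendsto_ae
  set ns : ℕ → ℕ := fun n => n₁ (n₂ (n₃ (n₄ n))) with hns
  have hae : ∀ᵐ x ∂volume.restrict Ω,
      Tendsto (fun n => vecL Ω (W (ns n)) x) atTop (𝓝 !₂[f x, g x]) := by
    filter_upwards [hf', hg', ae_all_iff.2 fun n => coeFn_vecL (W (ns n))] with x h1 h2 h3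
    have h4 : Tendsto (fun n => ((W (ns n)).fst.fn x, (W (ns n)).snd.fn x)) atTop
        (𝓝 (f x, g x)) := (h1.comp hn₄.tendsto_atTop).prodMk_nhds h2
    have h5 : Continuous fun p : ℝ × ℝ => (!₂[p.1, p.2] : Plane) := by fun_prop
    exact ((h5.tendsto _).comp h4).congr fun n => (h3 n).symm
  obtain ⟨h, hlim⟩ := hA.exists_tendsto_superpose (W := fun n => W (ns n)) (fun n => hW _) hae
  exact ⟨_, ns, hn₁.comp (hn₂.comp (hn₃.comp hn₄)), hlim⟩

set_option maxHeartbeats 1000000 in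
theorem mul_potential_le (hA : Admissible Ω H) {μ C : ℝ}
    (h : ∀ x ∈ Ω, ∀ W : Plane, μ * H x W ≤ inner ℝ W (gradW H x W) + C) (W : H10Sq Ω) :
    μ * potential Ω H W ≤
      inner ℝ (superpose Ω H (vecL Ω W)) (vecL Ω W) + C * (volume Ω).toReal := by
  have := hA.isFiniteMeasure
  have hi : Integrable (fun x => inner ℝ (gradW H x (vecL Ω W x)) (vecL Ω W x))
      (volume.restrict Ω) := integrable_inner_of_memLp (hA.memLp_gradW W) (Lp.memLp _)
  have hC : C * (volume Ω).toReal = ∫ _ in Ω, C := by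
    rw [setIntegral_const, smul_eq_mul, mul_comm, measureReal_def]
  rw [hA.inner_superpose, potential, hC, ← integral_const_mul,
    ← integral_add hi (integrable_const C)]
  refine integral_mono_ae ((hA.integrable_comp W).const_mul μ) (hi.add (integrable_const C)) ?_
  filter_upwards [ae_restrict_mem hA.measurableSet] with x hx
  rw [real_inner_comm]
  exact h x hx _

set_option maxHeartbeats 1000000 in
-- Trudinger's inequality with M = ρ has the large exponent c/ρ² but a right-hand side V independent
-- of ρ. The square term then contributes (ε/2)ρ² and the cubic term O(ρ³).
theorem exists_potential_le_of_sum_sq_eq (hA : Admissible Ω H) (hSL : CondSL Ω H) {ε : ℝ}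
    (hε : 0 < ε) : ∃ ρ > 0, ∀ W : H10Sq Ω, ‖H10.gradL Ω W.fst‖ ^ 2 + ‖H10.gradL Ω W.snd‖ ^ 2 = ρ ^ 2 →
      potential Ω H W ≤ ε * ρ ^ 2 := by
  obtain ⟨c, hc, C₀, hexp⟩ := exists_lintegral_exp_vecL_le
  set V : ℝ := max C₀ 0 * (volume Ω).toReal + 1 with hV
  have hV0 : 0 < V := by positivity
  obtain ⟨C, hC0, hC⟩ := exists_le_sq_add_cube_mul_exp hA hSL
    (show 0 < ε * c / (2 * V) by positivity)
  have hsc0 : 0 < √c := Real.sqrt_pos.2 hc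
  -- The first bound gives ρ² ≤ c/2, the second makes the cubic term at most (ε/2)ρ².
  set ρ : ℝ := min (√(c / 2)) (ε * √c ^ 3 / (16 * C * V)) with hρ
  have hρ0 : 0 < ρ := lt_min (by positivity) (by positivity)
  have hρc : ρ ^ 2 ≤ c / 2 := by
    rw [← Real.sq_sqrt (show 0 ≤ c / 2 by positivity)]
    gcongr
    exact min_le_left _ _
  have hρC : 8 * C * V * ρ / √c ^ 3 ≤ ε / 2 := by
    have h1 : ρ ≤ ε * √c ^ 3 / (16 * C * V) := min_le_right _ _
    rw [le_div_iff₀ (by positivity)] at h1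
    rw [div_le_iff₀ (by positivity)]
    linarith
  refine ⟨ρ, hρ0, fun W hW => ?_⟩
  have hd : ∀ w : H10 Ω, ‖H10.gradL Ω w‖ ^ 2 ≤ ρ ^ 2 → w.dnorm ≤ ρ := fun w hw => by
    rw [H10.dnorm_eq_norm]
    exact le_of_sq_le_sq hw hρ0.le
  have hl := hexp Ω W ρ hρ0 (hd _ (by linarith [sq_nonneg ‖H10.gradL Ω W.snd‖]))
    (hd _ (by linarith [sq_nonneg ‖H10.gradL Ω W.fst‖]))
  set κ : ℝ := ε * c / (2 * V) * (ρ ^ 2 / c) + C * (8 * (ρ / √c) ^ 3) with hκ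
  have hκ0 : 0 ≤ κ := by positivity
  have hm : AEStronglyMeasurable (fun x => Real.exp (c / ρ ^ 2 * ‖vecL Ω W x‖ ^ 2))
      (volume.restrict Ω) :=
    (Real.measurable_exp.comp_aemeasurable
      (((Lp.aestronglyMeasurable _).aemeasurable.norm.pow_const 2).const_mul _)).aestronglyMeasurable
  have hVt := hA.volume_ne_top
  have hint : Integrable (fun x => Real.exp (c / ρ ^ 2 * ‖vecL Ω W x‖ ^ 2))
      (volume.restrict Ω) := by
    refine ⟨hm, ?_⟩
    rw [hasFiniteIntegral_iff_ofReal (Eventually.of_forall fun x => (Real.exp_pos _).le)]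
    exact hl.trans_lt (by finiteness)
  have hle : ∫ x in Ω, Real.exp (c / ρ ^ 2 * ‖vecL Ω W x‖ ^ 2) ≤ V := by
    rw [integral_eq_lintegral_of_nonneg_ae (Eventually.of_forall fun x => (Real.exp_pos _).le) hm]
    refine (ENNReal.toReal_mono (by finiteness) hl).trans ?_
    rw [ENNReal.toReal_mul, ENNReal.toReal_ofReal', hV]
    linarith
  calc potential Ω H W ≤ ∫ x in Ω, κ * Real.exp (c / ρ ^ 2 * ‖vecL Ω W x‖ ^ 2) := by
        refine integral_mono_ae (hA.integrable_comp W) (hint.const_mul κ) ?_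
        filter_upwards [ae_restrict_mem hA.measurableSet] with x hx
        exact (hC x hx _).trans (sq_add_cube_mul_exp_le hc hρ0 hρc (by positivity) hC0.le)
    _ = κ * ∫ x in Ω, Real.exp (c / ρ ^ 2 * ‖vecL Ω W x‖ ^ 2) := integral_const_mul _ _
    _ ≤ κ * V := by gcongr
    _ = (ε / 2 + 8 * C * V * ρ / √c ^ 3) * ρ ^ 2 := by
        rw [hκ]; field_simp
    _ ≤ (ε / 2 + ε / 2) * ρ ^ 2 := by gcongr
    _ = _ := by ring

end Admissible

end

/-! ### Descent along the axis and conclusion -/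

section

variable {Ω : Set Plane} {H : Plane → Plane → ℝ}

/-- There are elements of `H^1_0(Ω)` which equal `1` on a ball. -/
theorem H10.exists_eq_one_on_closedBall (hΩ : IsOpen Ω) (hne : Ω.Nonempty) :
    ∃ (x₀ : Plane) (r : ℝ), 0 < r ∧ Metric.closedBall x₀ r ⊆ Ω ∧ ∃ w : H10 Ω,
      ∀ᵐ x ∂volume.restrict Ω, x ∈ Metric.closedBall x₀ r → w.fn x = 1 := by
  obtain ⟨x₀, hx₀⟩ := hne
  obtain ⟨R, hR, hball⟩ := Metric.isOpen_iff.1 hΩ x₀ hx₀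
  let f : ContDiffBump x₀ := ⟨R / 4, R / 2, by positivity, by linarith⟩
  have hsub : Metric.closedBall x₀ (R / 2) ⊆ Ω :=
    (Metric.closedBall_subset_ball (by linarith)).trans hball
  obtain ⟨w, hw⟩ := IsTestFunction.exists_H10 (Ω := Ω) (φ := f)
    ⟨f.contDiff, f.hasCompactSupport, by rw [f.tsupport_eq]; exact hsub⟩
  refine ⟨x₀, R / 4, by positivity,
    (Metric.closedBall_subset_closedBall (by linarith)).trans hsub, w, ?_⟩
  filter_upwards [hw] with x hx hxB
  rw [hx]
  exact f.one_of_mem_closedBall hxB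

namespace Admissible

/-- Since H ≥ 0 the integral may be restricted to B, where W lies on the axis and H grows
exponentially. -/
theorem mul_exp_le_potential (hA : Admissible Ω H) (hH1 : CondH1 Ω H) {S M m : ℝ} (hS : 0 < S)
    (hM : 0 < M) (hH2 : ∀ x ∈ Ω, ∀ W : Plane, S ≤ ‖W‖ → H x W ≤ M * ‖gradW H x W‖)
    {B : Set Plane} (hBm : MeasurableSet B) (hB : B ⊆ Ω) (hm : ∀ x ∈ B, m ≤ H x !₂[S, 0]) {t : ℝ}
    (ht : S ≤ t) {W : H10Sq Ω}
    (hW : ∀ᵐ x ∂volume.restrict Ω, x ∈ B → vecL Ω W x = !₂[t, 0]) :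
    volume.real B * (Real.exp ((t - S) / M) * m) ≤ potential Ω H W := by
  have hBt : volume B ≠ ⊤ := measure_ne_top_of_subset hB hA.volume_ne_top
  have hi := hA.integrable_comp W
  have h0 : 0 ≤ᵐ[volume.restrict Ω] fun x => H x (vecL Ω W x) := by
    filter_upwards [ae_restrict_mem hA.measurableSet] with x hx
    exact (hH1 x hx _).1
  have hWB : ∀ᵐ x ∂volume.restrict B, vecL Ω W x = !₂[t, 0] := by
    filter_upwards [ae_restrict_of_ae_restrict_of_subset hB hW, ae_restrict_mem hBm] with x h1 h2
    exact h1 h2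
  calc _ = ∫ _ in B, Real.exp ((t - S) / M) * m := by rw [setIntegral_const, smul_eq_mul]
    _ ≤ ∫ x in B, H x (vecL Ω W x) := by
        refine integral_mono_ae (integrableOn_const hBt) (IntegrableOn.mono_set hi hB) ?_
        filter_upwards [hWB, ae_restrict_mem hBm] with x h1 h2
        refine le_trans ?_ (exp_mul_le_axis hA.regular hH1 hS hM (hB h2) (hH2 x (hB h2)) ht)|>.trans_eq
          (congrArg (H x) h1.symm)
        exact mul_le_mul_of_nonneg_left (hm x h2) (Real.exp_pos _).le
    _ ≤ _ := setIntegral_mono_set hi h0 (LE.le.eventuallyLE hB)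

set_option maxHeartbeats 2000000 in
-- The far point is (t w, 0) with w = 1 on a ball. Exponential growth from (H₂) matters: the power
-- growth of order μ from the Ambrosetti–Rabinowitz condition could merely tie with t^{2θ₁} when μ =
-- 2θ₁.
theorem exists_energy_le_potential (hA : Admissible Ω H) (hne : Ω.Nonempty) (hH1 : CondH1 Ω H)
    (hH2 : CondH2 Ω H) {lam : ℝ} (hlam : 0 < lam) (a₁ b₁ θ₁ a₂ b₂ : ℝ) {θ₂ : ℝ} (hθ₂ : 1 < θ₂)
    (ρ : ℝ) : ∃ W : H10Sq Ω, ρ ≤ ‖H10.gradL Ω W.fst‖ ^ 2 + ‖H10.gradL Ω W.snd‖ ^ 2 ∧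
      energy (H10.gradL Ω) a₁ b₁ θ₁ W.fst + energy (H10.gradL Ω) a₂ b₂ θ₂ W.snd ≤
        lam * potential Ω H W := by
  obtain ⟨S, hS, M, hM, hH2⟩ := hH2
  obtain ⟨x₀, r, hr, hBΩ, w, hw⟩ := H10.exists_eq_one_on_closedBall hA.isOpen hne
  set B := Metric.closedBall x₀ r with hB
  have hBm : MeasurableSet B := Metric.isClosed_closedBall.measurableSet
  have hBv : 0 < volume.real B := ENNReal.toReal_pos
    (Metric.measure_closedBall_pos volume x₀ hr).ne'
    (measure_ne_top_of_subset hBΩ hA.volume_ne_top)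
  have hcont : ContinuousOn (fun x => H x !₂[S, 0]) B :=
    hA.regular.cont.comp (f := fun x : Plane => (x, (!₂[S, 0] : Plane))) (by fun_prop)
      fun x hx => ⟨hBΩ hx, trivial⟩
  -- H(·,(S,0)) is positive and continuous on a compact ball, so it has a positive minimum there.
  obtain ⟨x₁, hx₁, hmin⟩ := (isCompact_closedBall x₀ r).exists_isMinOn
    ⟨x₀, Metric.mem_closedBall_self hr.le⟩ hcont
  set m := H x₁ !₂[S, 0] with hm
  have hm0 : 0 < m := (hH2 x₁ (hBΩ hx₁) _ (norm_axis hS.le).ge).1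
  obtain ⟨K, hK, hcoer⟩ := H10.exists_norm_le_mul_norm_gradL hA.volume_ne_top
  -- A zero gradient would force w = 0 by Poincaré, although w = 1 on a ball.
  have hq : 0 < ‖H10.gradL Ω w‖ := by
    by_contra! hle
    have h0 : w = 0 := by
      have := hcoer w
      rw [le_antisymm hle (norm_nonneg _), mul_zero] at this
      exact norm_le_zero_iff.1 this
    have h1 : (volume.restrict Ω) B = 0 := by
      refine measure_mono_null (t := {x | ¬ (x ∈ B → w.fn x = 1)} ∪ {x | w.fn x ≠ 0}) ?_
        (measure_union_null hw ?_)
      · intro x hx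
        by_cases h : w.fn x = 0
        · left
          intro h'
          rw [h' hx] at h
          exact one_ne_zero h
        · exact Or.inr h
      · have h2 : w.fn = 0 := by rw [h0]; rfl
        rw [h2]
        exact Lp.coeFn_zero _ _ _
    rw [Measure.restrict_eq_self _ hBΩ] at h1
    exact (Metric.measure_closedBall_pos volume x₀ hr).ne' h1
  set κ : ℝ := lam * (volume.real B * (Real.exp (-(S / M)) * m)) with hκ
  have hκ0 : 0 < κ := by positivity
  have ev1 := eventually_energy_smul_le (H10.gradL Ω) a₁ b₁ θ₁ hκ0 (show 0 < 1 / M by positivity) w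
  have ev2 : ∀ᶠ t : ℝ in atTop, ρ ≤ (t * ‖H10.gradL Ω w‖) ^ 2 :=
    ((tendsto_pow_atTop two_ne_zero).comp
      (tendsto_id.atTop_mul_const hq)).eventually_ge_atTop ρ
  obtain ⟨t, h1, h2, hSt⟩ := (ev1.and (ev2.and (eventually_ge_atTop S))).exists
  have ht0 : 0 ≤ t := hS.le.trans hSt
  set W : H10Sq Ω := WithLp.toLp 2 (t • w, 0) with hW
  have hWfst : W.fst = t • w := rfl
  have hWsnd : W.snd = 0 := rfl
  have hvec : ∀ᵐ x ∂volume.restrict Ω, x ∈ B → vecL Ω W x = !₂[t, 0] := by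
    have e1 : (t • w).fn = t • w.fn := rfl
    filter_upwards [hw, coeFn_vecL W, Lp.coeFn_smul t w.fn,
      Lp.coeFn_zero ℝ 2 (volume.restrict Ω)] with x g1 g2 g3 g4 hxB
    rw [g2, hWfst, hWsnd, e1, g3, Pi.smul_apply, g1 hxB, show (0 : H10 Ω).fn = 0 from rfl, g4]
    simp
  refine ⟨W, ?_, ?_⟩
  · rw [hWfst, hWsnd, map_smul, norm_smul, Real.norm_of_nonneg ht0, map_zero, norm_zero]
    linarith
  · have h3 := hA.mul_exp_le_potential hH1 hS hM (fun x hx W hW => (hH2 x hx W hW).2) hBm hBΩ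
      (fun x hx => hmin hx) hSt hvec
    have h4 : energy (H10.gradL Ω) a₂ b₂ θ₂ (0 : H10 Ω) = 0 := by
      rw [energy, map_zero, norm_zero, zero_pow two_ne_zero, Real.zero_rpow (by linarith)]
      simp
    rw [hWfst, hWsnd, h4, add_zero]
    calc _ ≤ κ * Real.exp (1 / M * t) := h1
      _ = lam * (volume.real B * (Real.exp ((t - S) / M) * m)) := by
        have : (t - S) / M = -(S / M) + 1 / M * t := by ring
        rw [this, Real.exp_add, hκ]
        ring
      _ ≤ _ := by gcongr

set_option maxHeartbeats 2000000 in
/-- The weak form of the Kirchhoff system has a solution of positive energy. -/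
theorem exists_pair_inner_energyGrad_eq (hA : Admissible Ω H) (hne : Ω.Nonempty)
    {a₁ a₂ b₁ b₂ θ₁ θ₂ : ℝ} (ha₁ : 0 < a₁) (ha₂ : 0 < a₂) (hb₁ : 0 < b₁) (hb₂ : 0 < b₂)
    (hθ₁ : 1 < θ₁) (hθ₂ : 1 < θ₂) (hH1 : CondH1 Ω H) (hH2 : CondH2 Ω H)
    (hH2bar : CondH2bar θ₁ θ₂ Ω H) (hSL : CondSL Ω H) {lam : ℝ} (hlam : 0 < lam) :
    ∃ W : H10Sq Ω, lam * potential Ω H W <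
        energy (H10.gradL Ω) a₁ b₁ θ₁ W.fst + energy (H10.gradL Ω) a₂ b₂ θ₂ W.snd ∧
      ∀ Z : H10Sq Ω, inner ℝ (energyGrad (H10.gradL Ω) a₁ b₁ θ₁ W.fst) Z.fst +
        inner ℝ (energyGrad (H10.gradL Ω) a₂ b₂ θ₂ W.snd) Z.snd =
          lam * inner ℝ (superpose Ω H (vecL Ω W)) (vecL Ω Z) := by
  obtain ⟨μ, hμ, R, hR, hAR⟩ := hH2bar
  obtain ⟨K, hK, hcoer⟩ := H10.exists_norm_le_mul_norm_gradL hA.volume_ne_top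
  have hμ₁ : 2 * θ₁ ≤ μ := le_trans (by gcongr; exact le_max_left _ _) hμ
  have hμ₂ : 2 * θ₂ ≤ μ := le_trans (by gcongr; exact le_max_right _ _) hμ
  obtain ⟨C, hC0, hC⟩ := exists_mul_le_inner_gradW_add hA.regular hH1 hA.zero (μ := μ) (R := R)
    (by linarith) fun x hx W hW => (hAR x hx W hW).2
  obtain ⟨W, h1, h2⟩ := exists_kirchhoff_critical_point (A := H10.gradL Ω) (T := vecL Ω)
    ha₁ ha₂ hb₁.le hb₂.le hθ₁ hθ₂ hμ₁ hμ₂ hcoer (P := fun W => lam * potential Ω H W)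
    (N := fun W => lam • superpose Ω H (vecL Ω W)) (C := lam * (C * (volume Ω).toReal))
    (fun W Z => by
      rw [real_inner_smul_left]
      exact (hA.hasDerivAt_potential W Z).const_mul lam)
    (hA.continuous_superpose.const_smul lam)
    (fun W M hW => by
      obtain ⟨y, ns, hns, hy⟩ := hA.exists_subseq_tendsto_superpose W M hW
      exact ⟨lam • y, ns, hns, hy.const_smul lam⟩)
    (fun W => by
      rw [real_inner_smul_left]
      have := mul_le_mul_of_nonneg_left (hA.mul_potential_le hC W) hlam.le
      linarith)
    (by
      have h0 : potential Ω H 0 = 0 := by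
        rw [potential, map_zero]
        refine integral_eq_zero_of_ae ?_
        filter_upwards [Lp.coeFn_zero Plane 2 (volume.restrict Ω),
          ae_restrict_mem hA.measurableSet] with x hx hxΩ
        exact (congrArg (H x) hx).trans (hA.zero x hxΩ)
      rw [h0, mul_zero])
    (fun ε hε => by
      obtain ⟨ρ, hρ, h⟩ := hA.exists_potential_le_of_sum_sq_eq hSL (div_pos hε hlam)
      refine ⟨ρ, hρ, fun W hW => ?_⟩
      have := mul_le_mul_of_nonneg_left (h W hW) hlam.le
      rwa [← mul_assoc, mul_div_cancel₀ _ hlam.ne'] at this)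
    (hA.exists_energy_le_potential hne hH1 hH2 hlam a₁ b₁ θ₁ a₂ b₂ hθ₂)
  refine ⟨W, h1, fun Z => ?_⟩
  rw [h2 Z, real_inner_smul_left]

end Admissible

theorem H10.dnorm_rpow (w : H10 Ω) (θ : ℝ) :
    w.dnorm ^ (2 * (θ - 1)) = (‖gradL Ω w‖ ^ 2) ^ (θ - 1) := by
  rw [gradL_apply, ← dnorm_eq_norm, Real.rpow_mul (show 0 ≤ w.dnorm from Real.sqrt_nonneg _),
    Real.rpow_two]

theorem vecL_eq_zero {W : H10Sq Ω} (hu : W.fst.fn =ᵐ[volume.restrict Ω] 0)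
    (hv : W.snd.fn =ᵐ[volume.restrict Ω] 0) : vecL Ω W = 0 := by
  refine (Lp.eq_zero_iff_ae_eq_zero).2 ?_
  filter_upwards [coeFn_vecL W, hu, hv] with x g1 g2 g3
  refine g1.trans ?_
  have h : ∀ a b : ℝ, a = 0 → b = 0 → (!₂[a, b] : Plane) = 0 := by
    rintro _ _ rfl rfl
    ext i
    fin_cases i <;> rfl
  exact h _ _ g2 g3

theorem pos_energyCoeff {a b : ℝ} (ha : 0 < a) (hb : 0 < b) (t s : ℝ) :
    0 < a + b * (t ^ 2) ^ s := by positivity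

namespace Admissible

set_option maxHeartbeats 1000000 in
theorem isWeakSolution (hA : Admissible Ω H) {a₁ a₂ b₁ b₂ θ₁ θ₂ lam : ℝ} {W : H10Sq Ω}
    (h : ∀ Z : H10Sq Ω, inner ℝ (energyGrad (H10.gradL Ω) a₁ b₁ θ₁ W.fst) Z.fst +
      inner ℝ (energyGrad (H10.gradL Ω) a₂ b₂ θ₂ W.snd) Z.snd =
        lam * inner ℝ (superpose Ω H (vecL Ω W)) (vecL Ω Z)) :
    IsWeakSolution Ω a₁ a₂ b₁ b₂ θ₁ θ₂ lam H W.fst W.snd := by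
  intro φ ψ
  set Z : H10Sq Ω := WithLp.toLp 2 (φ, ψ) with hZ
  have h1 := h Z
  have hi := integrable_inner_of_memLp (hA.memLp_gradW W) (Lp.memLp (vecL Ω Z))
  have hae : (fun x => inner ℝ (gradW H x (vecL Ω W x)) (vecL Ω Z x))
      =ᵐ[volume.restrict Ω] fun x => inner ℝ (!₂[φ.fn x, ψ.fn x] : Plane)
        (gradW H x !₂[W.fst.fn x, W.snd.fn x]) := by
    filter_upwards [coeFn_vecL W, coeFn_vecL Z] with x g1 g2
    exact (real_inner_comm _ _).trans (congrArg₂ (fun p q : Plane => inner ℝ p (gradW H x q)) g2 g1)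
  refine ⟨hi.congr hae, ?_⟩
  rw [hA.inner_superpose, integral_congr_ae hae, inner_energyGrad, inner_energyGrad,
    ← H10.dnorm_rpow, ← H10.dnorm_rpow] at h1
  rw [H10.dirichlet_eq_inner, H10.dirichlet_eq_inner]
  exact h1

set_option maxHeartbeats 1000000 in
-- Nontriviality concerns the functions rather than their gradients. If u = v = 0 a.e., testing the
-- equation with W itself makes both gradients vanish; the energy is then 0, against λ∫H ≥ 0 and
-- positivity of J(W).
theorem isNontrivial (hA : Admissible Ω H) (hH1 : CondH1 Ω H) {a₁ a₂ b₁ b₂ θ₁ θ₂ lam : ℝ}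
    (ha₁ : 0 < a₁) (ha₂ : 0 < a₂) (hb₁ : 0 < b₁) (hb₂ : 0 < b₂) (hθ₁ : 0 < θ₁) (hθ₂ : 0 < θ₂)
    (hlam : 0 ≤ lam) {W : H10Sq Ω}
    (hpos : lam * potential Ω H W <
      energy (H10.gradL Ω) a₁ b₁ θ₁ W.fst + energy (H10.gradL Ω) a₂ b₂ θ₂ W.snd)
    (h : ∀ Z : H10Sq Ω, inner ℝ (energyGrad (H10.gradL Ω) a₁ b₁ θ₁ W.fst) Z.fst +
      inner ℝ (energyGrad (H10.gradL Ω) a₂ b₂ θ₂ W.snd) Z.snd =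
        lam * inner ℝ (superpose Ω H (vecL Ω W)) (vecL Ω Z)) :
    IsNontrivial W.fst W.snd := by
  rintro ⟨hu0, hv0⟩
  have h1 := h W
  rw [vecL_eq_zero hu0 hv0, inner_zero_right, mul_zero, inner_energyGrad, inner_energyGrad,
    real_inner_self_eq_norm_sq, real_inner_self_eq_norm_sq] at h1
  have c1 := pos_energyCoeff ha₁ hb₁ ‖H10.gradL Ω W.fst‖ (θ₁ - 1)
  have c2 := pos_energyCoeff ha₂ hb₂ ‖H10.gradL Ω W.snd‖ (θ₂ - 1)
  obtain ⟨d1, d2⟩ := (add_eq_zero_iff_of_nonneg (mul_nonneg c1.le (sq_nonneg _))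
    (mul_nonneg c2.le (sq_nonneg _))).1 h1
  have n1 := (mul_eq_zero.1 d1).resolve_left c1.ne'
  have n2 := (mul_eq_zero.1 d2).resolve_left c2.ne'
  have hnn : 0 ≤ potential Ω H W := by
    refine integral_nonneg_of_ae ?_
    filter_upwards [ae_restrict_mem hA.measurableSet] with x hx
    exact (hH1 x hx _).1
  rw [energy, energy, n1, n2, Real.zero_rpow hθ₁.ne', Real.zero_rpow hθ₂.ne'] at hpos
  simp only [mul_zero, add_zero] at hpos
  exact absurd hpos (not_lt.2 (mul_nonneg hlam hnn))

end Admissible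

end

end Kirchhoff

end

theorem theorem1p1 (Ω : Set Kirchhoff.Plane) (hΩo : IsOpen Ω) (hΩc : IsConnected Ω)
    (hΩb : Bornology.IsBounded Ω)
    (a₁ a₂ b₁ b₂ θ₁ θ₂ : ℝ) (ha₁ : 0 < a₁) (ha₂ : 0 < a₂) (hb₁ : 0 < b₁) (hb₂ : 0 < b₂)
    (hθ₁ : 1 < θ₁) (hθ₂ : 1 < θ₂)
    (H : Kirchhoff.Plane → Kirchhoff.Plane → ℝ) (hreg : Kirchhoff.Regular Ω H)
    (hu : Kirchhoff.SubcriticalGrowth Ω (Kirchhoff.Hu H))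
    (hv : Kirchhoff.SubcriticalGrowth Ω (Kirchhoff.Hv H))
    (hH1 : Kirchhoff.CondH1 Ω H) (hH2 : Kirchhoff.CondH2 Ω H)
    (hH2bar : Kirchhoff.CondH2bar θ₁ θ₂ Ω H) (hSL : Kirchhoff.CondSL Ω H)
    (lam : ℝ) (hlam : 0 < lam) :
    ∃ u v : Kirchhoff.H10 Ω,
      Kirchhoff.IsWeakSolution Ω a₁ a₂ b₁ b₂ θ₁ θ₂ lam H u v ∧ Kirchhoff.IsNontrivial u v := by
  have hA : Kirchhoff.Admissible Ω H :=
    ⟨hΩo, hΩb, hreg, hu, hv, fun x hx => Kirchhoff.apply_zero_eq_zero hreg hH1 hSL hx⟩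
  obtain ⟨W, hpos, h⟩ := hA.exists_pair_inner_energyGrad_eq hΩc.nonempty ha₁ ha₂ hb₁ hb₂ hθ₁ hθ₂
    hH1 hH2 hH2bar hSL hlam
  exact ⟨W.fst, W.snd, hA.isWeakSolution h, hA.isNontrivial hH1 ha₁ ha₂ hb₁ hb₂ (by linarith)
    (by linarith) hlam.le hpos h⟩
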